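/- Let $(M,g)$ and $(N,h)$ be smooth finite-dimensional Riemannian manifolds (Hausdorff, $\sigma$-compact, without boundary), let $p,q\ge 2$ be real numbers, and let $\varphi:M\to N$ be a smooth map. Let $\tau_p(\varphi)=\operatorname{div}\big(|d\varphi|^{p-2}d\varphi\big)=\operatorname{trace}_g\nabla\big(|d\varphi|^{p-2}d\varphi\big)$ be its $p$-tension field, where $|d\varphi|$ is the Hilbert--Schmidt norm and $\nabla$ is induced by the Levi-Civita connections of $g$ and $h$; for $D\subseteq M$ compact put $$E_{p,q}(\varphi;D)=\frac1q\int_D|\tau_p(\varphi)|^q\,v_g .$$ The map $\varphi$ is called $(p,q)$-harmonic if for every compact $D\subseteq M$ and every smooth variation $(\varphi_t)_{t\in(-\varepsilon,\varepsilon)}$ of $\varphi=\varphi_0$ supported in $D$ (that is, $(t,x)\mapsto\varphi_t(x)$ is smooth and $\varphi_t=\varphi$ outside $D$ for all $t$), the function $t\mapsto E_{p,q}(\varphi_t;D)$ is differentiable at $t=0$ with derivative $0$; it is called bi-$p$-harmonic if the same holds for $E_{p,2}(\varphi;D)=\frac12\int_D|\tau_p(\varphi)|^2\,v_g$. Assume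 that the function $|\tau_p(\varphi)|^{q-2}$ is constant on $M$ (with the convention $s^0=1$ for all $s\ge0$, including $s=0$). Then $\varphi$ is $(p,q)$-harmonic if and only if it is bi-$p$-harmonic. -/

import Mathlib

open Set MeasureTheory Bundle
open scoped Manifold ContDiff

noncomputable section

/-- The `i`-th standard basis vector of `ℝ^m`. -/
def stdVec {m : ℕ} (i : Fin m) : EuclideanSpace ℝ (Fin m) := EuclideanSpace.single i 1

/-- The matrix `G_ij = G(e_i, e_j)` of a bilinear form on `ℝ^m`. -/
def gramMatrix {m : ℕ}
    (G : EuclideanSpace ℝ (Fin m) →L[ℝ] EuclideanSpace ℝ (Fin m) →L[ℝ] ℝ) :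
    Matrix (Fin m) (Fin m) ℝ :=
  Matrix.of fun i j => G (stdVec i) (stdVec j)

/-- The trace `∑ G^ij B(e_i, e_j)` of a bilinear map `B` with respect to an inner product `G`. For
positive definite `G` this is `∑ B(b_i, b_i)` for any `G`-orthonormal basis `b`. -/
def metricTrace {m : ℕ} {F : Type*} [NormedAddCommGroup F] [NormedSpace ℝ F]
    (G : EuclideanSpace ℝ (Fin m) →L[ℝ] EuclideanSpace ℝ (Fin m) →L[ℝ] ℝ)
    (B : EuclideanSpace ℝ (Fin m) → EuclideanSpace ℝ (Fin m) → F) : F :=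
  ∑ i, ∑ j, (gramMatrix G)⁻¹ i j • B (stdVec i) (stdVec j)

/-- Smooth Riemannian metrics on an `m`-dimensional smooth manifold. -/
abbrev SmoothMetric (m : ℕ) (M : Type*) [TopologicalSpace M]
    [ChartedSpace (EuclideanSpace ℝ (Fin m)) M] [IsManifold (𝓡 m) ∞ M] :=
  ContMDiffRiemannianMetric (𝓡 m) ∞ (EuclideanSpace ℝ (Fin m))
    (fun x : M => TangentSpace (𝓡 m) x)

section Chart

variable {m : ℕ} {M : Type*} [TopologicalSpace M] [ChartedSpace (EuclideanSpace ℝ (Fin m)) M]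

/-- The differential at `u` of the inverse of the chart centred at `a`; it sends a coordinate
vector to the tangent vector that it represents. -/
def chartFrame (a : M) (u : EuclideanSpace ℝ (Fin m)) :
    EuclideanSpace ℝ (Fin m) →L[ℝ] TangentSpace (𝓡 m) ((extChartAt (𝓡 m) a).symm u) :=
  mfderiv 𝓘(ℝ, EuclideanSpace ℝ (Fin m)) (𝓡 m) (extChartAt (𝓡 m) a).symm u

variable [IsManifold (𝓡 m) ∞ M]

/-- The metric in the coordinates of the chart centred at `a`, as a function of the coordinate
point `u`: the pull-back of `g` by the inverse chart. -/
def chartMetric (g : SmoothMetric m M) (a : M) (u : EuclideanSpace ℝ (Fin m)) :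
    EuclideanSpace ℝ (Fin m) →L[ℝ] EuclideanSpace ℝ (Fin m) →L[ℝ] ℝ :=
  ContinuousLinearMap.bilinearComp (E := EuclideanSpace ℝ (Fin m))
    (F := EuclideanSpace ℝ (Fin m)) (g.inner ((extChartAt (𝓡 m) a).symm u))
    (chartFrame a u) (chartFrame a u)

/-- The Christoffel symbols of the Levi-Civita connection in the chart centred at `a`, as the
bilinear map `Γ(v, w) = ∑ Γ^k_ij v^i w^j e_k`, where
`Γ^k_ij = 1/2 ∑ g^kl (∂_i g_jl + ∂_j g_il - ∂_l g_ij)`. -/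
def christoffel (g : SmoothMetric m M) (a : M) (u v w : EuclideanSpace ℝ (Fin m)) :
    EuclideanSpace ℝ (Fin m) :=
  ∑ k, ∑ l, ((gramMatrix (chartMetric g a u))⁻¹ k l *
    (1 / 2 * (fderiv ℝ (chartMetric g a) u v w (stdVec l)
      + fderiv ℝ (chartMetric g a) u w v (stdVec l)
      - fderiv ℝ (chartMetric g a) u (stdVec l) v w))) • stdVec k

variable [MeasurableSpace M]

/-- The Riemannian measure `√(det g_ij) du` of the domain of the chart centred at `a`, extended by
zero to `M`. -/
def chartVolume (g : SmoothMetric m M) (a : M) : Measure M :=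
  Measure.map (extChartAt (𝓡 m) a).symm
    ((volume.restrict (extChartAt (𝓡 m) a).target).withDensity
      fun u => ENNReal.ofReal (Real.sqrt (gramMatrix (chartMetric g a u)).det))

variable [T2Space M] [SigmaCompactSpace M]

/-- A smooth partition of unity on `M` subordinate to the chart domains. -/
def chartPartition (m : ℕ) (M : Type*) [TopologicalSpace M]
    [ChartedSpace (EuclideanSpace ℝ (Fin m)) M] [IsManifold (𝓡 m) ∞ M] [T2Space M]
    [SigmaCompactSpace M] : SmoothPartitionOfUnity M (𝓡 m) M univ :=
  (SmoothPartitionOfUnity.exists_isSubordinate_chartAt_source (𝓡 m) M).choose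

/-- The Riemannian measure `v_g`, glued from the measures `√(det g_ij) du` in charts by a smooth
partition of unity: `∫ f v_g = ∑_a ∫ ρ_a f √(det g_ij) du`. -/
def riemannianVolume (g : SmoothMetric m M) : Measure M :=
  Measure.sum fun a : M =>
    (chartVolume g a).withDensity fun x => ENNReal.ofReal (chartPartition m M a x)

end Chart

section Maps

variable {m n : ℕ}
  {M : Type*} [TopologicalSpace M] [ChartedSpace (EuclideanSpace ℝ (Fin m)) M]
  [IsManifold (𝓡 m) ∞ M]
  {N : Type*} [TopologicalSpace N] [ChartedSpace (EuclideanSpace ℝ (Fin n)) N]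
  [IsManifold (𝓡 n) ∞ N]

/-- The Hilbert-Schmidt norm `|dφ|` at `x`: `|dφ|² = ∑ g^ij h(dφ(e_i), dφ(e_j))`. -/
def differentialNorm (g : SmoothMetric m M) (h : SmoothMetric n N) (φ : M → N) (x : M) : ℝ :=
  Real.sqrt (metricTrace (g.inner x) fun v w =>
    h.inner (φ x) (mfderiv (𝓡 m) (𝓡 n) φ x v) (mfderiv (𝓡 m) (𝓡 n) φ x w))

/-- The map `φ` in the charts centred at `a` and `b`. -/
def chartMap (a : M) (b : N) (φ : M → N) (u : EuclideanSpace ℝ (Fin m)) :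
    EuclideanSpace ℝ (Fin n) :=
  extChartAt (𝓡 n) b (φ ((extChartAt (𝓡 m) a).symm u))

/-- The `φ⁻¹TN`-valued one-form `|dφ|^(p-2) dφ` in the charts centred at `a` and `b`. -/
def chartPForm (g : SmoothMetric m M) (h : SmoothMetric n N) (p : ℝ) (a : M) (b : N) (φ : M → N)
    (u : EuclideanSpace ℝ (Fin m)) : EuclideanSpace ℝ (Fin m) →L[ℝ] EuclideanSpace ℝ (Fin n) :=
  differentialNorm g h φ ((extChartAt (𝓡 m) a).symm u) ^ (p - 2) • fderiv ℝ (chartMap a b φ) u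

/-- The covariant derivative of `ω = |dφ|^(p-2) dφ` in the charts centred at `a` and `b`:
`(∇_v ω)(w) = ∂_v (ω(w)) - ω(Γ^M(v, w)) + Γ^N(dφ(v), ω(w))` for constant coordinate
vectors `v`, `w`. -/
def chartCovDerivPForm (g : SmoothMetric m M) (h : SmoothMetric n N) (p : ℝ) (a : M) (b : N)
    (φ : M → N) (u v w : EuclideanSpace ℝ (Fin m)) : EuclideanSpace ℝ (Fin n) :=
  fderiv ℝ (chartPForm g h p a b φ) u v w
    - chartPForm g h p a b φ u (christoffel g a u v w)
    + christoffel h b (chartMap a b φ u) (fderiv ℝ (chartMap a b φ) u v)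
        (chartPForm g h p a b φ u w)

/-- The coordinates of `div (|dφ|^(p-2) dφ) = trace ∇ (|dφ|^(p-2) dφ)` in the charts centred at
`a` and `b`, at the coordinate point `u`. -/
def chartPTension (g : SmoothMetric m M) (h : SmoothMetric n N) (p : ℝ) (a : M) (b : N)
    (φ : M → N) (u : EuclideanSpace ℝ (Fin m)) : EuclideanSpace ℝ (Fin n) :=
  metricTrace (chartMetric g a u) (chartCovDerivPForm g h p a b φ u)

/-- The `p`-tension field `τ_p(φ) = div (|dφ|^(p-2) dφ)`, a vector field along `φ`. It is computed
at `x` in the charts centred at `x` and `φ x`; a vector of `TangentSpace (𝓡 n) (φ x)` is given by its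
coordinates in the chart centred at `φ x`. -/
def pTension (g : SmoothMetric m M) (h : SmoothMetric n N) (p : ℝ) (φ : M → N) (x : M) :
    TangentSpace (𝓡 n) (φ x) :=
  chartPTension g h p x (φ x) φ (extChartAt (𝓡 m) x x)

/-- The norm `|τ_p(φ)|` of the `p`-tension field at `x`. -/
def pTensionNorm (g : SmoothMetric m M) (h : SmoothMetric n N) (p : ℝ) (φ : M → N) (x : M) : ℝ :=
  Real.sqrt (h.inner (φ x) (pTension g h p φ x) (pTension g h p φ x))

/-- `Φ` is a smooth variation `(φ_t)` of `φ`, for `t ∈ (-ε, ε)`, supported in `D`. -/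
structure IsVariation (φ : M → N) (D : Set M) (ε : ℝ) (Φ : ℝ → M → N) : Prop where
  smooth : ContMDiffOn (𝓘(ℝ, ℝ).prod (𝓡 m)) (𝓡 n) ∞ (fun z : ℝ × M => Φ z.1 z.2)
    (Ioo (-ε) ε ×ˢ univ)
  initial : ∀ x, Φ 0 x = φ x
  support : ∀ t ∈ Ioo (-ε) ε, ∀ x ∉ D, Φ t x = φ x

/-- `φ` is a critical point of the functional `En(·; D)` for every compact `D ⊆ M`: for all
smooth variations of `φ` supported in `D`, `En(φ_t; D)` has derivative zero at `t = 0`. -/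
def IsCriticalPoint (m n : ℕ) {M : Type*} [TopologicalSpace M]
    [ChartedSpace (EuclideanSpace ℝ (Fin m)) M]
    {N : Type*} [TopologicalSpace N] [ChartedSpace (EuclideanSpace ℝ (Fin n)) N]
    (En : (M → N) → Set M → ℝ) (φ : M → N) : Prop :=
  ∀ D : Set M, IsCompact D → ∀ ε > 0, ∀ Φ : ℝ → M → N,
    IsVariation (m := m) (n := n) φ D ε Φ → HasDerivAt (fun t => En (Φ t) D) 0 0

variable [MeasurableSpace M] [T2Space M] [SigmaCompactSpace M]

/-- The `(p, q)`-energy `E_{p,q}(φ; D) = (1/q) ∫_D |τ_p(φ)|^q v_g`. -/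
def pqEnergy (g : SmoothMetric m M) (h : SmoothMetric n N) (p q : ℝ) (φ : M → N) (D : Set M) :
    ℝ :=
  1 / q * ∫ x in D, pTensionNorm g h p φ x ^ q ∂(riemannianVolume g)

/-- The bi-`p`-energy `E_{p,2}(φ; D) = (1/2) ∫_D |τ_p(φ)|² v_g`. -/
def biPEnergy (g : SmoothMetric m M) (h : SmoothMetric n N) (p : ℝ) (φ : M → N) (D : Set M) : ℝ :=
  1 / 2 * ∫ x in D, pTensionNorm g h p φ x ^ 2 ∂(riemannianVolume g)

/-- `(p, q)`-harmonic maps are the critical points of the `(p, q)`-energy. -/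
def IsPQHarmonic (g : SmoothMetric m M) (h : SmoothMetric n N) (p q : ℝ) (φ : M → N) : Prop :=
  IsCriticalPoint m n (pqEnergy g h p q) φ

/-- Bi-`p`-harmonic maps are the critical points of the bi-`p`-energy. -/
def IsBiPHarmonic (g : SmoothMetric m M) (h : SmoothMetric n N) (p : ℝ) (φ : M → N) : Prop :=
  IsCriticalPoint m n (biPEnergy g h p) φ

end Maps

end

/-!
Let `|τ_p(φ)|` be the constant `s`.

If `s > 0`, then `|τ_p(φ_t)|² = s² + O(t)` uniformly on compact sets: for `p > 2` the `p`-tension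
field vanishes wherever the differential does, so `dφ` has no zeros and `|τ_p(φ_t)|²` is smooth. As
`y ↦ y^(q/2) / q - s^(q-r) y^(r/2) / r` has derivative zero at `s²`, the first variation of
`E_{p,q}` is `s^(q-r)` times that of `E_{p,r}`.

If `s = 0`, then both first variations vanish, because `∫_D |τ_p(φ_t)|² = O(|t|^(2-γ))` for some
`γ < 1`. For `2 < p < 3` the field `τ_p(φ_t)` need not be Lipschitz in `t` at the zeros of `dφ`, but
comparing `|dφ|` with `|t|` gives
`|τ_p(φ_t)|² ≤ C |t|^(2-γ) (1 + (t² + |dφ|²)^(-γ/2) |∂²φ|²)` in coordinates, and the integral of the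
right-hand factor is bounded uniformly in `t`: for a first derivative `f` of `φ` the weight
`(ε + f²)^(-γ/2)` is at most `(1 - γ)⁻¹` times the derivative of `f ↦ f (ε + f²)^(-γ/2)`, so
`∫ (ε + f²)^(-γ/2) |∂f|²` can be integrated by parts.
-/

noncomputable section

/-- The coordinate space `ℝ^m`. -/
abbrev Coord (m : ℕ) : Type := EuclideanSpace ℝ (Fin m)

/-- Continuous bilinear forms on `ℝ^m`. -/
abbrev Bilin (m : ℕ) : Type := Coord m →L[ℝ] Coord m →L[ℝ] ℝ

-- Shortcuts: the search for these two instances on nested spaces of maps otherwise times out.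
instance {m : ℕ} : NormedAddCommGroup (Bilin m) := inferInstance

instance {m : ℕ} : NormedSpace ℝ (Bilin m) := inferInstance

section LinearAlgebra

variable {m n : ℕ} {F : Type*} [NormedAddCommGroup F] [NormedSpace ℝ F]

/-- The bilinear form `G` is an inner product on `ℝ^m`. -/
structure IsInnerForm (G : Bilin m) : Prop where
  symm : ∀ v w, G v w = G w v
  pos : ∀ v, v ≠ 0 → 0 < G v v

/-- The vectors `b 1, …, b m` are orthonormal for `G`. Traces with respect to `G` are computed in
such frames. -/
def IsOrthonormalFrame (G : Bilin m) (b : Fin m → Coord m) : Prop :=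
  ∀ i j, G (b i) (b j) = if i = j then 1 else 0

theorem sum_coord_smul_stdVec (v : Coord m) : ∑ i, v i • stdVec i = v := by
  simpa [stdVec] using (EuclideanSpace.basisFun (Fin m) ℝ).sum_repr v

theorem apply_eq_sum_gramMatrix (G : Bilin m) (v w : Coord m) :
    G v w = ∑ i, v i * ∑ j, gramMatrix G i j * w j := by
  conv_lhs => rw [← sum_coord_smul_stdVec v, ← sum_coord_smul_stdVec w]
  simp only [map_sum, map_smul, sum_apply, smul_apply, smul_eq_mul, gramMatrix, Matrix.of_apply]
  simp only [Finset.mul_sum]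
  rw [Finset.sum_comm]
  simp only [mul_comm, mul_left_comm]

theorem metricTrace_add (G : Bilin m) (B C : Coord m → Coord m → F) :
    metricTrace G (fun v w => B v w + C v w) = metricTrace G B + metricTrace G C := by
  simp only [metricTrace, smul_add, Finset.sum_add_distrib]

theorem metricTrace_smul (G : Bilin m) (c : ℝ) (B : Coord m → Coord m → F) :
    metricTrace G (fun v w => c • B v w) = c • metricTrace G B := by
  simp only [metricTrace, Finset.smul_sum, smul_comm c]

theorem map_metricTrace {F' : Type*} [NormedAddCommGroup F'] [NormedSpace ℝ F'] (L : F →L[ℝ] F')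
    (G : Bilin m) (B : Coord m → Coord m → F) :
    L (metricTrace G B) = metricTrace G fun v w => L (B v w) := by
  simp only [metricTrace, map_sum, map_smul]

namespace IsInnerForm

variable {G : Bilin m}

theorem nonneg (hG : IsInnerForm G) (v : Coord m) : 0 ≤ G v v := by
  rcases eq_or_ne v 0 with rfl | hv
  · simp
  · exact (hG.pos v hv).le

theorem eq_zero (hG : IsInnerForm G) {v : Coord m} (h : G v v = 0) : v = 0 :=
  by_contra fun hv => (hG.pos v hv).ne' h

theorem eq_of_forall (hG : IsInnerForm G) {v w : Coord m} (h : ∀ z, G v z = G w z) : v = w :=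
  sub_eq_zero.1 (hG.eq_zero (by simpa [sub_eq_zero] using h (v - w)))

theorem bilinearComp (hG : IsInnerForm G) {L : Coord m →L[ℝ] Coord m}
    (hL : Function.Injective L) : IsInnerForm (G.bilinearComp L L) where
  symm _ _ := hG.symm _ _
  pos _ hv := hG.pos _ ((map_ne_zero_iff L hL).2 hv)

theorem posDef_gramMatrix (hG : IsInnerForm G) : (gramMatrix G).PosDef := by
  refine .of_dotProduct_mulVec_pos ?_ fun x hx => ?_
  · ext i j
    simp [gramMatrix, hG.symm (stdVec j) (stdVec i)]
  · have h := hG.pos (WithLp.toLp 2 x) (by simpa using hx)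
    rwa [apply_eq_sum_gramMatrix] at h

theorem isUnit_det (hG : IsInnerForm G) : IsUnit (gramMatrix G).det :=
  (Matrix.isUnit_iff_isUnit_det _).1 hG.posDef_gramMatrix.isUnit

open scoped MatrixOrder ComplexOrder in
theorem exists_isOrthonormalFrame (hG : IsInnerForm G) : ∃ b, IsOrthonormalFrame G b := by
  obtain ⟨S, hS, hGS⟩ := CStarAlgebra.isStrictlyPositive_iff_eq_star_mul_self.mp
    hG.posDef_gramMatrix.isStrictlyPositive
  have hdet : IsUnit S.det := (Matrix.isUnit_iff_isUnit_det S).1 hS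
  have hone : (S⁻¹).transpose * (gramMatrix G * S⁻¹) = 1 := by
    rw [hGS, Matrix.star_eq_conjTranspose, Matrix.conjTranspose_eq_transpose_of_trivial,
      Matrix.mul_assoc, Matrix.mul_nonsing_inv S hdet, Matrix.mul_one, ← Matrix.transpose_mul,
      Matrix.mul_nonsing_inv S hdet, Matrix.transpose_one]
  refine ⟨fun j => WithLp.toLp 2 fun i => S⁻¹ i j, fun i j => ?_⟩
  rw [apply_eq_sum_gramMatrix, ← Matrix.one_apply, ← hone]
  simp only [Matrix.mul_apply, Matrix.transpose_apply]

end IsInnerForm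

namespace IsOrthonormalFrame

variable {G : Bilin m} {b : Fin m → Coord m}

theorem map {L : Coord m →L[ℝ] Coord m} (hb : IsOrthonormalFrame (G.bilinearComp L L) b) :
    IsOrthonormalFrame G fun k => L (b k) := hb

theorem sum_apply_smul (hb : IsOrthonormalFrame G b) (v : Coord m) :
    ∑ k, G v (b k) • b k = v := by
  have hcoeff (c : Fin m → ℝ) (k : Fin m) : G (∑ j, c j • b j) (b k) = c k := by
    simp [hb _ k]
  have hli : LinearIndependent ℝ b :=
    Fintype.linearIndependent_iff.2 fun c hc k => by simpa [hc] using (hcoeff c k).symm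
  let β := Module.Basis.mk hli (hli.span_eq_top_of_card_eq_finrank' (by simp)).ge
  have hv : ∑ k, β.repr v k • b k = v := by simpa [β] using β.sum_repr v
  conv_rhs => rw [← hv]
  refine Finset.sum_congr rfl fun k _ => ?_
  conv_lhs => rw [← hv, hcoeff]

theorem inv_gramMatrix (hb : IsOrthonormalFrame G b) (i j : Fin m) :
    (gramMatrix G)⁻¹ i j = ∑ k, b k i * b k j := by
  let X : Matrix (Fin m) (Fin m) ℝ := Matrix.of fun i k => b k i
  have hX : X.transpose * (gramMatrix G * X) = 1 := by
    ext i j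
    rw [Matrix.one_apply, ← hb i j, apply_eq_sum_gramMatrix]
    simp only [Matrix.mul_apply, Matrix.transpose_apply, X, Matrix.of_apply]
  have hinv : gramMatrix G * (X * X.transpose) = 1 := by
    rw [← Matrix.mul_assoc]
    exact mul_eq_one_comm.1 hX
  rw [Matrix.inv_eq_right_inv hinv]
  simp only [Matrix.mul_apply, Matrix.transpose_apply, X, Matrix.of_apply]

theorem metricTrace_eq (hb : IsOrthonormalFrame G b) (B : Coord m →ₗ[ℝ] Coord m →ₗ[ℝ] F) :
    metricTrace G (fun v w => B v w) = ∑ k, B (b k) (b k) := by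
  have hB (k : Fin m) : B (b k) (b k) = ∑ i, ∑ j, (b k i * b k j) • B (stdVec i) (stdVec j) := by
    conv_lhs => rw [← sum_coord_smul_stdVec (b k)]
    simp only [map_sum, map_smul, LinearMap.sum_apply, LinearMap.smul_apply, Finset.smul_sum,
      smul_smul]
    rw [Finset.sum_comm]
    simp only [mul_comm]
  simp only [metricTrace, hb.inv_gramMatrix, hB, Finset.sum_smul]
  calc ∑ i, ∑ j, ∑ k, (b k i * b k j) • B (stdVec i) (stdVec j)
      = ∑ i, ∑ k, ∑ j, (b k i * b k j) • B (stdVec i) (stdVec j) :=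
        Finset.sum_congr rfl fun i _ => Finset.sum_comm
    _ = _ := Finset.sum_comm

end IsOrthonormalFrame

theorem metricTrace_comp {G : Bilin m} (hG : IsInnerForm G) {L : Coord m →L[ℝ] Coord m}
    (hL : Function.Injective L) (B : Coord m →ₗ[ℝ] Coord m →ₗ[ℝ] F) :
    metricTrace (G.bilinearComp L L) (fun v w => B (L v) (L w)) =
      metricTrace G fun v w => B v w := by
  obtain ⟨b, hb⟩ := (hG.bilinearComp hL).exists_isOrthonormalFrame
  rw [hb.map.metricTrace_eq B]
  exact hb.metricTrace_eq (B.compl₁₂ (L : Coord m →ₗ[ℝ] Coord m) (L : Coord m →ₗ[ℝ] Coord m))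

theorem IsOrthonormalFrame.metricTrace_pullback {G : Bilin m} {b : Fin m → Coord m}
    (hb : IsOrthonormalFrame G b) (H : Bilin n) (A : Coord m →L[ℝ] Coord n) :
    metricTrace G (fun v w => H (A v) (A w)) = ∑ k, H (A (b k)) (A (b k)) :=
  hb.metricTrace_eq (H.bilinearComp A A).toLinearMap₁₂

theorem metricTrace_pullback_nonneg {G : Bilin m} {H : Bilin n} (hG : IsInnerForm G)
    (hH : IsInnerForm H) (A : Coord m →L[ℝ] Coord n) :
    0 ≤ metricTrace G fun v w => H (A v) (A w) := by
  obtain ⟨b, hb⟩ := hG.exists_isOrthonormalFrame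
  rw [hb.metricTrace_pullback]
  exact Finset.sum_nonneg fun k _ => hH.nonneg _

theorem metricTrace_pullback_eq_zero {G : Bilin m} {H : Bilin n} (hG : IsInnerForm G)
    (hH : IsInnerForm H) {A : Coord m →L[ℝ] Coord n}
    (h : metricTrace G (fun v w => H (A v) (A w)) = 0) : A = 0 := by
  obtain ⟨b, hb⟩ := hG.exists_isOrthonormalFrame
  rw [hb.metricTrace_pullback, Finset.sum_eq_zero_iff_of_nonneg fun k _ => hH.nonneg _] at h
  ext1 v
  rw [← hb.sum_apply_smul v]
  simp [fun k => hH.eq_zero (h k (Finset.mem_univ k))]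

theorem IsInnerForm.apply_metricTrace_smul {G : Bilin m} (hG : IsInnerForm G)
    (K : Coord m →ₗ[ℝ] ℝ) (z : Coord m) : G (metricTrace G fun v w => K w • v) z = K z := by
  obtain ⟨b, hb⟩ := hG.exists_isOrthonormalFrame
  have htrace : metricTrace G (fun v w => K w • v) = ∑ k, K (b k) • b k :=
    hb.metricTrace_eq (LinearMap.lsmul ℝ (Coord m) ∘ₗ K).flip
  conv_rhs => rw [← hb.sum_apply_smul z]
  simp only [htrace, map_sum, map_smul, sum_apply, smul_apply, smul_eq_mul, hG.symm z, mul_comm]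

end LinearAlgebra

section CoordinateGeometry

open Filter Topology

variable {m n : ℕ}

/-- The covector `z ↦ ½ (D v w z + D w v z - D z v w)`. For `D` the derivative of a metric it is the
covector `⟨∇_v w, ·⟩` given by the Koszul formula for constant vector fields `v`, `w`. -/
def koszulForm (D : Coord m →L[ℝ] Bilin m) (v w : Coord m) : Coord m →L[ℝ] ℝ :=
  (1 / 2 : ℝ) • (D v w + D w v - (D.flip v).flip w)

theorem koszulForm_apply (D : Coord m →L[ℝ] Bilin m) (v w z : Coord m) :
    koszulForm D v w z = 1 / 2 * (D v w z + D w v z - D z v w) := rfl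

/-- The Christoffel symbols of a metric on an open subset of `ℝ^m`, as a bilinear map. The trace
raises the index of the Koszul covector. -/
def coordChristoffel (G : Coord m → Bilin m) (u : Coord m) :
    Coord m →ₗ[ℝ] Coord m →ₗ[ℝ] Coord m :=
  LinearMap.mk₂ ℝ (fun v w => metricTrace (G u) fun e e' => koszulForm (fderiv ℝ G u) v w e' • e)
    (fun v v' w => by
      rw [← metricTrace_add]
      congr! 3 with e e'
      simp only [koszulForm_apply, map_add, add_apply, ← add_smul]
      ring_nf)
    (fun c v w => by
      rw [← metricTrace_smul]
      congr! 3 with e e'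
      simp only [koszulForm_apply, map_smul, smul_apply, smul_smul, smul_eq_mul]
      ring_nf)
    (fun v w w' => by
      rw [← metricTrace_add]
      congr! 3 with e e'
      simp only [koszulForm_apply, map_add, add_apply, ← add_smul]
      ring_nf)
    (fun c v w => by
      rw [← metricTrace_smul]
      congr! 3 with e e'
      simp only [koszulForm_apply, map_smul, smul_apply, smul_smul, smul_eq_mul]
      ring_nf)

theorem coordChristoffel_apply (G : Coord m → Bilin m) (u v w : Coord m) :
    coordChristoffel G u v w =
      metricTrace (G u) fun e e' => koszulForm (fderiv ℝ G u) v w e' • e := rfl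

/-- The covariant derivative of a one-form `σ` along the map `f`, in coordinates. -/
def coordCov (G : Coord m → Bilin m) (H : Coord n → Bilin n) (f : Coord m → Coord n)
    (σ : Coord m → Coord m →L[ℝ] Coord n) (u : Coord m) : Coord m →ₗ[ℝ] Coord m →ₗ[ℝ] Coord n :=
  (fderiv ℝ σ u).toLinearMap₁₂ - (coordChristoffel G u).compr₂ (σ u : Coord m →ₗ[ℝ] Coord n)
    + (coordChristoffel H (f u)).compl₁₂ (fderiv ℝ f u : Coord m →ₗ[ℝ] Coord n)
      (σ u : Coord m →ₗ[ℝ] Coord n)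

theorem coordCov_apply (G : Coord m → Bilin m) (H : Coord n → Bilin n) (f : Coord m → Coord n)
    (σ : Coord m → Coord m →L[ℝ] Coord n) (u v w : Coord m) :
    coordCov G H f σ u v w = fderiv ℝ σ u v w - σ u (coordChristoffel G u v w)
      + coordChristoffel H (f u) (fderiv ℝ f u v) (σ u w) := rfl

/-- The pull-back of a metric by a map `ψ`. -/
def pullMetric (ψ : Coord m → Coord m) (G : Coord m → Bilin m) (u : Coord m) : Bilin m :=
  (G (ψ u)).bilinearComp (fderiv ℝ ψ u) (fderiv ℝ ψ u)

theorem IsInnerForm.apply_coordChristoffel {G : Coord m → Bilin m} {u : Coord m}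
    (hG : IsInnerForm (G u)) (v w z : Coord m) :
    G u (coordChristoffel G u v w) z = koszulForm (fderiv ℝ G u) v w z :=
  hG.apply_metricTrace_smul (koszulForm (fderiv ℝ G u) v w : Coord m →ₗ[ℝ] ℝ) z

theorem coordChristoffel_congr {G G' : Coord m → Bilin m} {u : Coord m} (h : G =ᶠ[𝓝 u] G') :
    coordChristoffel G u = coordChristoffel G' u := by
  ext1 v
  ext1 w
  simp only [coordChristoffel_apply, h.fderiv_eq, h.eq_of_nhds]

section ChangeOfCoordinates

variable {G : Coord m → Bilin m} {ψ : Coord m → Coord m} {u : Coord m}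

theorem hasFDerivAt_pullMetric_apply (hψ : ContDiffAt ℝ 2 ψ u) (hG : DifferentiableAt ℝ G (ψ u))
    (w z : Coord m) :
    HasFDerivAt (fun x => pullMetric ψ G x w z)
      ((((fderiv ℝ G (ψ u)).comp (fderiv ℝ ψ u)).flip (fderiv ℝ ψ u w)).flip (fderiv ℝ ψ u z)
        + ((G (ψ u)).flip (fderiv ℝ ψ u z)).comp ((fderiv ℝ (fderiv ℝ ψ) u).flip w)
        + (G (ψ u) (fderiv ℝ ψ u w)).comp ((fderiv ℝ (fderiv ℝ ψ) u).flip z)) u := by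
  have hψ₁ : HasFDerivAt ψ (fderiv ℝ ψ u) u := (hψ.differentiableAt (by norm_num)).hasFDerivAt
  have hψ₂ (y : Coord m) :
      HasFDerivAt (fun x => fderiv ℝ ψ x y) ((fderiv ℝ (fderiv ℝ ψ) u).flip y) u := by
    have hd : DifferentiableAt ℝ (fderiv ℝ ψ) u :=
      (hψ.fderiv_right (m := 1) (by norm_num)).differentiableAt (by norm_num)
    simpa using hd.hasFDerivAt.clm_apply (hasFDerivAt_const y u)
  have hd := ((hG.hasFDerivAt.comp u hψ₁).clm_apply (hψ₂ w)).clm_apply (hψ₂ z)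
  refine hd.congr_fderiv ?_
  ext v
  simp
  ring

theorem differentiableAt_pullMetric (hψ : ContDiffAt ℝ 2 ψ u) (hG : DifferentiableAt ℝ G (ψ u)) :
    DifferentiableAt ℝ (pullMetric ψ G) u := by
  have hψ₁ : DifferentiableAt ℝ ψ u := hψ.differentiableAt (by norm_num)
  have hψ₂ : DifferentiableAt ℝ (fderiv ℝ ψ) u :=
    (hψ.fderiv_right (m := 1) (by norm_num)).differentiableAt (by norm_num)
  have _hGψ : DifferentiableAt ℝ (fun x => G (ψ x)) u := hG.comp u hψ₁
  change DifferentiableAt ℝ (fun x => ((ContinuousLinearMap.compL ℝ (Coord m) (Coord m) ℝ).flip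
    (fderiv ℝ ψ x)).comp ((G (ψ x)).comp (fderiv ℝ ψ x))) u
  fun_prop

theorem fderiv_pullMetric (hψ : ContDiffAt ℝ 2 ψ u) (hG : DifferentiableAt ℝ G (ψ u))
    (v w z : Coord m) :
    fderiv ℝ (pullMetric ψ G) u v w z =
      fderiv ℝ G (ψ u) (fderiv ℝ ψ u v) (fderiv ℝ ψ u w) (fderiv ℝ ψ u z)
        + G (ψ u) (fderiv ℝ (fderiv ℝ ψ) u v w) (fderiv ℝ ψ u z)
        + G (ψ u) (fderiv ℝ ψ u w) (fderiv ℝ (fderiv ℝ ψ) u v z) := by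
  have hd := ((differentiableAt_pullMetric hψ hG).hasFDerivAt.clm_apply
    (hasFDerivAt_const w u)).clm_apply (hasFDerivAt_const z u)
  have h := DFunLike.congr_fun (hd.unique (hasFDerivAt_pullMetric_apply hψ hG w z)) v
  simpa using h

theorem fderiv_coordChristoffel_pullMetric (hψ : ContDiffAt ℝ 2 ψ u)
    (hG : DifferentiableAt ℝ G (ψ u)) (hI : IsInnerForm (G (ψ u)))
    (hb : Function.Bijective (fderiv ℝ ψ u)) (v w : Coord m) :
    fderiv ℝ ψ u (coordChristoffel (pullMetric ψ G) u v w) =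
      coordChristoffel G (ψ u) (fderiv ℝ ψ u v) (fderiv ℝ ψ u w)
        + fderiv ℝ (fderiv ℝ ψ) u v w := by
  have hI' : IsInnerForm (pullMetric ψ G u) := hI.bilinearComp hb.1
  have hsymm : ∀ a b, fderiv ℝ (fderiv ℝ ψ) u a b = fderiv ℝ (fderiv ℝ ψ) u b a :=
    hψ.isSymmSndFDerivAt (by simp)
  refine hI.eq_of_forall fun z' => ?_
  obtain ⟨z, rfl⟩ := hb.2 z'
  change pullMetric ψ G u (coordChristoffel (pullMetric ψ G) u v w) z = _
  rw [hI'.apply_coordChristoffel, map_add, add_apply, hI.apply_coordChristoffel, koszulForm_apply,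
    koszulForm_apply, fderiv_pullMetric hψ hG, fderiv_pullMetric hψ hG, fderiv_pullMetric hψ hG,
    hsymm w v, hsymm z v, hsymm z w, hI.symm (fderiv ℝ (fderiv ℝ ψ) u v z)]
  ring

theorem coordCov_comp_source {G' : Coord m → Bilin m} {H : Coord n → Bilin n}
    {f f' : Coord m → Coord n} {σ σ' : Coord m → Coord m →L[ℝ] Coord n}
    (hψ : ContDiffAt ℝ 2 ψ u) (hG : DifferentiableAt ℝ G (ψ u)) (hI : IsInnerForm (G (ψ u)))
    (hb : Function.Bijective (fderiv ℝ ψ u)) (hf : DifferentiableAt ℝ f (ψ u))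
    (hσ : DifferentiableAt ℝ σ (ψ u)) (hG' : G' =ᶠ[𝓝 u] pullMetric ψ G)
    (hf' : f' =ᶠ[𝓝 u] f ∘ ψ) (hσ' : σ' =ᶠ[𝓝 u] fun x => (σ (ψ x)).comp (fderiv ℝ ψ x))
    (v w : Coord m) :
    coordCov G' H f' σ' u v w = coordCov G H f σ (ψ u) (fderiv ℝ ψ u v) (fderiv ℝ ψ u w) := by
  have hψ₁ : DifferentiableAt ℝ ψ u := hψ.differentiableAt (by norm_num)
  have hψ₂ : DifferentiableAt ℝ (fderiv ℝ ψ) u :=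
    (hψ.fderiv_right (m := 1) (by norm_num)).differentiableAt (by norm_num)
  have hd : HasFDerivAt (fun x => (σ (ψ x)).comp (fderiv ℝ ψ x)) _ u :=
    (hσ.hasFDerivAt.comp u hψ₁.hasFDerivAt).clm_comp hψ₂.hasFDerivAt
  simp only [coordCov_apply, coordChristoffel_congr hG', hσ'.fderiv_eq, hf'.fderiv_eq,
    hσ'.eq_of_nhds, hf'.eq_of_nhds, fderiv_comp u hf hψ₁, hd.fderiv,
    ContinuousLinearMap.comp_apply, fderiv_coordChristoffel_pullMetric hψ hG hI hb, map_add,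
    Function.comp_apply, add_apply, ContinuousLinearMap.compL_apply,
    ContinuousLinearMap.flip_apply]
  abel

theorem coordCov_comp_target {H H' : Coord n → Bilin n} {f f' : Coord m → Coord n}
    {σ σ' : Coord m → Coord m →L[ℝ] Coord n} {χ : Coord n → Coord n}
    (hχ : ContDiffAt ℝ 2 χ (f u)) (hH' : DifferentiableAt ℝ H' (χ (f u)))
    (hI : IsInnerForm (H' (χ (f u)))) (hb : Function.Bijective (fderiv ℝ χ (f u)))
    (hf : DifferentiableAt ℝ f u) (hσ : DifferentiableAt ℝ σ u)
    (hH : H =ᶠ[𝓝 (f u)] pullMetric χ H') (hf' : f' =ᶠ[𝓝 u] χ ∘ f)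
    (hσ' : σ' =ᶠ[𝓝 u] fun x => (fderiv ℝ χ (f x)).comp (σ x)) (v w : Coord m) :
    coordCov G H' f' σ' u v w = fderiv ℝ χ (f u) (coordCov G H f σ u v w) := by
  have hχ₁ : DifferentiableAt ℝ χ (f u) := hχ.differentiableAt (by norm_num)
  have hχ₂ : DifferentiableAt ℝ (fderiv ℝ χ) (f u) :=
    (hχ.fderiv_right (m := 1) (by norm_num)).differentiableAt (by norm_num)
  have hd : HasFDerivAt (fun x => (fderiv ℝ χ (f x)).comp (σ x)) _ u :=
    (hχ₂.hasFDerivAt.comp u hf.hasFDerivAt).clm_comp hσ.hasFDerivAt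
  simp only [coordCov_apply, coordChristoffel_congr hH, hσ'.fderiv_eq, hf'.fderiv_eq,
    hσ'.eq_of_nhds, hf'.eq_of_nhds, fderiv_comp u hχ₁ hf, hd.fderiv, map_add, map_sub,
    fderiv_coordChristoffel_pullMetric hχ hH' hI hb, Function.comp_apply,
    ContinuousLinearMap.comp_apply, add_apply, ContinuousLinearMap.compL_apply,
    ContinuousLinearMap.flip_apply]
  abel

end ChangeOfCoordinates

end CoordinateGeometry

section ChartGeometry

open Filter Topology

variable {m : ℕ} {M : Type*} [TopologicalSpace M] [ChartedSpace (EuclideanSpace ℝ (Fin m)) M]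

/-- The change of coordinates from the chart centred at `b` to the chart centred at `a`, defined on
`chartOverlap b a`. -/
def chartTransition (b a : M) (u : Coord m) : Coord m :=
  extChartAt (𝓡 m) a ((extChartAt (𝓡 m) b).symm u)

/-- The coordinates in the chart centred at `b` of the points that lie in the domain of the chart
centred at `a` as well. -/
def chartOverlap (b a : M) : Set (Coord m) :=
  {u ∈ (extChartAt (𝓡 m) b).target | (extChartAt (𝓡 m) b).symm u ∈ (extChartAt (𝓡 m) a).source}

/-- `chartFrame`, with the tangent space of `M` identified with the model space. -/
def coordFrame (a : M) (u : Coord m) : Coord m →L[ℝ] Coord m := chartFrame a u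

variable {a b : M} {u : Coord m}

theorem chartTransition_mem (hu : u ∈ chartOverlap b a) :
    chartTransition b a u ∈ (extChartAt (𝓡 m) a).target :=
  (extChartAt (𝓡 m) a).map_source hu.2

theorem extChartAt_symm_chartTransition (hu : u ∈ chartOverlap b a) :
    (extChartAt (𝓡 m) a).symm (chartTransition b a u) = (extChartAt (𝓡 m) b).symm u :=
  (extChartAt (𝓡 m) a).left_inv hu.2

theorem chartOverlap_mem_nhds (hu : u ∈ chartOverlap b a) : chartOverlap b a ∈ 𝓝 u :=
  inter_mem (extChartAt_target_mem_nhds' hu.1)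
    ((continuousAt_extChartAt_symm'' hu.1).preimage_mem_nhds
      ((isOpen_extChartAt_source a).mem_nhds hu.2))

variable [IsManifold (𝓡 m) ∞ M]

theorem contMDiffAt_extChartAt_symm (hu : u ∈ (extChartAt (𝓡 m) a).target) :
    ContMDiffAt 𝓘(ℝ, Coord m) (𝓡 m) ∞ (extChartAt (𝓡 m) a).symm u :=
  (contMDiffOn_extChartAt_symm a).contMDiffAt (extChartAt_target_mem_nhds' hu)

theorem contMDiffAt_extChartAt_of_mem {x : M} (hx : x ∈ (extChartAt (𝓡 m) a).source) :
    ContMDiffAt (𝓡 m) 𝓘(ℝ, Coord m) ∞ (extChartAt (𝓡 m) a) x :=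
  contMDiffAt_extChartAt' (by simpa using hx)

theorem bijective_coordFrame (hu : u ∈ (extChartAt (𝓡 m) a).target) :
    Function.Bijective (coordFrame a u) := by
  have h := isInvertible_mfderivWithin_extChartAt_symm (I := 𝓡 m) (x := a) hu
  rw [ModelWithCorners.range_eq_univ, mfderivWithin_univ] at h
  exact h.bijective

theorem coordFrame_self (a : M) :
    coordFrame a (extChartAt (𝓡 m) a a) = ContinuousLinearMap.id ℝ (Coord m) := by
  have h := mfderivWithin_range_extChartAt_symm (I := 𝓡 m) (x := a)
  rwa [ModelWithCorners.range_eq_univ, mfderivWithin_univ] at h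

theorem contDiffAt_chartTransition (hu : u ∈ chartOverlap b a) :
    ContDiffAt ℝ ∞ (chartTransition b a) u :=
  ((contMDiffAt_extChartAt_of_mem hu.2).comp u (contMDiffAt_extChartAt_symm hu.1)).contDiffAt

theorem coordFrame_chartTransition (hu : u ∈ chartOverlap b a) :
    coordFrame b u =
      (coordFrame a (chartTransition b a u)).comp (fderiv ℝ (chartTransition b a) u) := by
  have hcomp : (extChartAt (𝓡 m) b).symm =ᶠ[𝓝 u]
      (extChartAt (𝓡 m) a).symm ∘ chartTransition b a := by
    filter_upwards [chartOverlap_mem_nhds hu] with y hy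
    exact (extChartAt_symm_chartTransition hy).symm
  have hsymm : MDifferentiableAt 𝓘(ℝ, Coord m) (𝓡 m) (extChartAt (𝓡 m) a).symm
      (chartTransition b a u) :=
    (contMDiffAt_extChartAt_symm (chartTransition_mem hu)).mdifferentiableAt (by simp)
  have htrans : MDifferentiableAt 𝓘(ℝ, Coord m) 𝓘(ℝ, Coord m) (chartTransition b a) u :=
    ((contDiffAt_chartTransition hu).differentiableAt (by simp)).mdifferentiableAt
  have h := hcomp.mfderiv_eq (I := 𝓘(ℝ, Coord m)) (I' := 𝓡 m)
  rwa [mfderiv_comp u hsymm htrans, mfderiv_eq_fderiv] at h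

theorem bijective_fderiv_chartTransition (hu : u ∈ chartOverlap b a) :
    Function.Bijective (fderiv ℝ (chartTransition b a) u) := by
  have h := bijective_coordFrame hu.1
  rw [coordFrame_chartTransition hu, ContinuousLinearMap.coe_comp] at h
  exact (Function.Bijective.of_comp_iff' (bijective_coordFrame (chartTransition_mem hu)) _).1 h

/-- The Riemannian metric at `x` as a bilinear form on the model space. -/
def metricForm (g : SmoothMetric m M) (x : M) : Bilin m := g.inner x

theorem isInnerForm_metricForm (g : SmoothMetric m M) (x : M) : IsInnerForm (metricForm g x) :=
  ⟨g.symm x, g.pos x⟩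

theorem chartMetric_eq (g : SmoothMetric m M) (a : M) (u : Coord m) :
    chartMetric g a u = (metricForm g ((extChartAt (𝓡 m) a).symm u)).bilinearComp
      (coordFrame a u) (coordFrame a u) := rfl

theorem isInnerForm_chartMetric (g : SmoothMetric m M) (hu : u ∈ (extChartAt (𝓡 m) a).target) :
    IsInnerForm (chartMetric g a u) :=
  (isInnerForm_metricForm g _).bilinearComp (bijective_coordFrame hu).1

theorem chartMetric_self (g : SmoothMetric m M) (a : M) :
    chartMetric g a (extChartAt (𝓡 m) a a) = metricForm g a := by
  rw [chartMetric_eq, coordFrame_self, extChartAt_to_inv]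
  rfl

theorem chartMetric_eq_pullMetric (g : SmoothMetric m M) (hu : u ∈ chartOverlap b a) :
    chartMetric g b u = pullMetric (chartTransition b a) (chartMetric g a) u := by
  rw [pullMetric, chartMetric_eq, chartMetric_eq, extChartAt_symm_chartTransition hu,
    coordFrame_chartTransition hu]
  rfl

theorem chartMetric_eventuallyEq (g : SmoothMetric m M) (hu : u ∈ chartOverlap b a) :
    chartMetric g b =ᶠ[𝓝 u] pullMetric (chartTransition b a) (chartMetric g a) := by
  filter_upwards [chartOverlap_mem_nhds hu] with y hy
  exact chartMetric_eq_pullMetric g hy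

theorem contMDiffOn_chartFrame (a : M) (v : Coord m) :
    ContMDiffOn 𝓘(ℝ, Coord m) (𝓡 m).tangent ∞
      (fun u => (⟨(extChartAt (𝓡 m) a).symm u, chartFrame a u v⟩ : TangentBundle (𝓡 m) M))
      (extChartAt (𝓡 m) a).target := by
  have hopen := isOpen_extChartAt_target (I := 𝓡 m) a
  have hconst : ContMDiff 𝓘(ℝ, Coord m) 𝓘(ℝ, Coord m).tangent ∞
      (fun u => (⟨u, v⟩ : TangentBundle 𝓘(ℝ, Coord m) (Coord m))) := fun u =>
    contMDiffAt_vectorSpace_iff_contDiffAt.2 contDiffAt_const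
  refine (((contMDiffOn_extChartAt_symm (I := 𝓡 m) (n := ∞) a).contMDiffOn_tangentMapWithin
    (m := ∞) (by simp) hopen.uniqueMDiffOn).comp hconst.contMDiffOn fun _ hy => hy).congr
      fun y hy => ?_
  simp only [Function.comp, tangentMapWithin, mfderivWithin_of_isOpen hopen hy]
  rfl

theorem contDiffOn_chartMetric (g : SmoothMetric m M) (a : M) :
    ContDiffOn ℝ ∞ (chartMetric g a) (extChartAt (𝓡 m) a).target := by
  refine contDiffOn_clm_apply.2 fun v => contDiffOn_clm_apply.2 fun w => ?_
  have hinner : ContMDiffOn 𝓘(ℝ, Coord m) ((𝓡 m).prod 𝓘(ℝ)) ∞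
      (fun u => TotalSpace.mk' ℝ (E := Bundle.Trivial M ℝ) ((extChartAt (𝓡 m) a).symm u)
        (g.inner ((extChartAt (𝓡 m) a).symm u) (chartFrame a u v) (chartFrame a u w)))
      (extChartAt (𝓡 m) a).target := fun u hu =>
    ContMDiffWithinAt.clm_bundle_apply₂ (F₁ := Coord m) (F₂ := Coord m)
      (g.contMDiff.contMDiffAt.comp_contMDiffWithinAt u (contMDiffOn_extChartAt_symm a u hu))
      (contMDiffOn_chartFrame a v u hu) (contMDiffOn_chartFrame a w u hu)
  intro u hu
  have h := hinner u hu
  simp only [contMDiffWithinAt_totalSpace] at h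
  exact h.2.contDiffWithinAt

theorem contDiffAt_chartMetric (g : SmoothMetric m M) (hu : u ∈ (extChartAt (𝓡 m) a).target) :
    ContDiffAt ℝ ∞ (chartMetric g a) u :=
  (contDiffOn_chartMetric g a).contDiffAt (extChartAt_target_mem_nhds' hu)

end ChartGeometry

section CoordinateMaps

open Filter Topology

theorem hasFDerivAt_rpow_smul_of_eq_zero {X W : Type*} [NormedAddCommGroup X] [NormedSpace ℝ X]
    [NormedAddCommGroup W] [NormedSpace ℝ W] {e : X → ℝ} {A : X → W} {x : X} {s : ℝ}
    (hs : 0 < s) (he : ContinuousAt e x) (hA : DifferentiableAt ℝ A x) (hex : e x = 0)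
    (hAx : A x = 0) : HasFDerivAt (fun y => e y ^ s • A y) (0 : X →L[ℝ] W) x := by
  have hes : (fun y => e y ^ s) =o[𝓝 x] fun _ => (1 : ℝ) := by
    rw [Asymptotics.isLittleO_one_iff]
    simpa [ContinuousAt, hex, Real.zero_rpow hs.ne'] using he.rpow_const (p := s) (Or.inr hs.le)
  have hAO : A =O[𝓝 x] fun y => y - x := by simpa [hAx] using hA.isBigO_sub
  rw [hasFDerivAt_iff_isLittleO]
  simpa [hAx] using hes.smul_isBigO hAO

theorem hasFDerivAt_rpow_smul {X W : Type*} [NormedAddCommGroup X] [NormedSpace ℝ X]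
    [NormedAddCommGroup W] [NormedSpace ℝ W] {e : X → ℝ} {A : X → W} {x : X} {s : ℝ}
    (hs : 0 ≤ s) (he : DifferentiableAt ℝ e x) (hA : DifferentiableAt ℝ A x)
    (h0 : e x = 0 → A x = 0) :
    HasFDerivAt (fun y => e y ^ s • A y)
      (e x ^ s • fderiv ℝ A x + (s * e x ^ (s - 1)) • (fderiv ℝ e x).smulRight (A x)) x := by
  rcases hs.eq_or_lt with rfl | hs
  · simpa using hA.hasFDerivAt
  by_cases hx : e x = 0
  · refine (hasFDerivAt_rpow_smul_of_eq_zero hs he.continuousAt hA hx (h0 hx)).congr_fderiv ?_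
    ext v
    simp [hx, h0 hx, Real.zero_rpow hs.ne']
  · refine ((he.hasFDerivAt.rpow_const (Or.inl hx)).smul hA.hasFDerivAt).congr_fderiv ?_
    ext v
    simp [smul_smul]

section Smoothness

variable {X : Type*} [NormedAddCommGroup X] [NormedSpace ℝ X] {k : ℕ∞ω} {z : X}

theorem contDiffAt_fderiv {Y : Type*} [NormedAddCommGroup Y] [NormedSpace ℝ Y] {f : X → Y}
    (hf : ContDiffAt ℝ ∞ f z) : ContDiffAt ℝ ∞ (fderiv ℝ f) z :=
  hf.fderiv_right (by simp)

theorem contDiffAt_det {ι : Type*} [Fintype ι] [DecidableEq ι] {A : X → Matrix ι ι ℝ}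
    (hA : ∀ i j, ContDiffAt ℝ k (fun x => A x i j) z) : ContDiffAt ℝ k (fun x => (A x).det) z := by
  simp only [Matrix.det_apply]
  exact ContDiffAt.sum fun σ _ => (contDiffAt_prod fun i _ => hA _ _).const_smul (Equiv.Perm.sign σ)

theorem contDiffAt_inv_apply {ι : Type*} [Fintype ι] [DecidableEq ι] {A : X → Matrix ι ι ℝ}
    (hA : ∀ i j, ContDiffAt ℝ k (fun x => A x i j) z) (hz : IsUnit (A z).det) (i j : ι) :
    ContDiffAt ℝ k (fun x => (A x)⁻¹ i j) z := by
  simp only [Matrix.inv_def, Matrix.smul_apply, Matrix.adjugate_apply, Ring.inverse_eq_inv',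
    smul_eq_mul]
  refine ((contDiffAt_det hA).inv hz.ne_zero).mul (contDiffAt_det fun a b => ?_)
  rcases eq_or_ne a j with rfl | ha
  · simpa using contDiffAt_const
  · simpa [Matrix.updateRow_ne ha] using hA a b

theorem contDiffAt_metricTrace {m : ℕ} {F : Type*} [NormedAddCommGroup F] [NormedSpace ℝ F]
    {G : X → Bilin m} (hG : ContDiffAt ℝ k G z) (hI : IsInnerForm (G z))
    {B : X → Coord m → Coord m → F} (hB : ∀ v w, ContDiffAt ℝ k (fun x => B x v w) z) :
    ContDiffAt ℝ k (fun x => metricTrace (G x) (B x)) z :=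
  ContDiffAt.sum fun i _ => ContDiffAt.sum fun j _ =>
    (contDiffAt_inv_apply (fun _ _ => (hG.clm_apply contDiffAt_const).clm_apply contDiffAt_const)
      hI.isUnit_det i j).smul (hB _ _)

end Smoothness

variable {m n : ℕ} {G : Coord m → Bilin m} {H : Coord n → Bilin n} {f : Coord m → Coord n}
  {u : Coord m}

/-- The energy density `|df|²` of a map in coordinates. -/
def coordDensity (G : Coord m → Bilin m) (H : Coord n → Bilin n) (f : Coord m → Coord n)
    (u : Coord m) : ℝ :=
  metricTrace (G u) fun v w => H (f u) (fderiv ℝ f u v) (fderiv ℝ f u w)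

/-- The form `|df|^(p-2) df` in coordinates, with `|df|^(p-2)` written as a power of `|df|²`. -/
def coordPForm (G : Coord m → Bilin m) (H : Coord n → Bilin n) (p : ℝ) (f : Coord m → Coord n)
    (u : Coord m) : Coord m →L[ℝ] Coord n :=
  coordDensity G H f u ^ ((p - 2) / 2) • fderiv ℝ f u

/-- The `p`-tension field of a map in coordinates. -/
def coordTension (G : Coord m → Bilin m) (H : Coord n → Bilin n) (p : ℝ) (f : Coord m → Coord n)
    (u : Coord m) : Coord n :=
  metricTrace (G u) fun v w => coordCov G H f (coordPForm G H p f) u v w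

theorem contDiffAt_coordDensity (hG : ContDiffAt ℝ ∞ G u) (hH : ContDiffAt ℝ ∞ H (f u))
    (hf : ContDiffAt ℝ ∞ f u) (hI : IsInnerForm (G u)) : ContDiffAt ℝ ∞ (coordDensity G H f) u :=
  contDiffAt_metricTrace hG hI fun _ _ => ((hH.comp u hf).clm_apply
    ((contDiffAt_fderiv hf).clm_apply contDiffAt_const)).clm_apply
      ((contDiffAt_fderiv hf).clm_apply contDiffAt_const)

theorem hasFDerivAt_coordPForm {p : ℝ} (hp : 2 ≤ p) (hG : ContDiffAt ℝ ∞ G u)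
    (hH : ContDiffAt ℝ ∞ H (f u)) (hf : ContDiffAt ℝ ∞ f u) (hI : IsInnerForm (G u))
    (hJ : IsInnerForm (H (f u))) :
    HasFDerivAt (coordPForm G H p f)
      (coordDensity G H f u ^ ((p - 2) / 2) • fderiv ℝ (fderiv ℝ f) u +
        ((p - 2) / 2 * coordDensity G H f u ^ ((p - 2) / 2 - 1)) •
          (fderiv ℝ (coordDensity G H f) u).smulRight (fderiv ℝ f u)) u :=
  hasFDerivAt_rpow_smul (by linarith)
    ((contDiffAt_coordDensity hG hH hf hI).differentiableAt (by simp))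
    ((contDiffAt_fderiv hf).differentiableAt (by simp)) (metricTrace_pullback_eq_zero hI hJ)

theorem coordTension_eq {p : ℝ} (hp : 2 ≤ p) (hG : ContDiffAt ℝ ∞ G u)
    (hH : ContDiffAt ℝ ∞ H (f u)) (hf : ContDiffAt ℝ ∞ f u) (hI : IsInnerForm (G u))
    (hJ : IsInnerForm (H (f u))) :
    coordTension G H p f u =
      coordDensity G H f u ^ ((p - 2) / 2) •
          metricTrace (G u) (fun v w => coordCov G H f (fderiv ℝ f) u v w) +
        ((p - 2) / 2 * coordDensity G H f u ^ ((p - 2) / 2 - 1)) •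
          metricTrace (G u) fun v w => fderiv ℝ (coordDensity G H f) u v • fderiv ℝ f u w := by
  rw [← metricTrace_smul, ← metricTrace_smul, ← metricTrace_add, coordTension]
  congr! 3 with v w
  rw [coordCov_apply, coordCov_apply, (hasFDerivAt_coordPForm hp hG hH hf hI hJ).fderiv]
  simp only [coordPForm, add_apply, smul_apply, ContinuousLinearMap.smulRight_apply, map_smul]
  module

end CoordinateMaps

section ChartMaps

open Filter Topology

variable {m n : ℕ}
  {M : Type*} [TopologicalSpace M] [ChartedSpace (EuclideanSpace ℝ (Fin m)) M]
  {N : Type*} [TopologicalSpace N] [ChartedSpace (EuclideanSpace ℝ (Fin n)) N]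

/-- The domain of `chartMap a b φ`: the coordinates in the chart centred at `a` of the points that
`φ` maps into the domain of the chart centred at `b`. -/
def chartMapDomain (a : M) (b : N) (φ : M → N) : Set (Coord m) :=
  {u ∈ (extChartAt (𝓡 m) a).target |
    φ ((extChartAt (𝓡 m) a).symm u) ∈ (extChartAt (𝓡 n) b).source}

variable {φ : M → N} {a a' : M} {b b' : N} {u : Coord m}

theorem chartMap_mem_target (hu : u ∈ chartMapDomain (n := n) a b φ) :
    chartMap a b φ u ∈ (extChartAt (𝓡 n) b).target :=
  (extChartAt (𝓡 n) b).map_source hu.2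

theorem extChartAt_symm_chartMap (hu : u ∈ chartMapDomain (n := n) a b φ) :
    (extChartAt (𝓡 n) b).symm (chartMap a b φ u) = φ ((extChartAt (𝓡 m) a).symm u) :=
  (extChartAt (𝓡 n) b).left_inv hu.2

theorem chartMapDomain_mem_nhds (hφ : Continuous φ) (hu : u ∈ chartMapDomain (n := n) a b φ) :
    chartMapDomain (n := n) a b φ ∈ 𝓝 u :=
  inter_mem (extChartAt_target_mem_nhds' hu.1)
    ((hφ.continuousAt.comp (continuousAt_extChartAt_symm'' hu.1)).preimage_mem_nhds
      ((isOpen_extChartAt_source b).mem_nhds hu.2))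

theorem chartTransition_mem_chartMapDomain (hu : u ∈ chartMapDomain (n := n) a' b φ)
    (ha : u ∈ chartOverlap a' a) : chartTransition a' a u ∈ chartMapDomain (n := n) a b φ :=
  ⟨chartTransition_mem ha, by simpa only [extChartAt_symm_chartTransition ha] using hu.2⟩

theorem chartMap_mem_chartOverlap (hu : u ∈ chartMapDomain (n := n) a b φ)
    (hu' : u ∈ chartMapDomain (n := n) a b' φ) :
    chartMap (n := n) a b φ u ∈ chartOverlap b b' :=
  ⟨chartMap_mem_target hu, by simpa only [extChartAt_symm_chartMap hu] using hu'.2⟩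

theorem chartMap_chartTransition (ha : u ∈ chartOverlap a' a) :
    chartMap (n := n) a b φ (chartTransition a' a u) = chartMap a' b φ u := by
  rw [chartMap, chartMap, extChartAt_symm_chartTransition ha]

theorem chartTransition_chartMap (hu : u ∈ chartMapDomain (n := n) a b φ) :
    chartTransition b b' (chartMap (n := n) a b φ u) = chartMap a b' φ u := by
  rw [chartTransition, extChartAt_symm_chartMap hu, chartMap]

variable [IsManifold (𝓡 m) ∞ M] [IsManifold (𝓡 n) ∞ N]

theorem contDiffAt_chartMap (hφ : ContMDiff (𝓡 m) (𝓡 n) ∞ φ)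
    (hu : u ∈ chartMapDomain (n := n) a b φ) : ContDiffAt ℝ ∞ (chartMap (n := n) a b φ) u :=
  ((contMDiffAt_extChartAt_of_mem (m := n) hu.2).comp u
    (hφ.contMDiffAt.comp u (contMDiffAt_extChartAt_symm hu.1))).contDiffAt

theorem mfderiv_comp_coordFrame (hφ : ContMDiff (𝓡 m) (𝓡 n) ∞ φ)
    (hu : u ∈ chartMapDomain (n := n) a b φ) (v : Coord m) :
    mfderiv (𝓡 m) (𝓡 n) φ ((extChartAt (𝓡 m) a).symm u) (coordFrame a u v) =
      coordFrame b (chartMap a b φ u) (fderiv ℝ (chartMap a b φ) u v) := by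
  have hcomp : φ ∘ (extChartAt (𝓡 m) a).symm =ᶠ[𝓝 u]
      (extChartAt (𝓡 n) b).symm ∘ chartMap a b φ := by
    filter_upwards [chartMapDomain_mem_nhds hφ.continuous hu] with y hy
    exact (extChartAt_symm_chartMap hy).symm
  have hderiv := hcomp.mfderiv_eq (I := 𝓘(ℝ, Coord m)) (I' := 𝓡 n)
  rw [mfderiv_comp u (hφ.mdifferentiable (by simp) _)
      ((contMDiffAt_extChartAt_symm hu.1).mdifferentiableAt (by simp)),
    mfderiv_comp u ((contMDiffAt_extChartAt_symm
      (chartMap_mem_target hu)).mdifferentiableAt (by simp))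
      ((contDiffAt_chartMap hφ hu).differentiableAt (by simp)).mdifferentiableAt,
    mfderiv_eq_fderiv] at hderiv
  exact DFunLike.congr_fun hderiv v

variable (g : SmoothMetric m M) (h : SmoothMetric n N) {p : ℝ}

theorem differentialNorm_eq_sqrt_coordDensity (hφ : ContMDiff (𝓡 m) (𝓡 n) ∞ φ)
    (hu : u ∈ chartMapDomain (n := n) a b φ) :
    differentialNorm g h φ ((extChartAt (𝓡 m) a).symm u) =
      Real.sqrt (coordDensity (chartMetric g a) (chartMetric h b) (chartMap a b φ) u) := by
  set x := (extChartAt (𝓡 m) a).symm u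
  let D : Coord m →L[ℝ] Coord n := mfderiv (𝓡 m) (𝓡 n) φ x
  have hpull : coordDensity (chartMetric g a) (chartMetric h b) (chartMap a b φ) u =
      metricTrace ((metricForm g x).bilinearComp (coordFrame a u) (coordFrame a u)) fun v w =>
        metricForm h (φ x) (D (coordFrame a u v)) (D (coordFrame a u w)) := by
    rw [coordDensity, chartMetric_eq, chartMetric_eq, extChartAt_symm_chartMap hu]
    congr! 3 with v w
    exact congr_arg₂ (fun y z => metricForm h (φ x) y z) (mfderiv_comp_coordFrame hφ hu v).symm
      (mfderiv_comp_coordFrame hφ hu w).symm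
  rw [hpull]
  exact congr_arg Real.sqrt (metricTrace_comp (isInnerForm_metricForm g x)
    (bijective_coordFrame hu.1).1 ((metricForm h (φ x)).bilinearComp D D).toLinearMap₁₂).symm

theorem chartPForm_eq (hφ : ContMDiff (𝓡 m) (𝓡 n) ∞ φ) (hu : u ∈ chartMapDomain (n := n) a b φ) :
    chartPForm g h p a b φ u =
      coordPForm (chartMetric g a) (chartMetric h b) p (chartMap a b φ) u := by
  have hnonneg : 0 ≤ coordDensity (chartMetric g a) (chartMetric h b) (chartMap a b φ) u :=
    metricTrace_pullback_nonneg (isInnerForm_chartMetric g hu.1)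
      (isInnerForm_chartMetric h (chartMap_mem_target hu)) _
  rw [chartPForm, coordPForm, differentialNorm_eq_sqrt_coordDensity g h hφ hu, Real.sqrt_eq_rpow,
    ← Real.rpow_mul hnonneg, one_div_mul_eq_div]

theorem chartPForm_eventuallyEq (hφ : ContMDiff (𝓡 m) (𝓡 n) ∞ φ)
    (hu : u ∈ chartMapDomain (n := n) a b φ) :
    chartPForm g h p a b φ =ᶠ[𝓝 u]
      coordPForm (chartMetric g a) (chartMetric h b) p (chartMap a b φ) := by
  filter_upwards [chartMapDomain_mem_nhds hφ.continuous hu] with y hy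
  exact chartPForm_eq g h hφ hy

theorem differentiableAt_chartPForm (hp : 2 ≤ p) (hφ : ContMDiff (𝓡 m) (𝓡 n) ∞ φ)
    (hu : u ∈ chartMapDomain (n := n) a b φ) :
    DifferentiableAt ℝ (chartPForm g h p a b φ) u :=
  (hasFDerivAt_coordPForm hp (contDiffAt_chartMetric g hu.1)
    (contDiffAt_chartMetric h (chartMap_mem_target hu)) (contDiffAt_chartMap hφ hu)
    (isInnerForm_chartMetric g hu.1) (isInnerForm_chartMetric h
      (chartMap_mem_target hu))).differentiableAt.congr_of_eventuallyEq
    (chartPForm_eventuallyEq g h hφ hu)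

theorem christoffel_eq_coordChristoffel (v w : Coord m) :
    christoffel g a u v w = coordChristoffel (chartMetric g a) u v w := by
  simp only [christoffel, coordChristoffel_apply, metricTrace, koszulForm_apply, smul_smul]

theorem chartPTension_eq_metricTrace :
    chartPTension g h p a b φ u = metricTrace (chartMetric g a u) fun v w =>
      coordCov (chartMetric g a) (chartMetric h b) (chartMap a b φ) (chartPForm g h p a b φ) u
        v w := by
  simp only [chartPTension, coordCov_apply, ← christoffel_eq_coordChristoffel]
  rfl

theorem chartPTension_eq_coordTension (hφ : ContMDiff (𝓡 m) (𝓡 n) ∞ φ)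
    (hu : u ∈ chartMapDomain (n := n) a b φ) :
    chartPTension g h p a b φ u =
      coordTension (chartMetric g a) (chartMetric h b) p (chartMap a b φ) u := by
  have hform := chartPForm_eventuallyEq g h (p := p) hφ hu
  simp only [chartPTension_eq_metricTrace, coordTension, coordCov_apply, hform.fderiv_eq,
    hform.eq_of_nhds]

theorem chartPForm_comp_chartTransition (hφ : ContMDiff (𝓡 m) (𝓡 n) ∞ φ)
    (hu : u ∈ chartMapDomain (n := n) a' b φ) (ha : u ∈ chartOverlap a' a) :
    chartPForm g h p a' b φ u =
      (chartPForm g h p a b φ (chartTransition a' a u)).comp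
        (fderiv ℝ (chartTransition a' a) u) := by
  have hmap : chartMap (n := n) a' b φ =ᶠ[𝓝 u] chartMap a b φ ∘ chartTransition a' a := by
    filter_upwards [chartOverlap_mem_nhds ha] with y hy
    exact (chartMap_chartTransition hy).symm
  have hmem := chartTransition_mem_chartMapDomain hu ha
  rw [chartPForm, chartPForm, hmap.fderiv_eq,
    fderiv_comp u ((contDiffAt_chartMap hφ hmem).differentiableAt (by simp))
      ((contDiffAt_chartTransition ha).differentiableAt (by simp)),
    extChartAt_symm_chartTransition ha, ContinuousLinearMap.smul_comp]

theorem chartPForm_change_target (hφ : ContMDiff (𝓡 m) (𝓡 n) ∞ φ)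
    (hu : u ∈ chartMapDomain (n := n) a b φ) (hu' : u ∈ chartMapDomain (n := n) a b' φ) :
    chartPForm g h p a b' φ u =
      (fderiv ℝ (chartTransition b b') (chartMap a b φ u)).comp (chartPForm g h p a b φ u) := by
  have hmap : chartMap (m := m) a b' φ =ᶠ[𝓝 u] chartTransition b b' ∘ chartMap (n := n) a b φ := by
    filter_upwards [chartMapDomain_mem_nhds hφ.continuous hu] with y hy
    exact (chartTransition_chartMap hy).symm
  rw [chartPForm, chartPForm, hmap.fderiv_eq,
    fderiv_comp u ((contDiffAt_chartTransition
      (chartMap_mem_chartOverlap hu hu')).differentiableAt (by simp))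
      ((contDiffAt_chartMap hφ hu).differentiableAt (by simp)), ContinuousLinearMap.comp_smul]

theorem chartPTension_chartTransition (hp : 2 ≤ p) (hφ : ContMDiff (𝓡 m) (𝓡 n) ∞ φ)
    (hu : u ∈ chartMapDomain (n := n) a' b φ) (ha : u ∈ chartOverlap a' a) :
    chartPTension g h p a b φ (chartTransition a' a u) = chartPTension g h p a' b φ u := by
  have hmem := chartTransition_mem_chartMapDomain hu ha
  have hinj := bijective_fderiv_chartTransition ha
  have hcov := coordCov_comp_source (H := chartMetric h b)
    ((contDiffAt_chartTransition ha).of_le ENat.LEInfty.out)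
    ((contDiffAt_chartMetric g hmem.1).differentiableAt (by simp))
    (isInnerForm_chartMetric g hmem.1) hinj
    ((contDiffAt_chartMap hφ hmem).differentiableAt (by simp))
    (differentiableAt_chartPForm g h hp hφ hmem) (chartMetric_eventuallyEq g ha)
    (f' := chartMap a' b φ) (σ' := chartPForm g h p a' b φ)
    (by filter_upwards [chartOverlap_mem_nhds ha] with y hy
        exact (chartMap_chartTransition hy).symm)
    (by filter_upwards [chartMapDomain_mem_nhds hφ.continuous hu, chartOverlap_mem_nhds ha]
          with y hy hya
        exact chartPForm_comp_chartTransition g h hφ hy hya)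
  rw [chartPTension_eq_metricTrace, chartPTension_eq_metricTrace, chartMetric_eq_pullMetric g ha]
  simp only [hcov]
  exact (metricTrace_comp (isInnerForm_chartMetric g hmem.1) hinj.1 _).symm

theorem chartPTension_change_target (hp : 2 ≤ p) (hφ : ContMDiff (𝓡 m) (𝓡 n) ∞ φ)
    (hu : u ∈ chartMapDomain (n := n) a b φ) (hu' : u ∈ chartMapDomain (n := n) a b' φ) :
    chartPTension g h p a b' φ u =
      fderiv ℝ (chartTransition b b') (chartMap a b φ u) (chartPTension g h p a b φ u) := by
  have hmem := chartMap_mem_chartOverlap hu hu'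
  have htarget := chartTransition_mem hmem
  have hcov := coordCov_comp_target (G := chartMetric g a)
    ((contDiffAt_chartTransition hmem).of_le ENat.LEInfty.out)
    ((contDiffAt_chartMetric h htarget).differentiableAt (by simp))
    (isInnerForm_chartMetric h htarget) (bijective_fderiv_chartTransition hmem)
    ((contDiffAt_chartMap hφ hu).differentiableAt (by simp))
    (differentiableAt_chartPForm g h hp hφ hu) (chartMetric_eventuallyEq h hmem)
    (f' := chartMap a b' φ) (σ' := chartPForm g h p a b' φ)
    (by filter_upwards [chartMapDomain_mem_nhds hφ.continuous hu] with y hy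
        exact (chartTransition_chartMap hy).symm)
    (by filter_upwards [chartMapDomain_mem_nhds hφ.continuous hu,
          chartMapDomain_mem_nhds hφ.continuous hu'] with y hy hy'
        exact chartPForm_change_target g h hφ hy hy')
  rw [chartPTension_eq_metricTrace, chartPTension_eq_metricTrace, map_metricTrace]
  simp only [hcov]

theorem chartMetric_chartPTension_change_target (hp : 2 ≤ p) (hφ : ContMDiff (𝓡 m) (𝓡 n) ∞ φ)
    (hu : u ∈ chartMapDomain (n := n) a b φ) (hu' : u ∈ chartMapDomain (n := n) a b' φ) :
    chartMetric h b' (chartMap a b' φ u) (chartPTension g h p a b' φ u)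
        (chartPTension g h p a b' φ u) =
      chartMetric h b (chartMap a b φ u) (chartPTension g h p a b φ u)
        (chartPTension g h p a b φ u) := by
  rw [chartPTension_change_target g h hp hφ hu hu',
    chartMetric_eq_pullMetric h (chartMap_mem_chartOverlap hu hu'), pullMetric,
    chartTransition_chartMap hu]
  rfl

theorem pTensionNorm_sq (x : M) :
    pTensionNorm g h p φ x ^ 2 =
      chartMetric h (φ x) (chartMap x (φ x) φ (extChartAt (𝓡 m) x x))
        (chartPTension g h p x (φ x) φ (extChartAt (𝓡 m) x x))
        (chartPTension g h p x (φ x) φ (extChartAt (𝓡 m) x x)) := by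
  rw [chartMap, extChartAt_to_inv, chartMetric_self]
  exact Real.sq_sqrt ((isInnerForm_metricForm h _).nonneg _)

theorem pTensionNorm_sq_eq (hp : 2 ≤ p) (hφ : ContMDiff (𝓡 m) (𝓡 n) ∞ φ)
    (hu : u ∈ chartMapDomain (n := n) a b φ) :
    pTensionNorm g h p φ ((extChartAt (𝓡 m) a).symm u) ^ 2 =
      chartMetric h b (chartMap a b φ u)
        (coordTension (chartMetric g a) (chartMetric h b) p (chartMap a b φ) u)
        (coordTension (chartMetric g a) (chartMetric h b) p (chartMap a b φ) u) := by
  set x := (extChartAt (𝓡 m) a).symm u with hx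
  have hxx : (extChartAt (𝓡 m) x).symm (extChartAt (𝓡 m) x x) = x := extChartAt_to_inv x
  have hoverlap : extChartAt (𝓡 m) x x ∈ chartOverlap x a :=
    ⟨mem_extChartAt_target x, by simpa only [hxx] using (extChartAt (𝓡 m) a).map_target hu.1⟩
  have hdomain : extChartAt (𝓡 m) x x ∈ chartMapDomain (n := n) x b φ :=
    ⟨mem_extChartAt_target x, by simpa only [hxx] using hu.2⟩
  have hdomain' : extChartAt (𝓡 m) x x ∈ chartMapDomain (n := n) x (φ x) φ :=
    ⟨mem_extChartAt_target x, by simpa only [hxx] using mem_extChartAt_source (φ x)⟩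
  have htransition : chartTransition x a (extChartAt (𝓡 m) x x) = u := by
    rw [chartTransition, hxx, hx, (extChartAt (𝓡 m) a).right_inv hu.1]
  rw [← chartPTension_eq_coordTension g h hφ hu, ← htransition,
    chartPTension_chartTransition g h hp hφ hdomain hoverlap, chartMap_chartTransition hoverlap,
    pTensionNorm_sq, chartMetric_chartPTension_change_target g h hp hφ hdomain hdomain']

end ChartMaps

section Orders

open Filter Topology Asymptotics

variable {Z : Type*} [NormedAddCommGroup Z] [NormedSpace ℝ Z]
  {V W : Type*} [NormedAddCommGroup V] [NormedSpace ℝ V] [NormedAddCommGroup W] [NormedSpace ℝ W]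
  {z₀ : Z} {w w' w₁ w₁' w₂ w₂' : Z → ℝ}

/-- Near `z₀`, the function `X` is differentiable, `X = O(w)` and `DX = O(w')`. -/
structure HasOrder (z₀ : Z) (X : Z → W) (w w' : Z → ℝ) : Prop where
  diff : ∀ᶠ z in 𝓝 z₀, DifferentiableAt ℝ X z
  val : X =O[𝓝 z₀] w
  der : fderiv ℝ X =O[𝓝 z₀] w'

namespace HasOrder

theorem mono {X : Z → W} (h : HasOrder z₀ X w₁ w₁') (hw : w₁ =O[𝓝 z₀] w)
    (hw' : w₁' =O[𝓝 z₀] w') : HasOrder z₀ X w w' :=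
  ⟨h.diff, h.val.trans hw, h.der.trans hw'⟩

theorem congr {X Y : Z → W} (h : HasOrder z₀ X w w') (hXY : Y =ᶠ[𝓝 z₀] X) :
    HasOrder z₀ Y w w' := by
  refine ⟨?_, h.val.congr' hXY.symm .rfl, h.der.congr' ?_ .rfl⟩
  · filter_upwards [h.diff, hXY.eventuallyEq_nhds] with z h1 h2
    exact h1.congr_of_eventuallyEq h2
  · filter_upwards [hXY.eventuallyEq_nhds] with z h2
    exact h2.fderiv_eq.symm

theorem of_contDiffAt {X : Z → W} (h : ContDiffAt ℝ ∞ X z₀) :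
    HasOrder z₀ X (fun _ => 1) (fun _ => 1) := by
  refine ⟨?_, h.continuousAt.isBigO_one ℝ, (contDiffAt_fderiv h).continuousAt.isBigO_one ℝ⟩
  filter_upwards [(h.of_le (m := 1) ENat.LEInfty.out).eventually (by simp)] with z hz
  exact hz.differentiableAt (by simp)

theorem add {X Y : Z → W} (hX : HasOrder z₀ X w w') (hY : HasOrder z₀ Y w w') :
    HasOrder z₀ (fun z => X z + Y z) w w' := by
  refine ⟨?_, hX.val.add hY.val, (hX.der.add hY.der).congr' ?_ .rfl⟩
  · filter_upwards [hX.diff, hY.diff] with z h1 h2 using h1.add h2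
  · filter_upwards [hX.diff, hY.diff] with z h1 h2 using (fderiv_fun_add h1 h2).symm

theorem sub {X Y : Z → W} (hX : HasOrder z₀ X w w') (hY : HasOrder z₀ Y w w') :
    HasOrder z₀ (fun z => X z - Y z) w w' := by
  refine ⟨?_, hX.val.sub hY.val, (hX.der.sub hY.der).congr' ?_ .rfl⟩
  · filter_upwards [hX.diff, hY.diff] with z h1 h2 using h1.sub h2
  · filter_upwards [hX.diff, hY.diff] with z h1 h2 using (fderiv_fun_sub h1 h2).symm

theorem sum {ι : Type*} (s : Finset ι) {X : ι → Z → W}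
    (hX : ∀ i ∈ s, HasOrder z₀ (X i) w w') : HasOrder z₀ (fun z => ∑ i ∈ s, X i z) w w' := by
  have hdiff : ∀ᶠ z in 𝓝 z₀, ∀ i ∈ s, DifferentiableAt ℝ (X i) z :=
    (eventually_all_finset s).2 fun i hi => (hX i hi).diff
  refine ⟨?_, .fun_sum fun i hi => (hX i hi).val,
    (IsBigO.fun_sum fun i hi => (hX i hi).der).congr' ?_ .rfl⟩
  · filter_upwards [hdiff] with z hz using .fun_sum hz
  · filter_upwards [hdiff] with z hz using (fderiv_fun_sum hz).symm

theorem smul {c : Z → ℝ} {X : Z → W} (hc : HasOrder z₀ c w₁ w₁') (hX : HasOrder z₀ X w₂ w₂')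
    (hw : (fun z => w₁ z * w₂ z) =O[𝓝 z₀] w) (hw₁ : (fun z => w₁' z * w₂ z) =O[𝓝 z₀] w')
    (hw₂ : (fun z => w₁ z * w₂' z) =O[𝓝 z₀] w') : HasOrder z₀ (fun z => c z • X z) w w' := by
  refine ⟨?_, (hc.val.smul hX.val).trans hw, ?_⟩
  · filter_upwards [hc.diff, hX.diff] with z h1 h2 using h1.smul h2
  have hder : (fun z => c z • fderiv ℝ X z + (fderiv ℝ c z).smulRight (X z)) =O[𝓝 z₀] w' := by
    refine ((hc.val.smul hX.der).trans hw₂).add (.trans (.of_norm_left ?_) hw₁)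
    simpa only [ContinuousLinearMap.norm_smulRight_apply] using
      hc.der.norm_left.mul hX.val.norm_left
  refine hder.congr' ?_ .rfl
  filter_upwards [hc.diff, hX.diff] with z h1 h2 using (fderiv_fun_smul h1 h2).symm

theorem clm_apply {L : Z → V →L[ℝ] W} {X : Z → V} (hL : HasOrder z₀ L w₁ w₁')
    (hX : HasOrder z₀ X w₂ w₂') (hw : (fun z => w₁ z * w₂ z) =O[𝓝 z₀] w)
    (hw₁ : (fun z => w₁' z * w₂ z) =O[𝓝 z₀] w') (hw₂ : (fun z => w₁ z * w₂' z) =O[𝓝 z₀] w') :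
    HasOrder z₀ (fun z => L z (X z)) w w' := by
  refine ⟨?_, ?_, ?_⟩
  · filter_upwards [hL.diff, hX.diff] with z h1 h2 using h1.clm_apply h2
  · exact (IsBigO.of_norm_le fun z => (L z).le_opNorm (X z)).trans
      ((hL.val.norm_left.mul hX.val.norm_left).trans hw)
  have hder : (fun z => (L z).comp (fderiv ℝ X z) + (fderiv ℝ L z).flip (X z)) =O[𝓝 z₀] w' := by
    refine .add ((IsBigO.of_norm_le fun z => (L z).opNorm_comp_le (fderiv ℝ X z)).trans
      ((hL.val.norm_left.mul hX.der.norm_left).trans hw₂)) ?_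
    refine (IsBigO.of_norm_le fun z => ((fderiv ℝ L z).flip.le_opNorm (X z)).trans_eq ?_).trans
      ((hL.der.norm_left.mul hX.val.norm_left).trans hw₁)
    rw [ContinuousLinearMap.opNorm_flip]
  refine hder.congr' ?_ .rfl
  filter_upwards [hL.diff, hX.diff] with z h1 h2 using (fderiv_clm_apply h1 h2).symm

theorem one_clm_apply {L : Z → V →L[ℝ] W} {X : Z → V}
    (hL : HasOrder z₀ L (fun _ => 1) (fun _ => 1)) (hX : HasOrder z₀ X w w')
    (hw : w =O[𝓝 z₀] w') : HasOrder z₀ (fun z => L z (X z)) w w' :=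
  hL.clm_apply hX (by simpa using isBigO_refl w _) (by simpa using hw)
    (by simpa using isBigO_refl w' _)

theorem clm_apply_one {L : Z → V →L[ℝ] W} {X : Z → V}
    (hL : HasOrder z₀ L w w') (hX : HasOrder z₀ X (fun _ => 1) (fun _ => 1))
    (hw : w =O[𝓝 z₀] w') : HasOrder z₀ (fun z => L z (X z)) w w' :=
  hL.clm_apply hX (by simpa using isBigO_refl w _) (by simpa using isBigO_refl w' _)
    (by simpa using hw)

theorem one_smul {c : Z → ℝ} {X : Z → W}
    (hc : HasOrder z₀ c (fun _ => 1) (fun _ => 1)) (hX : HasOrder z₀ X w w')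
    (hw : w =O[𝓝 z₀] w') : HasOrder z₀ (fun z => c z • X z) w w' :=
  hc.smul hX (by simpa using isBigO_refl w _) (by simpa using hw)
    (by simpa using isBigO_refl w' _)

theorem smul_inner {c : Z → ℝ} {B : Z → V →L[ℝ] V →L[ℝ] ℝ} {x y : Z → V}
    (hc : ContDiffAt ℝ ∞ c z₀) (hB : ContDiffAt ℝ ∞ B z₀) (hx : HasOrder z₀ x w₁ w₁')
    (hy : HasOrder z₀ y w₂ w₂') (h₁ : w₁ =O[𝓝 z₀] w₁')
    (hw : (fun z => w₁ z * w₂ z) =O[𝓝 z₀] w) (hw₁ : (fun z => w₁' z * w₂ z) =O[𝓝 z₀] w')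
    (hw₂ : (fun z => w₁ z * w₂' z) =O[𝓝 z₀] w') (hww : w =O[𝓝 z₀] w') :
    HasOrder z₀ (fun z => c z • B z (x z) (y z)) w w' :=
  (of_contDiffAt hc).one_smul
    (((of_contDiffAt hB).one_clm_apply hx h₁).clm_apply hy hw hw₁ hw₂) hww

end HasOrder

end Orders

section Families

open Filter Topology Asymptotics

variable {m n : ℕ}

/-- Near `z₀`, the map `f` is a smooth family of maps between coordinate domains with smooth
metrics `G` and `H`. -/
structure IsSmoothFamily (G : Coord m → Bilin m) (H : Coord n → Bilin n)
    (f : ℝ × Coord m → Coord n) (z₀ : ℝ × Coord m) : Prop where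
  map : ∀ᶠ z in 𝓝 z₀, ContDiffAt ℝ ∞ f z
  source : ∀ᶠ u in 𝓝 z₀.2, ContDiffAt ℝ ∞ G u ∧ IsInnerForm (G u)
  target : ∀ᶠ y in 𝓝 (f z₀), ContDiffAt ℝ ∞ H y ∧ IsInnerForm (H y)

/-- The differential of a family of maps in the space directions. -/
def spaceDeriv {W : Type*} [NormedAddCommGroup W] [NormedSpace ℝ W] (f : ℝ × Coord m → W)
    (z : ℝ × Coord m) : Coord m →L[ℝ] W :=
  (fderiv ℝ f z).comp (ContinuousLinearMap.inr ℝ ℝ (Coord m))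

/-- The energy density of a family of maps. -/
def familyDensity (G : Coord m → Bilin m) (H : Coord n → Bilin n) (f : ℝ × Coord m → Coord n)
    (z : ℝ × Coord m) : ℝ :=
  metricTrace (G z.2) fun v w => H (f z) (spaceDeriv f z v) (spaceDeriv f z w)

/-- The tension field of a family of maps. -/
def familyTension (G : Coord m → Bilin m) (H : Coord n → Bilin n) (f : ℝ × Coord m → Coord n)
    (z : ℝ × Coord m) : Coord n :=
  metricTrace (G z.2) fun v w => spaceDeriv (spaceDeriv f) z v w
    - spaceDeriv f z (coordChristoffel G z.2 v w)
    + coordChristoffel H (f z) (spaceDeriv f z v) (spaceDeriv f z w)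

/-- The image of the gradient of the energy density under the differential. -/
def familyGradient (G : Coord m → Bilin m) (H : Coord n → Bilin n) (f : ℝ × Coord m → Coord n)
    (z : ℝ × Coord m) : Coord n :=
  metricTrace (G z.2) fun v w => spaceDeriv (familyDensity G H f) z v • spaceDeriv f z w

section SpaceDeriv

variable {V W : Type*} [NormedAddCommGroup V] [NormedSpace ℝ V] [NormedAddCommGroup W]
  [NormedSpace ℝ W] {f : ℝ × Coord m → W} {z : ℝ × Coord m}

theorem tendsto_slice (z : ℝ × Coord m) : Tendsto (fun u : Coord m => (z.1, u)) (𝓝 z.2) (𝓝 z) :=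
  (Continuous.prodMk_right z.1).tendsto z.2

theorem fderiv_slice (hf : DifferentiableAt ℝ f z) :
    fderiv ℝ (fun u => f (z.1, u)) z.2 = spaceDeriv f z :=
  (HasFDerivAt.comp z.2 (f := fun u : Coord m => (z.1, u)) hf.hasFDerivAt
    (hasFDerivAt_prodMk_right _ _)).fderiv

theorem contDiffAt_slice (hf : ContDiffAt ℝ ∞ f z) :
    ContDiffAt ℝ ∞ (fun u => f (z.1, u)) z.2 :=
  ContDiffAt.comp z.2 (f := fun u : Coord m => (z.1, u)) hf (contDiffAt_const.prodMk contDiffAt_id)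

theorem contDiffAt_spaceDeriv (hf : ContDiffAt ℝ ∞ f z) : ContDiffAt ℝ ∞ (spaceDeriv f) z :=
  (contDiffAt_fderiv hf).clm_comp contDiffAt_const

theorem contDiffAt_spaceDeriv_apply (hf : ContDiffAt ℝ ∞ f z) (v : Coord m) :
    ContDiffAt ℝ ∞ (fun z => spaceDeriv f z v) z :=
  (contDiffAt_spaceDeriv hf).clm_apply contDiffAt_const

theorem fderiv_fderiv_slice (h : ∀ᶠ y in 𝓝 z, ContDiffAt ℝ ∞ f y) :
    fderiv ℝ (fderiv ℝ fun u => f (z.1, u)) z.2 = spaceDeriv (spaceDeriv f) z := by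
  have heq : fderiv ℝ (fun u => f (z.1, u)) =ᶠ[𝓝 z.2] fun u => spaceDeriv f (z.1, u) := by
    filter_upwards [(tendsto_slice z).eventually h] with u hu
    exact fderiv_slice (z := (z.1, u)) (hu.differentiableAt (by simp))
  rw [heq.fderiv_eq]
  exact fderiv_slice ((contDiffAt_spaceDeriv h.self_of_nhds).differentiableAt (by simp))

theorem spaceDeriv_spaceDeriv_apply (hf : ContDiffAt ℝ ∞ f z) (v w : Coord m) :
    spaceDeriv (fun z => spaceDeriv f z w) z v = spaceDeriv (spaceDeriv f) z v w := by
  have hd : HasFDerivAt (fun z => spaceDeriv f z w) _ z :=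
    ((contDiffAt_spaceDeriv hf).differentiableAt (by simp)).hasFDerivAt.clm_apply
      (hasFDerivAt_const w z)
  rw [spaceDeriv, hd.fderiv]
  simp [spaceDeriv]

theorem spaceDeriv_sum {ι : Type*} (s : Finset ι) {F : ι → ℝ × Coord m → W}
    (hF : ∀ i ∈ s, DifferentiableAt ℝ (F i) z) :
    spaceDeriv (fun z => ∑ i ∈ s, F i z) z = ∑ i ∈ s, spaceDeriv (F i) z := by
  ext v
  simp [spaceDeriv, fderiv_fun_sum hF]

theorem spaceDeriv_smul_inner {c : ℝ × Coord m → ℝ} {B : ℝ × Coord m → V →L[ℝ] V →L[ℝ] ℝ}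
    {x y : ℝ × Coord m → V} (hc : DifferentiableAt ℝ c z) (hB : DifferentiableAt ℝ B z)
    (hx : DifferentiableAt ℝ x z) (hy : DifferentiableAt ℝ y z) (v : Coord m) :
    spaceDeriv (fun z => c z • B z (x z) (y z)) z v =
      spaceDeriv c z v • B z (x z) (y z) + c z • spaceDeriv B z v (x z) (y z)
        + c z • B z (spaceDeriv x z v) (y z) + c z • B z (x z) (spaceDeriv y z v) := by
  have hd : HasFDerivAt (fun z => c z • B z (x z) (y z)) _ z := hc.hasFDerivAt.smul
    ((hB.hasFDerivAt.clm_apply hx.hasFDerivAt).clm_apply hy.hasFDerivAt)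
  rw [spaceDeriv, hd.fderiv]
  simp only [spaceDeriv, ContinuousLinearMap.comp_apply, add_apply, smul_apply,
    ContinuousLinearMap.flip_apply, ContinuousLinearMap.smulRight_apply, smul_eq_mul]
  ring

end SpaceDeriv

variable {G : Coord m → Bilin m} {H : Coord n → Bilin n} {f : ℝ × Coord m → Coord n}
  {z : ℝ × Coord m}

theorem coordDensity_slice (h : ContDiffAt ℝ ∞ f z) :
    coordDensity G H (fun u => f (z.1, u)) z.2 = familyDensity G H f z := by
  simp only [coordDensity, fderiv_slice (h.differentiableAt (by simp)), familyDensity]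

theorem contDiffAt_coordChristoffel {X : Type*} [NormedAddCommGroup X] [NormedSpace ℝ X]
    {y a b : X → Coord m} {x : X} (hG : ContDiffAt ℝ ∞ G (y x)) (hI : IsInnerForm (G (y x)))
    (hy : ContDiffAt ℝ ∞ y x) (ha : ContDiffAt ℝ ∞ a x) (hb : ContDiffAt ℝ ∞ b x) :
    ContDiffAt ℝ ∞ (fun x => coordChristoffel G (y x) (a x) (b x)) x := by
  have : ContDiffAt ℝ ∞ (fun x => fderiv ℝ G (y x)) x := (contDiffAt_fderiv hG).comp x hy
  simp only [coordChristoffel_apply, koszulForm_apply]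
  refine contDiffAt_metricTrace (G := fun x => G (y x)) (hG.comp x hy) hI fun e e' => ?_
  fun_prop

namespace IsSmoothFamily

section Pointwise

variable (h : IsSmoothFamily G H f z)

include h

theorem eventually : ∀ᶠ y in 𝓝 z, IsSmoothFamily G H f y := by
  filter_upwards [h.map.eventually_nhds, continuousAt_snd.eventually h.source.eventually_nhds,
    h.map.self_of_nhds.continuousAt.eventually h.target.eventually_nhds] with y h1 h2 h3
  exact ⟨h1, h2, h3⟩

theorem contDiffAt_map : ContDiffAt ℝ ∞ f z := h.map.self_of_nhds

theorem contDiffAt_source : ContDiffAt ℝ ∞ (fun z : ℝ × Coord m => G z.2) z :=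
  h.source.self_of_nhds.1.comp z contDiffAt_snd

theorem contDiffAt_target : ContDiffAt ℝ ∞ (fun z => H (f z)) z :=
  h.target.self_of_nhds.1.comp z h.contDiffAt_map

theorem isInnerForm_source : IsInnerForm (G z.2) := h.source.self_of_nhds.2

theorem isInnerForm_target : IsInnerForm (H (f z)) := h.target.self_of_nhds.2

theorem contDiffAt_gramMatrix_inv (i j : Fin m) :
    ContDiffAt ℝ ∞ (fun z : ℝ × Coord m => (gramMatrix (G z.2))⁻¹ i j) z :=
  contDiffAt_inv_apply (fun _ _ => (h.contDiffAt_source.clm_apply contDiffAt_const).clm_apply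
    contDiffAt_const) h.isInnerForm_source.isUnit_det i j

theorem contDiffAt_christoffel_source (v w : Coord m) :
    ContDiffAt ℝ ∞ (fun z : ℝ × Coord m => coordChristoffel G z.2 v w) z :=
  contDiffAt_coordChristoffel h.source.self_of_nhds.1 h.isInnerForm_source contDiffAt_snd
    contDiffAt_const contDiffAt_const

theorem contDiffAt_christoffel_target {a b : ℝ × Coord m → Coord n} (ha : ContDiffAt ℝ ∞ a z)
    (hb : ContDiffAt ℝ ∞ b z) : ContDiffAt ℝ ∞ (fun z => coordChristoffel H (f z) (a z) (b z)) z :=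
  contDiffAt_coordChristoffel h.target.self_of_nhds.1 h.isInnerForm_target h.contDiffAt_map ha hb

theorem contDiffAt_familyDensity : ContDiffAt ℝ ∞ (familyDensity G H f) z :=
  contDiffAt_metricTrace h.contDiffAt_source h.isInnerForm_source fun v w =>
    (h.contDiffAt_target.clm_apply (contDiffAt_spaceDeriv_apply h.contDiffAt_map v)).clm_apply
      (contDiffAt_spaceDeriv_apply h.contDiffAt_map w)

theorem contDiffAt_familyTension : ContDiffAt ℝ ∞ (familyTension G H f) z := by
  have hf := h.contDiffAt_map
  have hA := contDiffAt_spaceDeriv hf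
  refine contDiffAt_metricTrace h.contDiffAt_source h.isInnerForm_source fun v w => ?_
  refine .add (.sub ?_ (hA.clm_apply (h.contDiffAt_christoffel_source v w)))
    (h.contDiffAt_christoffel_target (contDiffAt_spaceDeriv_apply hf v)
      (contDiffAt_spaceDeriv_apply hf w))
  exact (contDiffAt_spaceDeriv_apply hA v).clm_apply contDiffAt_const

theorem contDiffAt_familyGradient : ContDiffAt ℝ ∞ (familyGradient G H f) z :=
  contDiffAt_metricTrace h.contDiffAt_source h.isInnerForm_source fun v w =>
    (contDiffAt_spaceDeriv_apply h.contDiffAt_familyDensity v).smul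
      (contDiffAt_spaceDeriv_apply h.contDiffAt_map w)

theorem familyDensity_nonneg : 0 ≤ familyDensity G H f z :=
  metricTrace_pullback_nonneg h.isInnerForm_source h.isInnerForm_target _

theorem spaceDeriv_eq_zero (h0 : familyDensity G H f z = 0) : spaceDeriv f z = 0 :=
  metricTrace_pullback_eq_zero h.isInnerForm_source h.isInnerForm_target h0

theorem fderiv_coordDensity_slice :
    fderiv ℝ (coordDensity G H fun u => f (z.1, u)) z.2 = spaceDeriv (familyDensity G H f) z := by
  have heq : coordDensity G H (fun u => f (z.1, u)) =ᶠ[𝓝 z.2]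
      fun u => familyDensity G H f (z.1, u) := by
    filter_upwards [(tendsto_slice z).eventually h.map] with u hu
    exact coordDensity_slice (z := (z.1, u)) hu
  rw [heq.fderiv_eq]
  exact fderiv_slice (h.contDiffAt_familyDensity.differentiableAt (by simp))

theorem coordTension_slice {p : ℝ} (hp : 2 ≤ p) :
    coordTension G H p (fun u => f (z.1, u)) z.2 =
      familyDensity G H f z ^ ((p - 2) / 2) • familyTension G H f z +
        ((p - 2) / 2 * familyDensity G H f z ^ ((p - 2) / 2 - 1)) • familyGradient G H f z := by
  rw [_root_.coordTension_eq hp h.source.self_of_nhds.1 h.target.self_of_nhds.1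
    (contDiffAt_slice h.contDiffAt_map) h.isInnerForm_source h.isInnerForm_target]
  simp only [coordCov_apply, fderiv_fderiv_slice h.map, h.fderiv_coordDensity_slice,
    coordDensity_slice h.contDiffAt_map, fderiv_slice (h.contDiffAt_map.differentiableAt (by simp)),
    familyTension, familyGradient]

end Pointwise

end IsSmoothFamily

theorem eventually_forall_sq_norm_le {Z V : Type*} [TopologicalSpace Z] [NormedAddCommGroup V]
    [NormedSpace ℝ V] [FiniteDimensional ℝ V] {q : Z → V → ℝ} {z₀ : Z}
    (hq : ∀ B, ContinuousAt (fun y : Z × V => q y.1 y.2) (z₀, B))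
    (hsmul : ∀ z (r : ℝ) B, q z (r • B) = r ^ 2 * q z B) (hpos : ∀ B, B ≠ 0 → 0 < q z₀ B) :
    ∃ c > 0, ∀ᶠ z in 𝓝 z₀, ∀ B, c * ‖B‖ ^ 2 ≤ q z B := by
  have hK : IsCompact (Metric.sphere (0 : V) 1) :=
    have := FiniteDimensional.proper ℝ V
    isCompact_sphere _ _
  obtain ⟨c, hc, hmin⟩ : ∃ c > 0, ∀ B ∈ Metric.sphere (0 : V) 1, c < q z₀ B := by
    have hcont : ContinuousOn (q z₀) (Metric.sphere 0 1) := fun B _ =>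
      (ContinuousAt.comp (f := fun B => (z₀, B)) (x := B) (hq B) (by fun_prop)).continuousWithinAt
    obtain ⟨c, hc, hmin⟩ := hK.exists_forall_le' hcont (a := 0) fun B hB =>
      hpos B (Metric.ne_of_mem_sphere hB one_ne_zero)
    exact ⟨c / 2, by positivity, fun B hB => (half_lt_self hc).trans_le (hmin B hB)⟩
  refine ⟨c, hc, ?_⟩
  filter_upwards [hK.eventually_forall_of_forall_eventually (x₀ := z₀) (P := fun z B => c < q z B)
    fun B hB => (hq B).eventually (lt_mem_nhds (hmin B hB))] with z hz B
  rcases eq_or_ne B 0 with rfl | hB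
  · have := hsmul z 0 0
    simp_all
  · have hn : 0 < ‖B‖ := norm_pos_iff.2 hB
    have hunit := hz (‖B‖⁻¹ • B) (by simp [norm_smul, hn.ne'])
    rw [hsmul, inv_pow, inv_mul_eq_div, lt_div_iff₀ (by positivity)] at hunit
    exact hunit.le

/-- The norm of the differential in a family of maps. -/
def familyNorm (G : Coord m → Bilin m) (H : Coord n → Bilin n) (f : ℝ × Coord m → Coord n)
    (z : ℝ × Coord m) : ℝ := √(familyDensity G H f z)

/-- The size of the first and second space derivatives in a family of maps. -/
def jetSize (G : Coord m → Bilin m) (H : Coord n → Bilin n) (f : ℝ × Coord m → Coord n)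
    (z : ℝ × Coord m) : ℝ := familyNorm G H f z + ‖spaceDeriv (spaceDeriv f) z‖

theorem familyNorm_nonneg (z : ℝ × Coord m) : 0 ≤ familyNorm G H f z := Real.sqrt_nonneg _

theorem jetSize_nonneg (z : ℝ × Coord m) : 0 ≤ jetSize G H f z :=
  add_nonneg (familyNorm_nonneg z) (norm_nonneg _)

theorem familyNorm_le_jetSize (z : ℝ × Coord m) : familyNorm G H f z ≤ jetSize G H f z :=
  le_add_of_nonneg_right (norm_nonneg _)

theorem familyNorm_isBigO_jetSize {z₀ : ℝ × Coord m} : familyNorm G H f =O[𝓝 z₀] jetSize G H f :=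
  IsBigO.of_norm_le fun z => by
    rw [Real.norm_of_nonneg (familyNorm_nonneg z)]
    exact familyNorm_le_jetSize z

namespace IsSmoothFamily

variable {z₀ : ℝ × Coord m} (h : IsSmoothFamily G H f z₀)

include h

theorem continuousAt_metricTrace_pullback (B : Coord m →L[ℝ] Coord n) :
    ContinuousAt (fun y : (ℝ × Coord m) × (Coord m →L[ℝ] Coord n) =>
      metricTrace (G y.1.2) fun v w => H (f y.1) (y.2 v) (y.2 w)) (z₀, B) := by
  have hG : ContDiffAt ℝ ∞ (fun y : (ℝ × Coord m) × (Coord m →L[ℝ] Coord n) => G y.1.2)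
      (z₀, B) := ContDiffAt.comp (z₀, B) (f := Prod.fst) h.contDiffAt_source contDiffAt_fst
  have hH : ContDiffAt ℝ ∞ (fun y : (ℝ × Coord m) × (Coord m →L[ℝ] Coord n) => H (f y.1))
      (z₀, B) := ContDiffAt.comp (z₀, B) (f := Prod.fst) h.contDiffAt_target contDiffAt_fst
  have happly (v : Coord m) : ContDiffAt ℝ ∞
      (fun y : (ℝ × Coord m) × (Coord m →L[ℝ] Coord n) => y.2 v) (z₀, B) := by fun_prop
  exact (contDiffAt_metricTrace hG h.isInnerForm_source fun v w =>
    (hH.clm_apply (happly v)).clm_apply (happly w)).continuousAt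

theorem exists_sq_le_familyDensity :
    ∃ c > 0, ∀ᶠ z in 𝓝 z₀, c * ‖spaceDeriv f z‖ ^ 2 ≤ familyDensity G H f z := by
  have hsmul (z : ℝ × Coord m) (r : ℝ) (B : Coord m →L[ℝ] Coord n) :
      (metricTrace (G z.2) fun v w => H (f z) ((r • B) v) ((r • B) w)) =
        r ^ 2 * metricTrace (G z.2) fun v w => H (f z) (B v) (B w) := by
    simp only [← smul_eq_mul, ← metricTrace_smul, smul_apply, map_smul, smul_smul, sq]
  have hpos (B : Coord m →L[ℝ] Coord n) (hB : B ≠ 0) :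
      0 < metricTrace (G z₀.2) fun v w => H (f z₀) (B v) (B w) :=
    (metricTrace_pullback_nonneg h.isInnerForm_source h.isInnerForm_target B).lt_of_ne'
      fun h0 => hB (metricTrace_pullback_eq_zero h.isInnerForm_source h.isInnerForm_target h0)
  obtain ⟨c, hc, hle⟩ := eventually_forall_sq_norm_le
    (q := fun z (B : Coord m →L[ℝ] Coord n) =>
      metricTrace (G z.2) fun v w => H (f z) (B v) (B w))
    h.continuousAt_metricTrace_pullback hsmul hpos
  refine ⟨c, hc, ?_⟩
  filter_upwards [hle] with z hz using hz (spaceDeriv f z)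

theorem familyNorm_isBigO_one : familyNorm G H f =O[𝓝 z₀] (fun _ => (1 : ℝ)) :=
  h.contDiffAt_familyDensity.continuousAt.sqrt.isBigO_one ℝ

theorem jetSize_isBigO_one : jetSize G H f =O[𝓝 z₀] (fun _ => (1 : ℝ)) :=
  h.familyNorm_isBigO_one.add ((contDiffAt_spaceDeriv
    (contDiffAt_spaceDeriv h.contDiffAt_map)).continuousAt.norm.isBigO_one ℝ)

theorem familyNorm_mul_familyNorm_isBigO_familyNorm :
    (fun z => familyNorm G H f z * familyNorm G H f z) =O[𝓝 z₀] familyNorm G H f := by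
  simpa using (isBigO_refl (familyNorm G H f) (𝓝 z₀)).mul h.familyNorm_isBigO_one

theorem familyNorm_mul_jetSize_isBigO_jetSize :
    (fun z => familyNorm G H f z * jetSize G H f z) =O[𝓝 z₀] jetSize G H f := by
  simpa using h.familyNorm_isBigO_one.mul (isBigO_refl (jetSize G H f) (𝓝 z₀))

theorem spaceDeriv_isBigO_familyNorm : spaceDeriv f =O[𝓝 z₀] familyNorm G H f := by
  obtain ⟨c, hc, hle⟩ := h.exists_sq_le_familyDensity
  refine IsBigO.of_bound (√c)⁻¹ (hle.mono fun z hz => ?_)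
  rw [Real.norm_of_nonneg (familyNorm_nonneg z), inv_mul_eq_div, le_div_iff₀ (Real.sqrt_pos.2 hc),
    familyNorm]
  refine Real.le_sqrt_of_sq_le ?_
  rwa [mul_pow, Real.sq_sqrt hc.le, mul_comm]

theorem hasOrder_spaceDeriv : HasOrder z₀ (spaceDeriv f) (familyNorm G H f) (fun _ => 1) :=
  have hf := HasOrder.of_contDiffAt (contDiffAt_spaceDeriv h.contDiffAt_map)
  ⟨hf.diff, h.spaceDeriv_isBigO_familyNorm, hf.der⟩

theorem hasOrder_spaceDeriv_apply (v : Coord m) :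
    HasOrder z₀ (fun z => spaceDeriv f z v) (familyNorm G H f) (fun _ => 1) :=
  h.hasOrder_spaceDeriv.clm_apply_one (.of_contDiffAt contDiffAt_const) h.familyNorm_isBigO_one

theorem hasOrder_spaceDeriv_spaceDeriv :
    HasOrder z₀ (spaceDeriv (spaceDeriv f)) (jetSize G H f) (fun _ => 1) :=
  have hf := HasOrder.of_contDiffAt (contDiffAt_spaceDeriv (contDiffAt_spaceDeriv h.contDiffAt_map))
  ⟨hf.diff, IsBigO.of_norm_le fun z => le_add_of_nonneg_left (familyNorm_nonneg z), hf.der⟩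

theorem hasOrder_spaceDeriv_spaceDeriv_apply (v w : Coord m) :
    HasOrder z₀ (fun z => spaceDeriv (spaceDeriv f) z v w) (jetSize G H f) (fun _ => 1) :=
  (h.hasOrder_spaceDeriv_spaceDeriv.clm_apply_one (.of_contDiffAt contDiffAt_const)
    h.jetSize_isBigO_one).clm_apply_one (.of_contDiffAt contDiffAt_const) h.jetSize_isBigO_one

theorem hasOrder_metricTrace {F : Type*} [NormedAddCommGroup F] [NormedSpace ℝ F]
    {w w' : ℝ × Coord m → ℝ} {B : ℝ × Coord m → Coord m → Coord m → F}
    (hw : w =O[𝓝 z₀] w') (hB : ∀ a b, HasOrder z₀ (fun z => B z a b) w w') :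
    HasOrder z₀ (fun z => metricTrace (G z.2) (B z)) w w' :=
  .sum _ fun i _ => .sum _ fun j _ =>
    (HasOrder.of_contDiffAt (h.contDiffAt_gramMatrix_inv i j)).one_smul (hB _ _) hw

theorem christoffel_target_isBigO_jetSize (a b : Coord m) :
    (fun z => coordChristoffel H (f z) (spaceDeriv f z a) (spaceDeriv f z b))
      =O[𝓝 z₀] jetSize G H f := by
  have hsum : ∀ z, coordChristoffel H (f z) (spaceDeriv f z a) (spaceDeriv f z b) =
      ∑ i, spaceDeriv f z a i • coordChristoffel H (f z) (stdVec i) (spaceDeriv f z b) := by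
    intro z
    conv_lhs => rw [← sum_coord_smul_stdVec (spaceDeriv f z a)]
    simp only [map_sum, map_smul, LinearMap.sum_apply, LinearMap.smul_apply]
  simp only [hsum]
  refine IsBigO.fun_sum fun i _ => ?_
  have hcoord : (fun z => spaceDeriv f z a i) =O[𝓝 z₀] jetSize G H f :=
    (IsBigO.of_norm_le fun z => PiLp.norm_apply_le (spaceDeriv f z a) i).trans
      (((h.hasOrder_spaceDeriv_apply a).val.trans familyNorm_isBigO_jetSize).norm_left)
  have hchrist : (fun z => coordChristoffel H (f z) (stdVec i) (spaceDeriv f z b))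
      =O[𝓝 z₀] fun _ => (1 : ℝ) :=
    (h.contDiffAt_christoffel_target contDiffAt_const
      (contDiffAt_spaceDeriv_apply h.contDiffAt_map b)).continuousAt.isBigO_one ℝ
  simpa using hcoord.smul hchrist

theorem hasOrder_familyTension :
    HasOrder z₀ (familyTension G H f) (jetSize G H f) (fun _ => 1) := by
  have hf := h.contDiffAt_map
  refine h.hasOrder_metricTrace h.jetSize_isBigO_one fun a b => ?_
  refine ((h.hasOrder_spaceDeriv_spaceDeriv_apply a b).sub ?_).add ?_
  · exact (h.hasOrder_spaceDeriv.clm_apply_one (.of_contDiffAt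
      (h.contDiffAt_christoffel_source a b)) h.familyNorm_isBigO_one).mono familyNorm_isBigO_jetSize
      (isBigO_refl _ _)
  · have hsmooth := HasOrder.of_contDiffAt (h.contDiffAt_christoffel_target
      (contDiffAt_spaceDeriv_apply hf a) (contDiffAt_spaceDeriv_apply hf b))
    exact ⟨hsmooth.diff, h.christoffel_target_isBigO_jetSize a b, hsmooth.der⟩

theorem hasOrder_familyDensity :
    HasOrder z₀ (familyDensity G H f) (fun z => familyNorm G H f z * familyNorm G H f z)
      (familyNorm G H f) :=
  h.hasOrder_metricTrace h.familyNorm_mul_familyNorm_isBigO_familyNorm fun a b =>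
    ((HasOrder.of_contDiffAt h.contDiffAt_target).one_clm_apply (h.hasOrder_spaceDeriv_apply a)
      h.familyNorm_isBigO_one).clm_apply (h.hasOrder_spaceDeriv_apply b) (isBigO_refl _ _)
      (by simpa using isBigO_refl (familyNorm G H f) _)
      (by simpa using isBigO_refl (familyNorm G H f) _)

theorem hasOrder_spaceDeriv_smul_inner {c : ℝ × Coord m → ℝ} {B : ℝ × Coord m → Bilin n}
    (hc : ContDiffAt ℝ ∞ c z₀) (hB : ContDiffAt ℝ ∞ B z₀) (v a b : Coord m) :
    HasOrder z₀ (fun z => spaceDeriv c z v • B z (spaceDeriv f z a) (spaceDeriv f z b)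
        + c z • spaceDeriv B z v (spaceDeriv f z a) (spaceDeriv f z b)
        + c z • B z (spaceDeriv (spaceDeriv f) z v a) (spaceDeriv f z b)
        + c z • B z (spaceDeriv f z a) (spaceDeriv (spaceDeriv f) z v b))
      (fun z => familyNorm G H f z * jetSize G H f z) (jetSize G H f) := by
  have hJ := isBigO_refl (jetSize G H f) (𝓝 z₀)
  have hR : (familyNorm G H f) =O[𝓝 z₀] jetSize G H f := familyNorm_isBigO_jetSize
  have hRR : (fun z => familyNorm G H f z * familyNorm G H f z) =O[𝓝 z₀]
      fun z => familyNorm G H f z * jetSize G H f z := (isBigO_refl _ _).mul hR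
  have hRJ := h.familyNorm_mul_jetSize_isBigO_jetSize
  have h1 := h.hasOrder_spaceDeriv_apply
  have h2 := h.hasOrder_spaceDeriv_spaceDeriv_apply
  refine .add (.add (.add ?_ ?_) ?_) ?_
  · exact .smul_inner (contDiffAt_spaceDeriv_apply hc v) hB (h1 a) (h1 b)
      h.familyNorm_isBigO_one hRR (by simpa using hR) (by simpa using hR) hRJ
  · exact .smul_inner hc (contDiffAt_spaceDeriv_apply hB v) (h1 a) (h1 b)
      h.familyNorm_isBigO_one hRR (by simpa using hR) (by simpa using hR) hRJ
  · exact .smul_inner hc hB (h2 v a) (h1 b) h.jetSize_isBigO_one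
      (by simpa only [mul_comm] using isBigO_refl _ _) (by simpa using hR) (by simpa using hJ) hRJ
  · exact .smul_inner hc hB (h1 a) (h2 v b) h.familyNorm_isBigO_one (isBigO_refl _ _)
      (by simpa using hJ) (by simpa using hR) hRJ

theorem hasOrder_spaceDeriv_familyDensity (v : Coord m) :
    HasOrder z₀ (fun z => spaceDeriv (familyDensity G H f) z v)
      (fun z => familyNorm G H f z * jetSize G H f z) (jetSize G H f) := by
  refine (HasOrder.sum Finset.univ fun i _ => HasOrder.sum Finset.univ fun j _ =>
    h.hasOrder_spaceDeriv_smul_inner (h.contDiffAt_gramMatrix_inv i j) h.contDiffAt_target v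
      (stdVec i) (stdVec j)).congr ?_
  filter_upwards [h.eventually] with z hz
  have hc i j := (hz.contDiffAt_gramMatrix_inv i j).differentiableAt (by simp)
  have hB := hz.contDiffAt_target.differentiableAt (by simp)
  have ha i := (contDiffAt_spaceDeriv_apply hz.contDiffAt_map (stdVec i)).differentiableAt (by simp)
  have hterm i j := (hc i j).fun_smul ((hB.clm_apply (ha i)).clm_apply (ha j))
  have hsum : familyDensity G H f = fun z => ∑ i, ∑ j, (gramMatrix (G z.2))⁻¹ i j •
      H (f z) (spaceDeriv f z (stdVec i)) (spaceDeriv f z (stdVec j)) := rfl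
  rw [hsum, spaceDeriv_sum _ fun i _ => .fun_sum fun j _ => hterm i j]
  simp only [spaceDeriv_sum _ fun j _ => hterm _ j, sum_apply,
    spaceDeriv_smul_inner (hc _ _) hB (ha _) (ha _), spaceDeriv_spaceDeriv_apply hz.contDiffAt_map]

theorem hasOrder_familyGradient :
    HasOrder z₀ (familyGradient G H f)
      (fun z => familyNorm G H f z * familyNorm G H f z * jetSize G H f z)
      (fun z => familyNorm G H f z * jetSize G H f z) := by
  refine h.hasOrder_metricTrace ?_ fun a b => ?_
  · simpa only [mul_assoc] using
      h.familyNorm_mul_familyNorm_isBigO_familyNorm.mul (isBigO_refl (jetSize G H f) _)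
  · exact (h.hasOrder_spaceDeriv_familyDensity a).smul (h.hasOrder_spaceDeriv_apply b)
      ((isBigO_refl _ _).congr_left fun z => by ring)
      (by simpa only [mul_comm] using isBigO_refl _ _) (by simpa using isBigO_refl _ _)

end IsSmoothFamily

end Families

section Paths

open Filter Topology

theorem abs_sqrt_add_sub_sqrt_add_le {e : ℝ → ℝ} {K δ η t : ℝ} (hK : 0 ≤ K) (hη : 0 < η)
    (ht : t ∈ Ioo (-δ) δ) (h0 : ∀ r ∈ Ioo (-δ) δ, 0 ≤ e r)
    (hd : ∀ r ∈ Ioo (-δ) δ, DifferentiableAt ℝ e r)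
    (he : ∀ r ∈ Ioo (-δ) δ, |deriv e r| ≤ K * √(e r)) :
    |√(e t + η) - √(e 0 + η)| ≤ K * |t| := by
  have hz : (0 : ℝ) ∈ Ioo (-δ) δ := ⟨by linarith [ht.1, ht.2], by linarith [ht.1, ht.2]⟩
  have hder : ∀ r ∈ Ioo (-δ) δ, HasDerivWithinAt (fun r => √(e r + η))
      (deriv e r / (2 * √(e r + η))) (Ioo (-δ) δ) r := fun r hr =>
    (((hd r hr).hasDerivAt.add_const η).sqrt (by linarith [h0 r hr])).hasDerivWithinAt
  have hbound : ∀ r ∈ Ioo (-δ) δ, ‖deriv e r / (2 * √(e r + η))‖ ≤ K := by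
    intro r hr
    have hpos : 0 < √(e r + η) := Real.sqrt_pos.2 (by linarith [h0 r hr])
    have hle : √(e r) ≤ 2 * √(e r + η) :=
      (Real.sqrt_le_sqrt (le_add_of_nonneg_right hη.le)).trans (by linarith)
    rw [Real.norm_eq_abs, abs_div, abs_of_pos (a := 2 * √(e r + η)) (by positivity),
      div_le_iff₀ (by positivity)]
    exact (he r hr).trans (by gcongr)
  simpa using (convex_Ioo (-δ) δ).norm_image_sub_le_of_norm_hasDerivWithin_le hder hbound hz ht

theorem abs_sqrt_sub_sqrt_le {e : ℝ → ℝ} {K δ t : ℝ} (hK : 0 ≤ K) (ht : t ∈ Ioo (-δ) δ)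
    (h0 : ∀ r ∈ Ioo (-δ) δ, 0 ≤ e r) (hd : ∀ r ∈ Ioo (-δ) δ, DifferentiableAt ℝ e r)
    (he : ∀ r ∈ Ioo (-δ) δ, |deriv e r| ≤ K * √(e r)) : |√(e t) - √(e 0)| ≤ K * |t| := by
  have hcont : Continuous fun η : ℝ => |√(e t + η) - √(e 0 + η)| := by fun_prop
  have hlim : Tendsto (fun η : ℝ => |√(e t + η) - √(e 0 + η)|) (𝓝[>] 0)
      (𝓝 |√(e t) - √(e 0)|) := by
    simpa using (hcont.tendsto 0).mono_left (nhdsWithin_le_nhds (s := Ioi 0))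
  refine le_of_tendsto hlim ?_
  filter_upwards [self_mem_nhdsWithin] with η hη
    using abs_sqrt_add_sub_sqrt_add_le hK hη ht h0 hd he

variable {F : Type*} [NormedAddCommGroup F] [NormedSpace ℝ F]

theorem norm_deriv_rpow_smul_le {e : ℝ → ℝ} {V : ℝ → F} {t K A σ : ℝ}
    (he : DifferentiableAt ℝ e t) (hV : DifferentiableAt ℝ V t) (hpos : 0 < e t)
    (hder : |deriv e t| ≤ K * √(e t)) (hval : ‖V t‖ ≤ A) (hderV : √(e t) * ‖deriv V t‖ ≤ A) :
    DifferentiableAt ℝ (fun t => e t ^ σ • V t) t ∧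
      ‖deriv (fun t => e t ^ σ • V t) t‖ ≤ (|σ| * K + 1) * (√(e t) ^ (2 * σ - 1) * A) := by
  have hd : HasDerivAt (fun t => e t ^ σ • V t) _ t :=
    (he.hasDerivAt.rpow_const (p := σ) (Or.inl hpos.ne')).smul hV.hasDerivAt
  refine ⟨hd.differentiableAt, ?_⟩
  set R := √(e t) with hR
  have hR0 : 0 < R := Real.sqrt_pos.2 hpos
  have hpow : e t ^ σ = R ^ (2 * σ - 1) * R := by
    rw [Real.rpow_sub_one hR0.ne', div_mul_cancel₀ _ hR0.ne', hR, Real.sqrt_eq_rpow,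
      ← Real.rpow_mul hpos.le]
    ring_nf
  have hpow' : R * e t ^ (σ - 1) = R ^ (2 * σ - 1) := by
    rw [Real.rpow_sub_one hpos.ne', hpow, mul_div_assoc', mul_comm, mul_assoc,
      Real.mul_self_sqrt hpos.le, mul_div_cancel_right₀ _ hpos.ne']
  have hK : 0 ≤ K * R := (abs_nonneg _).trans hder
  rw [hd.deriv]
  calc ‖e t ^ σ • deriv V t + (deriv e t * σ * e t ^ (σ - 1)) • V t‖
      ≤ ‖e t ^ σ • deriv V t‖ + ‖(deriv e t * σ * e t ^ (σ - 1)) • V t‖ := norm_add_le _ _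
    _ = R ^ (2 * σ - 1) * (R * ‖deriv V t‖) + |deriv e t| * |σ| * e t ^ (σ - 1) * ‖V t‖ := by
        simp only [norm_smul, norm_mul, Real.norm_eq_abs,
          abs_of_nonneg (Real.rpow_nonneg hpos.le _)]
        rw [hpow, mul_assoc]
    _ ≤ R ^ (2 * σ - 1) * A + K * R * |σ| * e t ^ (σ - 1) * A := by gcongr
    _ = (|σ| * K + 1) * (R ^ (2 * σ - 1) * A) := by rw [← hpow']; ring

/-- Bounds along a path of maps, at a fixed point of the source: `e` stands for the density
`|dφ|²`, `τ` for the tension field, `Y` for the contraction of `de` with `dφ`, and `b` for the size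
of the second derivatives. -/
structure PathBounds (K δ : ℝ) (e b : ℝ → ℝ) (τ Y : ℝ → F) : Prop where
  nonneg : ∀ t ∈ Ioo (-δ) δ, 0 ≤ e t
  le : ∀ t ∈ Ioo (-δ) δ, √(e t) ≤ K
  diff : ∀ t ∈ Ioo (-δ) δ, DifferentiableAt ℝ e t
  der : ∀ t ∈ Ioo (-δ) δ, |deriv e t| ≤ K * √(e t)
  diff_tension : ∀ t ∈ Ioo (-δ) δ, DifferentiableAt ℝ τ t
  tension : ∀ t ∈ Ioo (-δ) δ, ‖τ t‖ ≤ K * (√(e t) + b t)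
  der_tension : ∀ t ∈ Ioo (-δ) δ, ‖deriv τ t‖ ≤ K
  diff_grad : ∀ t ∈ Ioo (-δ) δ, DifferentiableAt ℝ Y t
  grad : ∀ t ∈ Ioo (-δ) δ, ‖Y t‖ ≤ K * (√(e t) * √(e t) * (√(e t) + b t))
  der_grad : ∀ t ∈ Ioo (-δ) δ, ‖deriv Y t‖ ≤ K * (√(e t) * (√(e t) + b t))
  nonneg_snd : ∀ t ∈ Ioo (-δ) δ, 0 ≤ b t
  snd : ∀ t ∈ Ioo (-δ) δ, b t ≤ b 0 + K * |t|

/-- The `p`-tension field `e ^ s • τ + s e ^ (s - 1) • Y` along a path, where `s = (p - 2) / 2`. -/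
def pathPTension (s : ℝ) (e : ℝ → ℝ) (τ Y : ℝ → F) (t : ℝ) : F :=
  e t ^ s • τ t + (s * e t ^ (s - 1)) • Y t

theorem sqrt_sq_add_le_abs_add_sqrt (t : ℝ) {a : ℝ} (ha : 0 ≤ a) : √(t ^ 2 + a) ≤ |t| + √a := by
  refine Real.sqrt_le_iff.2 ⟨by positivity, ?_⟩
  rw [add_sq, sq_abs, Real.sq_sqrt ha]
  nlinarith [mul_nonneg (abs_nonneg t) (Real.sqrt_nonneg a)]

theorem rpow_neg_mul_add_le {γ A a ρ b : ℝ} (hγ : 0 < γ) (ha : 0 < a) (haρ : a ≤ ρ)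
    (hρA : ρ ≤ A * a) (hb : 0 ≤ b) : a ^ (-γ) * (a + b) ≤ A ^ γ * (ρ ^ (-γ) * (ρ + b)) := by
  have hρ : 0 < ρ := ha.trans_le haρ
  have hA : 0 < A := pos_of_mul_pos_left (hρ.trans_le hρA) ha.le
  have hpow : a ^ (-γ) ≤ A ^ γ * ρ ^ (-γ) := by
    calc a ^ (-γ) = A ^ γ * (A * a) ^ (-γ) := by
          rw [Real.mul_rpow hA.le ha.le, ← mul_assoc, ← Real.rpow_add hA, add_neg_cancel,
            Real.rpow_zero, one_mul]
      _ ≤ A ^ γ * ρ ^ (-γ) := by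
          gcongr ?_ * ?_
          exact Real.rpow_le_rpow_of_nonpos hρ hρA (by linarith)
  calc a ^ (-γ) * (a + b) ≤ A ^ γ * ρ ^ (-γ) * (ρ + b) := by gcongr
    _ = _ := by ring

theorem sq_rpow_neg_mul_add_le {γ x ρ b N : ℝ} (hγ : 0 < γ) (hγ' : γ < 1) (hx : 0 < x) (hx1 : x ≤ 1)
    (hxρ : x ≤ ρ) (hρN : ρ ≤ N) (hN : 1 ≤ N) :
    (x * (ρ ^ (-γ) * (ρ + b))) ^ 2 ≤
      2 * N ^ 2 * (x ^ (2 - γ) * (1 + (ρ ^ 2) ^ (-(γ / 2)) * b ^ 2)) := by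
  have hρ : 0 < ρ := hx.trans_le hxρ
  have hsq : (ρ ^ 2) ^ (-(γ / 2)) = ρ ^ (-γ) := by
    rw [← Real.rpow_natCast, ← Real.rpow_mul hρ.le]
    ring_nf
  have hx2 : x ^ 2 ≤ x ^ (2 - γ) := by
    rw [← Real.rpow_natCast]
    exact Real.rpow_le_rpow_of_exponent_ge hx hx1 (by push_cast; linarith)
  have hfst : x ^ 2 * (ρ ^ (1 - γ)) ^ 2 ≤ N ^ 2 * x ^ (2 - γ) := by
    have hle : ρ ^ (1 - γ) ≤ N := by
      calc ρ ^ (1 - γ) ≤ N ^ (1 - γ) := by gcongr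
        _ ≤ N ^ (1 : ℝ) := Real.rpow_le_rpow_of_exponent_le hN (by linarith)
        _ = N := Real.rpow_one N
    rw [mul_comm]
    gcongr
  have hsnd : x ^ 2 * ρ ^ (-γ) ≤ x ^ (2 - γ) := by
    calc x ^ 2 * ρ ^ (-γ) ≤ x ^ 2 * x ^ (-γ) := by
          gcongr ?_ * ?_
          exact Real.rpow_le_rpow_of_nonpos hx hxρ (by linarith)
      _ = x ^ (2 - γ) := by rw [← Real.rpow_natCast, ← Real.rpow_add hx]; push_cast; ring_nf
  have hN2 : 1 ≤ N ^ 2 := one_le_pow₀ hN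
  calc (x * (ρ ^ (-γ) * (ρ + b))) ^ 2
      ≤ x ^ 2 * (ρ ^ (-γ)) ^ 2 * (2 * (ρ ^ 2 + b ^ 2)) := by
        rw [mul_pow, mul_pow, ← mul_assoc]
        gcongr
        exact add_sq_le.trans_eq (by ring)
    _ = 2 * (x ^ 2 * (ρ ^ (1 - γ)) ^ 2 + x ^ 2 * ρ ^ (-γ) * (ρ ^ (-γ) * b ^ 2)) := by
        rw [sub_eq_neg_add, Real.rpow_add_one hρ.ne']; ring
    _ ≤ 2 * (N ^ 2 * x ^ (2 - γ) + N ^ 2 * x ^ (2 - γ) * (ρ ^ (-γ) * b ^ 2)) := by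
        gcongr ?_ * (?_ + ?_ * _)
        exact hsnd.trans (le_mul_of_one_le_left (by positivity) hN2)
    _ = _ := by rw [hsq]; ring

namespace PathBounds

variable {K δ s : ℝ} {e b : ℝ → ℝ} {τ Y : ℝ → F}

theorem norm_le (h : PathBounds K δ e b τ Y) (hs : 0 < s) {t : ℝ} (ht : t ∈ Ioo (-δ) δ) :
    ‖pathPTension s e τ Y t‖ ≤ K * (1 + s) * (√(e t) ^ (2 * s) * (√(e t) + b t)) := by
  have hτ := h.tension t ht
  have hY := h.grad t ht
  have he := h.nonneg t ht
  have hpow : √(e t) ^ (2 * s) = e t ^ s := by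
    rw [Real.sqrt_eq_rpow, ← Real.rpow_mul he]
    ring_nf
  rw [hpow]
  rcases he.eq_or_lt with h0 | hpos
  · have hY0 : Y t = 0 := by simpa [← h0] using hY
    simp [pathPTension, hY0, ← h0, Real.zero_rpow hs.ne']
  · rw [Real.mul_self_sqrt he] at hY
    calc ‖pathPTension s e τ Y t‖
        ≤ e t ^ s * ‖τ t‖ + s * e t ^ (s - 1) * ‖Y t‖ := by
          refine (norm_add_le _ _).trans_eq ?_
          rw [norm_smul, norm_smul, Real.norm_of_nonneg (by positivity),
            Real.norm_of_nonneg (by positivity)]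
      _ ≤ e t ^ s * (K * (√(e t) + b t)) +
            s * e t ^ (s - 1) * (K * (e t * (√(e t) + b t))) := by gcongr
      _ = K * (1 + s) * (e t ^ s * (√(e t) + b t)) := by
          rw [Real.rpow_sub_one hpos.ne']
          field_simp

theorem norm_deriv_le (h : PathBounds K δ e b τ Y) (hs : 0 < s) {t : ℝ} (ht : t ∈ Ioo (-δ) δ)
    (hpos : 0 < e t) :
    DifferentiableAt ℝ (pathPTension s e τ Y) t ∧ ‖deriv (pathPTension s e τ Y) t‖ ≤
      (s * K + 1 + s * (|s - 1| * K + 1)) * K * (√(e t) ^ (2 * s - 1) * (√(e t) + b t)) := by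
  have hR : 0 < √(e t) := Real.sqrt_pos.2 hpos
  have hb := h.nonneg_snd t ht
  have hK : 0 ≤ K := hR.le.trans (h.le t ht)
  obtain ⟨hdτ, hleτ⟩ := norm_deriv_rpow_smul_le (σ := s) (h.diff t ht) (h.diff_tension t ht) hpos
    (h.der t ht) (h.tension t ht) (by
      nlinarith [mul_le_mul_of_nonneg_left (h.der_tension t ht) hR.le, mul_nonneg hK hb])
  obtain ⟨hdY, hleY⟩ := norm_deriv_rpow_smul_le (σ := s - 1) (h.diff t ht) (h.diff_grad t ht) hpos
    (h.der t ht) (h.grad t ht)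
    ((mul_le_mul_of_nonneg_left (h.der_grad t ht) hR.le).trans_eq (by ring))
  have hd : HasDerivAt (pathPTension s e τ Y) (deriv (fun t => e t ^ s • τ t) t +
      s • deriv (fun t => e t ^ (s - 1) • Y t) t) t := by
    refine (hdτ.hasDerivAt.add (hdY.hasDerivAt.const_smul s)).congr_of_eventuallyEq
      (.of_forall fun t => ?_)
    simp only [pathPTension, mul_smul, Pi.add_apply, Pi.smul_apply]
  have hpow : √(e t) ^ (2 * (s - 1) - 1) * (√(e t) * √(e t)) = √(e t) ^ (2 * s - 1) := by
    rw [← pow_two, ← Real.rpow_natCast, ← Real.rpow_add hR]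
    push_cast
    ring_nf
  refine ⟨hd.differentiableAt, hd.deriv ▸ (norm_add_le _ _).trans ?_⟩
  rw [norm_smul, Real.norm_of_nonneg hs.le]
  rw [abs_of_pos hs] at hleτ
  refine (add_le_add hleτ (mul_le_mul_of_nonneg_left hleY hs.le)).trans_eq ?_
  rw [← hpow]
  ring

theorem abs_sqrt_sub_le (h : PathBounds K δ e b τ Y) (hK : 0 ≤ K) {t : ℝ} (ht : t ∈ Ioo (-δ) δ) :
    |√(e t) - √(e 0)| ≤ K * |t| :=
  abs_sqrt_sub_sqrt_le hK ht h.nonneg h.diff h.der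

theorem exists_decay_of_sqrt_le {γ : ℝ} (hγ' : γ < 1) (hs : 1 - γ ≤ 2 * s)
    (hK : 1 ≤ K) : ∃ C ≥ 0, ∀ (e b : ℝ → ℝ) (τ Y : ℝ → F), PathBounds K δ e b τ Y →
      ∀ t ∈ Ioo (-δ) δ, t ≠ 0 → √(e 0) ≤ 2 * K * |t| →
        ‖pathPTension s e τ Y t‖ ≤ C * |t| * (|t| ^ (-γ) * (|t| + b 0)) := by
  have hs0 : 0 < s := by linarith
  refine ⟨K * (1 + s) * (K ^ (2 * s - 1 + γ) * (3 * K) ^ (1 - γ) * (4 * K)), by positivity,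
    fun e b τ Y h t ht ht0 hle => ?_⟩
  have hx : 0 < |t| := abs_pos.2 ht0
  have hR : √(e t) ≤ 3 * K * |t| := by linarith [(abs_le.1 (h.abs_sqrt_sub_le (by linarith) ht)).2]
  have hb0 : 0 ≤ b 0 := h.nonneg_snd 0 ⟨by linarith [ht.1, ht.2], by linarith [ht.1, ht.2]⟩
  have hb := h.nonneg_snd t ht
  have hpow : √(e t) ^ (2 * s) ≤ K ^ (2 * s - 1 + γ) * (3 * K * |t|) ^ (1 - γ) := by
    calc √(e t) ^ (2 * s) = √(e t) ^ (2 * s - 1 + γ) * √(e t) ^ (1 - γ) := by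
          rw [← Real.rpow_add_of_nonneg (Real.sqrt_nonneg _) (by linarith) (by linarith)]
          ring_nf
      _ ≤ _ := by
          gcongr
          · linarith
          · exact h.le t ht
  have hsum : √(e t) + b t ≤ 4 * K * (|t| + b 0) := by
    nlinarith [h.snd t ht, mul_nonneg (sub_nonneg.2 hK) hb0]
  have hsplit : (3 * K * |t|) ^ (1 - γ) = (3 * K) ^ (1 - γ) * (|t| ^ (-γ) * |t|) := by
    rw [Real.mul_rpow (by positivity) hx.le, ← Real.rpow_add_one hx.ne', neg_add_eq_sub]
  calc ‖pathPTension s e τ Y t‖ ≤ K * (1 + s) * (√(e t) ^ (2 * s) * (√(e t) + b t)) :=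
        h.norm_le hs0 ht
    _ ≤ K * (1 + s) * (K ^ (2 * s - 1 + γ) * (3 * K * |t|) ^ (1 - γ) * (4 * K * (|t| + b 0))) := by
        gcongr
    _ = _ := by
        rw [hsplit]
        ring

theorem norm_deriv_le_of_sqrt_mem {γ r R₀ β : ℝ} (h : PathBounds K δ e b τ Y) (hγ : 0 < γ)
    (hs : 1 - γ ≤ 2 * s) (hs0 : 0 < s) (hR₀ : 0 < R₀) (hr : r ∈ Ioo (-δ) δ)
    (hlow : R₀ / 2 ≤ √(e r)) (hsum : √(e r) + b r ≤ 3 * (R₀ + β)) :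
    DifferentiableAt ℝ (pathPTension s e τ Y) r ∧ ‖deriv (pathPTension s e τ Y) r‖ ≤
      (s * K + 1 + s * (|s - 1| * K + 1)) * K * (K ^ (2 * s - 1 + γ) * 2 ^ γ * 3) *
        (R₀ ^ (-γ) * (R₀ + β)) := by
  have hpos : 0 < √(e r) := by linarith
  have hK : 0 < K := hpos.trans_le (h.le r hr)
  have hb := h.nonneg_snd r hr
  obtain ⟨hdiff, hle⟩ := h.norm_deriv_le hs0 hr (Real.sqrt_pos.1 hpos)
  refine ⟨hdiff, hle.trans ?_⟩
  have hpow : √(e r) ^ (2 * s - 1) ≤ K ^ (2 * s - 1 + γ) * (2 ^ γ * R₀ ^ (-γ)) := by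
    calc √(e r) ^ (2 * s - 1) = √(e r) ^ (2 * s - 1 + γ) * √(e r) ^ (-γ) := by
          rw [← Real.rpow_add hpos]
          ring_nf
      _ ≤ K ^ (2 * s - 1 + γ) * (R₀ / 2) ^ (-γ) := by
          gcongr ?_ * ?_
          · exact Real.rpow_le_rpow hpos.le (h.le r hr) (by linarith)
          · exact Real.rpow_le_rpow_of_nonpos (by linarith) hlow (by linarith)
      _ = K ^ (2 * s - 1 + γ) * (2 ^ γ * R₀ ^ (-γ)) := by
          rw [Real.div_rpow hR₀.le two_pos.le, Real.rpow_neg two_pos.le,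
            div_inv_eq_mul, mul_comm _ (2 ^ γ)]
  calc (s * K + 1 + s * (|s - 1| * K + 1)) * K * (√(e r) ^ (2 * s - 1) * (√(e r) + b r))
      ≤ (s * K + 1 + s * (|s - 1| * K + 1)) * K *
          (K ^ (2 * s - 1 + γ) * (2 ^ γ * R₀ ^ (-γ)) * (3 * (R₀ + β))) := by gcongr
    _ = _ := by ring

theorem exists_decay_of_lt_sqrt {γ : ℝ} (hγ : 0 < γ) (hs : 1 - γ ≤ 2 * s) (hs0 : 0 < s)
    (hK : 1 ≤ K) : ∃ C ≥ 0, ∀ (e b : ℝ → ℝ) (τ Y : ℝ → F), PathBounds K δ e b τ Y →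
      pathPTension s e τ Y 0 = 0 → ∀ t ∈ Ioo (-δ) δ, 2 * K * |t| < √(e 0) →
        ‖pathPTension s e τ Y t‖ ≤ C * |t| * (√(e 0) ^ (-γ) * (√(e 0) + b 0)) := by
  refine ⟨(s * K + 1 + s * (|s - 1| * K + 1)) * K * (K ^ (2 * s - 1 + γ) * 2 ^ γ * 3),
    by positivity, fun e b τ Y h h0 t ht hlt => ?_⟩
  have hz : (0 : ℝ) ∈ Ioo (-δ) δ := ⟨by linarith [ht.1, ht.2], by linarith [ht.1, ht.2]⟩
  have hR₀ : 0 < √(e 0) := lt_of_le_of_lt (by positivity) hlt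
  have hb0 := h.nonneg_snd 0 hz
  have hsub : uIcc 0 t ⊆ Ioo (-δ) δ := ordConnected_Ioo.uIcc_subset hz ht
  have hKr : ∀ r ∈ uIcc 0 t, K * |r| ≤ K * |t| := fun r hr => by
    have := abs_sub_left_of_mem_uIcc hr
    rw [sub_zero, sub_zero] at this
    gcongr
  have hbound : ∀ r ∈ uIcc 0 t, _ := fun r hr => by
    have hsqrt := abs_le.1 (h.abs_sqrt_sub_le (by linarith) (hsub hr))
    exact h.norm_deriv_le_of_sqrt_mem (β := b 0) hγ hs hs0 hR₀ (hsub hr)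
      (by linarith [hsqrt.1, hKr r hr])
      (by linarith [hsqrt.2, hKr r hr, h.snd r (hsub hr)])
  have hmean := (convex_uIcc (0 : ℝ) t).norm_image_sub_le_of_norm_deriv_le
    (fun r hr => (hbound r hr).1) (fun r hr => (hbound r hr).2) left_mem_uIcc right_mem_uIcc
  rw [h0, sub_zero, sub_zero, Real.norm_eq_abs] at hmean
  exact hmean.trans_eq (by ring)

theorem exists_norm_le_mul_rpow_neg {γ : ℝ} (hγ : 0 < γ) (hγ' : γ < 1) (hs : 1 - γ ≤ 2 * s)
    (hK : 1 ≤ K) : ∃ C, ∀ (e b : ℝ → ℝ) (τ Y : ℝ → F), PathBounds K δ e b τ Y →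
      pathPTension s e τ Y 0 = 0 → ∀ t ∈ Ioo (-δ) δ, t ≠ 0 →
        ‖pathPTension s e τ Y t‖ ≤
          C * (|t| * (√(t ^ 2 + e 0) ^ (-γ) * (√(t ^ 2 + e 0) + b 0))) := by
  obtain ⟨C₁, hC₁, hnear⟩ := exists_decay_of_sqrt_le (F := F) (δ := δ) hγ' hs hK
  obtain ⟨C₂, hC₂, hfar⟩ := exists_decay_of_lt_sqrt (F := F) (δ := δ) hγ hs (by linarith) hK
  refine ⟨(C₁ + C₂) * (1 + 2 * K) ^ γ, fun e b τ Y h h0 t ht ht0 => ?_⟩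
  have hz : (0 : ℝ) ∈ Ioo (-δ) δ := ⟨by linarith [ht.1, ht.2], by linarith [ht.1, ht.2]⟩
  have hx : 0 < |t| := abs_pos.2 ht0
  have he0 := h.nonneg 0 hz
  have hb0 := h.nonneg_snd 0 hz
  have hxρ : |t| ≤ √(t ^ 2 + e 0) := Real.abs_le_sqrt (by linarith)
  have hRρ : √(e 0) ≤ √(t ^ 2 + e 0) := Real.sqrt_le_sqrt (by nlinarith)
  have hρ : √(t ^ 2 + e 0) ≤ |t| + √(e 0) := sqrt_sq_add_le_abs_add_sqrt t he0
  have key : ∀ a > 0, a ≤ √(t ^ 2 + e 0) → √(t ^ 2 + e 0) ≤ (1 + 2 * K) * a →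
      ∀ C ≤ C₁ + C₂, ‖pathPTension s e τ Y t‖ ≤ C * |t| * (a ^ (-γ) * (a + b 0)) →
      ‖pathPTension s e τ Y t‖ ≤ (C₁ + C₂) * (1 + 2 * K) ^ γ *
        (|t| * (√(t ^ 2 + e 0) ^ (-γ) * (√(t ^ 2 + e 0) + b 0))) := by
    intro a ha haρ hρa C hCle hle
    calc ‖pathPTension s e τ Y t‖ ≤ C * |t| * (a ^ (-γ) * (a + b 0)) := hle
      _ ≤ (C₁ + C₂) * |t| * ((1 + 2 * K) ^ γ *
            (√(t ^ 2 + e 0) ^ (-γ) * (√(t ^ 2 + e 0) + b 0))) := by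
          gcongr ?_ * _ * ?_
          exact rpow_neg_mul_add_le hγ ha haρ hρa hb0
      _ = _ := by ring
  rcases le_or_gt (√(e 0)) (2 * K * |t|) with hcase | hcase
  · exact key _ hx hxρ (by linarith) _ (by linarith) (hnear e b τ Y h t ht ht0 hcase)
  · have hpos : 0 < √(e 0) := lt_of_le_of_lt (by positivity) hcase
    exact key _ hpos hRρ (by nlinarith) _ (by linarith) (hfar e b τ Y h h0 t ht hcase)

theorem exists_decay {γ : ℝ} (hγ : 0 < γ) (hγ' : γ < 1) (hs : 1 - γ ≤ 2 * s) (hK : 1 ≤ K)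
    (hδ : δ ≤ 1) : ∃ C ≥ 0, ∀ (e b : ℝ → ℝ) (τ Y : ℝ → F), PathBounds K δ e b τ Y →
      pathPTension s e τ Y 0 = 0 → ∀ t ∈ Ioo (-δ) δ, ‖pathPTension s e τ Y t‖ ^ 2 ≤
        C * (|t| ^ (2 - γ) * (1 + (t ^ 2 + e 0) ^ (-(γ / 2)) * b 0 ^ 2)) := by
  obtain ⟨C, hdecay⟩ := exists_norm_le_mul_rpow_neg (F := F) (δ := δ) hγ hγ' hs hK
  refine ⟨C ^ 2 * (2 * (1 + K) ^ 2), by positivity, fun e b τ Y h h0 t ht => ?_⟩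
  have hz : (0 : ℝ) ∈ Ioo (-δ) δ := ⟨by linarith [ht.1, ht.2], by linarith [ht.1, ht.2]⟩
  have he0 := h.nonneg 0 hz
  rcases eq_or_ne t 0 with rfl | ht0
  · rw [h0, norm_zero, zero_pow two_ne_zero]
    positivity
  have hx1 : |t| ≤ 1 := (abs_lt.2 ht).le.trans hδ
  have hρ : √(t ^ 2 + e 0) ≤ 1 + K :=
    (sqrt_sq_add_le_abs_add_sqrt t he0).trans (add_le_add hx1 (h.le 0 hz))
  have hsq := sq_rpow_neg_mul_add_le (b := b 0) hγ hγ' (abs_pos.2 ht0) hx1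
    (Real.abs_le_sqrt (by linarith)) hρ (by linarith)
  rw [Real.sq_sqrt (by positivity)] at hsq
  calc ‖pathPTension s e τ Y t‖ ^ 2
      ≤ (C * (|t| * (√(t ^ 2 + e 0) ^ (-γ) * (√(t ^ 2 + e 0) + b 0)))) ^ 2 := by
        gcongr
        exact hdecay e b τ Y h h0 t ht ht0
    _ ≤ _ := by
        rw [mul_pow, mul_assoc]
        gcongr

end PathBounds

end Paths

section FamilyDecay

open Filter Topology Asymptotics

variable {m n : ℕ} {W : Type*} [NormedAddCommGroup W]

theorem differentiableAt_time_slice [NormedSpace ℝ W] {X : ℝ × Coord m → W} {t : ℝ} {u : Coord m}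
    (hX : DifferentiableAt ℝ X (t, u)) : DifferentiableAt ℝ (fun t => X (t, u)) t :=
  DifferentiableAt.comp t (f := fun t : ℝ => (t, u)) hX (by fun_prop)

theorem norm_deriv_time_slice_le [NormedSpace ℝ W] {X : ℝ × Coord m → W} {t : ℝ} {u : Coord m}
    (hX : DifferentiableAt ℝ X (t, u)) :
    ‖deriv (fun t => X (t, u)) t‖ ≤ ‖fderiv ℝ X (t, u)‖ := by
  have hd : HasDerivAt (fun t => X (t, u)) (fderiv ℝ X (t, u) (1, 0)) t :=
    HasFDerivAt.comp_hasDerivAt t (f := fun t : ℝ => (t, u)) hX.hasFDerivAt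
      ((hasDerivAt_id t).prodMk (hasDerivAt_const t u))
  rw [hd.deriv]
  simpa using (fderiv ℝ X (t, u)).le_opNorm ((1, 0) : ℝ × Coord m)

theorem exists_forall_Ioo_of_eventually {t₀ : ℝ} {u₀ : Coord m} {P : ℝ × Coord m → Prop}
    (h : ∀ᶠ z in 𝓝 (t₀, u₀), P z) :
    ∃ δ > 0, ∀ᶠ u in 𝓝 u₀, ∀ t ∈ Ioo (t₀ - δ) (t₀ + δ), P (t, u) := by
  rw [nhds_prod_eq, eventually_prod_iff] at h
  obtain ⟨pa, ha, pb, hb, hP⟩ := h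
  obtain ⟨δ, hδ, hball⟩ := Metric.eventually_nhds_iff_ball.1 ha
  refine ⟨δ, hδ, hb.mono fun u hu t ht => hP (hball t ?_) hu⟩
  rwa [Real.ball_eq_Ioo]

theorem eventually_eventually_norm_le_mul {Z : Type*} {l : Filter Z} {X : Z → W} {w : Z → ℝ}
    (hw : ∀ z, 0 ≤ w z) (h : X =O[l] w) : ∀ᶠ K in atTop, ∀ᶠ z in l, ‖X z‖ ≤ K * w z := by
  obtain ⟨c, hc⟩ := h.bound
  filter_upwards [eventually_ge_atTop c] with K hK
  filter_upwards [hc] with z hz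
  rw [Real.norm_of_nonneg (hw z)] at hz
  exact hz.trans (mul_le_mul_of_nonneg_right hK (hw z))

theorem HasOrder.eventually_time_bounds [NormedSpace ℝ W] {X : ℝ × Coord m → W}
    {w w' : ℝ × Coord m → ℝ} {z₀ : ℝ × Coord m} (h : HasOrder z₀ X w w') (hw : ∀ z, 0 ≤ w z)
    (hw' : ∀ z, 0 ≤ w' z) :
    ∀ᶠ K in atTop, ∀ᶠ z in 𝓝 z₀, DifferentiableAt ℝ (fun t => X (t, z.2)) z.1 ∧
      ‖X z‖ ≤ K * w z ∧ ‖deriv (fun t => X (t, z.2)) z.1‖ ≤ K * w' z := by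
  filter_upwards [eventually_eventually_norm_le_mul hw h.val,
    eventually_eventually_norm_le_mul hw' h.der] with K hval hder
  filter_upwards [h.diff, hval, hder] with z hd hv hd'
  exact ⟨differentiableAt_time_slice hd, hv, (norm_deriv_time_slice_le hd).trans hd'⟩

namespace IsSmoothFamily

variable {G : Coord m → Bilin m} {H : Coord n → Bilin n} {f : ℝ × Coord m → Coord n} {u₀ : Coord m}

theorem exists_pathBounds (h : IsSmoothFamily G H f (0, u₀)) :
    ∃ K ≥ 1, ∃ δ > 0, δ ≤ 1 ∧ ∀ᶠ u in 𝓝 u₀,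
      (∀ t ∈ Ioo (-δ) δ, IsSmoothFamily G H f (t, u)) ∧
      PathBounds K δ (fun t => familyDensity G H f (t, u))
        (fun t => ‖spaceDeriv (spaceDeriv f) (t, u)‖) (fun t => familyTension G H f (t, u))
        (fun t => familyGradient G H f (t, u)) := by
  have hR := familyNorm_nonneg (G := G) (H := H) (f := f)
  have hJ := jetSize_nonneg (G := G) (H := H) (f := f)
  have h1 : ∀ _ : ℝ × Coord m, (0 : ℝ) ≤ 1 := fun _ => zero_le_one
  obtain ⟨K, hK, hnorm, hE, hτ, hY, hB⟩ := ((eventually_ge_atTop (1 : ℝ)).and <|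
    (eventually_eventually_norm_le_mul h1 h.familyNorm_isBigO_one).and <|
    (h.hasOrder_familyDensity.eventually_time_bounds (fun z => mul_nonneg (hR z) (hR z)) hR).and <|
    (h.hasOrder_familyTension.eventually_time_bounds hJ h1).and <|
    (h.hasOrder_familyGradient.eventually_time_bounds
      (fun z => mul_nonneg (mul_nonneg (hR z) (hR z)) (hJ z))
      (fun z => mul_nonneg (hR z) (hJ z))).and
    (h.hasOrder_spaceDeriv_spaceDeriv.eventually_time_bounds hJ h1)).exists
  simp only [mul_one, Real.norm_of_nonneg (hR _)] at hnorm hτ hB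
  obtain ⟨δ, hδ, hbox⟩ := exists_forall_Ioo_of_eventually
    (h.eventually.and <| hnorm.and <| hE.and <| hτ.and <| hY.and hB)
  refine ⟨K, hK, min δ 1, by positivity, min_le_right _ _, ?_⟩
  filter_upwards [hbox] with u hu
  have hbounds : ∀ t ∈ Ioo (-min δ 1) (min δ 1), _ := fun t ht => hu t
    ⟨by linarith [ht.1, min_le_left δ 1], by linarith [ht.2, min_le_left δ 1]⟩
  choose! hsmooth hnorm hE hτ hY hB using hbounds
  refine ⟨hsmooth, ⟨fun t ht => (hsmooth t ht).familyDensity_nonneg, hnorm,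
    fun t ht => (hE t ht).1, fun t ht => (hE t ht).2.2, fun t ht => (hτ t ht).1,
    fun t ht => (hτ t ht).2.1, fun t ht => (hτ t ht).2.2, fun t ht => (hY t ht).1,
    fun t ht => (hY t ht).2.1, fun t ht => (hY t ht).2.2, fun t _ => norm_nonneg _,
    fun t ht => ?_⟩⟩
  have hzero : (0 : ℝ) ∈ Ioo (-min δ 1) (min δ 1) :=
    ⟨by linarith [ht.1, ht.2], by linarith [ht.1, ht.2]⟩
  have hmean := (convex_Ioo _ _).norm_image_sub_le_of_norm_deriv_le (fun t ht => (hB t ht).1)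
    (fun t ht => (hB t ht).2.2) hzero ht
  rw [sub_zero, Real.norm_eq_abs] at hmean
  linarith [norm_sub_norm_le (spaceDeriv (spaceDeriv f) (t, u)) (spaceDeriv (spaceDeriv f) (0, u))]

end IsSmoothFamily

end FamilyDecay

section IntegrationByParts

open Filter Topology

theorem hasDerivAt_mul_rpow_neg {γ ε : ℝ} (hε : 0 < ε) (x : ℝ) :
    HasDerivAt (fun x => x * (ε + x ^ 2) ^ (-(γ / 2)))
      ((ε + x ^ 2) ^ (-(γ / 2)) - γ * x ^ 2 * (ε + x ^ 2) ^ (-(γ / 2) - 1)) x := by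
  have hquad : HasDerivAt (fun x : ℝ => ε + x ^ 2) (2 * x) x := by
    simpa using (hasDerivAt_pow 2 x).const_add ε
  exact ((hasDerivAt_id' x).mul
    (hquad.rpow_const (p := -(γ / 2)) (Or.inl (by positivity)))).congr_deriv (by ring)

theorem continuous_add_sq_rpow {ε : ℝ} (hε : 0 < ε) (r : ℝ) :
    Continuous fun x : ℝ => (ε + x ^ 2) ^ r := by
  have hne (x : ℝ) : ε + x ^ 2 ≠ 0 := by positivity
  exact Continuous.rpow_const (by fun_prop) fun x => Or.inl (hne x)

theorem one_sub_mul_rpow_neg_le {γ ε : ℝ} (hγ : 0 ≤ γ) (hε : 0 < ε) (x : ℝ) :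
    (1 - γ) * (ε + x ^ 2) ^ (-(γ / 2)) ≤
      (ε + x ^ 2) ^ (-(γ / 2)) - γ * x ^ 2 * (ε + x ^ 2) ^ (-(γ / 2) - 1) := by
  have hq : 0 < ε + x ^ 2 := by positivity
  have hle : x ^ 2 * (ε + x ^ 2) ^ (-(γ / 2) - 1) ≤ (ε + x ^ 2) ^ (-(γ / 2)) := by
    rw [Real.rpow_sub_one hq.ne', mul_div_assoc', div_le_iff₀ hq, mul_comm]
    gcongr
    linarith
  linarith [mul_le_mul_of_nonneg_left hle hγ]

theorem abs_mul_rpow_neg_le {γ ε : ℝ} (hγ : 0 ≤ γ) (hγ' : γ ≤ 1) (hε : 0 < ε) (x : ℝ) :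
    |x * (ε + x ^ 2) ^ (-(γ / 2))| ≤ 1 + |x| := by
  have hq : 0 < ε + x ^ 2 := by positivity
  rw [abs_mul, abs_of_pos (Real.rpow_pos_of_pos hq _)]
  rcases le_total 1 (ε + x ^ 2) with hlarge | hsmall
  · have : (ε + x ^ 2) ^ (-(γ / 2)) ≤ 1 :=
      Real.rpow_le_one_of_one_le_of_nonpos hlarge (by linarith)
    nlinarith [abs_nonneg x]
  · have habs : |x| ≤ (ε + x ^ 2) ^ (1 / 2 : ℝ) := by
      rw [← Real.sqrt_eq_rpow]
      exact Real.abs_le_sqrt (by linarith)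
    calc |x| * (ε + x ^ 2) ^ (-(γ / 2))
        ≤ (ε + x ^ 2) ^ (1 / 2 : ℝ) * (ε + x ^ 2) ^ (-(γ / 2)) := by gcongr
      _ = (ε + x ^ 2) ^ (1 / 2 - γ / 2) := by rw [← Real.rpow_add hq, sub_eq_add_neg]
      _ ≤ 1 := Real.rpow_le_one hq.le hsmall (by linarith)
      _ ≤ 1 + |x| := by linarith [abs_nonneg x]

variable {E : Type*} [NormedAddCommGroup E] [NormedSpace ℝ E] {f : E → ℝ}

theorem exists_contDiff_hasCompactSupport_eventuallyEq [FiniteDimensional ℝ E] {k : ℕ∞} {u₀ : E}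
    (hf : ∀ᶠ u in 𝓝 u₀, ContDiffAt ℝ k f u) :
    ∃ F : E → ℝ, ContDiff ℝ k F ∧ HasCompactSupport F ∧ F =ᶠ[𝓝 u₀] f := by
  obtain ⟨r, hr, hball⟩ := Metric.eventually_nhds_iff_ball.1 hf
  let χ : ContDiffBump u₀ := ⟨r / 4, r / 2, by positivity, by linarith⟩
  have hsupport : tsupport χ ⊆ Metric.ball u₀ r := by
    rw [χ.tsupport_eq]
    exact Metric.closedBall_subset_ball (half_lt_self hr)
  refine ⟨fun u => χ u * f u, ?_, χ.hasCompactSupport.mul_right, ?_⟩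
  · refine (contMDiff_of_tsupport fun u hu => ContDiffAt.contMDiffAt ?_).contDiff
    exact χ.contDiffAt.mul (hball u (hsupport (tsupport_mul_subset_left hu)))
  · filter_upwards [χ.eventuallyEq_one] with u hu
    simp [hu]

theorem contDiff_fderiv_apply (hf : ContDiff ℝ 2 f) (v : E) :
    ContDiff ℝ 1 fun u => fderiv ℝ f u v :=
  (hf.fderiv_right (by norm_num)).clm_apply contDiff_const

theorem continuous_fderiv_fderiv_apply (hf : ContDiff ℝ 2 f) (v : E) :
    Continuous fun u => fderiv ℝ (fun u => fderiv ℝ f u v) u v :=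
  ((contDiff_fderiv_apply hf v).continuous_fderiv one_ne_zero).clm_apply continuous_const

theorem continuous_rpow_neg_mul_sq_fderiv (hf : ContDiff ℝ 2 f) (v : E) (γ : ℝ) {ε : ℝ}
    (hε : 0 < ε) : Continuous fun u => (ε + f u ^ 2) ^ (-(γ / 2)) * fderiv ℝ f u v ^ 2 :=
  ((continuous_add_sq_rpow hε _).comp hf.continuous).mul
    ((contDiff_fderiv_apply hf v).continuous.pow 2)

variable [MeasurableSpace E] [BorelSpace E] {μ : Measure E}

theorem integrable_mul_sq_fderiv [IsFiniteMeasureOnCompacts μ] (hf : ContDiff ℝ 2 f)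
    (hc : HasCompactSupport f) (v : E) {w : E → ℝ} (hw : Continuous w) :
    Integrable (fun u => w u * fderiv ℝ f u v ^ 2) μ :=
  (hw.mul ((contDiff_fderiv_apply hf v).continuous.pow 2)).integrable_of_hasCompactSupport
    ((hc.fderiv_apply ℝ v).comp_left (g := (· ^ 2)) (zero_pow two_ne_zero)).mul_left

theorem integrable_mul_fderiv_fderiv [IsFiniteMeasureOnCompacts μ] (hf : ContDiff ℝ 2 f)
    (hc : HasCompactSupport f) (v : E) {w : E → ℝ} (hw : Continuous w) :
    Integrable (fun u => w u * fderiv ℝ (fun u => fderiv ℝ f u v) u v) μ :=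
  (hw.mul (continuous_fderiv_fderiv_apply hf v)).integrable_of_hasCompactSupport
    ((hc.fderiv_apply ℝ v).fderiv_apply ℝ v).mul_left

variable [FiniteDimensional ℝ E] [μ.IsAddHaarMeasure]

theorem integral_deriv_comp_mul_sq_fderiv {Φ Φ' : ℝ → ℝ} (hΦ : ∀ x, HasDerivAt Φ (Φ' x) x)
    (hΦ' : Continuous Φ') (hf : ContDiff ℝ 2 f) (hc : HasCompactSupport f) (v : E) :
    ∫ u, Φ' (f u) * fderiv ℝ f u v ^ 2 ∂μ =
      -∫ u, Φ (f u) * fderiv ℝ (fun u => fderiv ℝ f u v) u v ∂μ := by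
  have hΦcont : Continuous Φ := continuous_iff_continuousAt.2 fun x => (hΦ x).continuousAt
  have hchain (u : E) : HasFDerivAt (fun u => Φ (f u)) (Φ' (f u) • fderiv ℝ f u) u :=
    (hΦ (f u)).comp_hasFDerivAt u (hf.differentiable two_ne_zero u).hasFDerivAt
  have hmul (u : E) : fderiv ℝ (fun u => Φ (f u)) u v * fderiv ℝ f u v =
      Φ' (f u) * fderiv ℝ f u v ^ 2 := by
    rw [(hchain u).fderiv, smul_apply, smul_eq_mul]
    ring
  have hint := integral_mul_fderiv_eq_neg_fderiv_mul_of_integrable (μ := μ) (v := v)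
    (f := fun u => Φ (f u)) (g := fun u => fderiv ℝ f u v)
    (by simpa only [hmul, Function.comp_apply] using
      integrable_mul_sq_fderiv hf hc v (hΦ'.comp hf.continuous))
    (integrable_mul_fderiv_fderiv hf hc v (hΦcont.comp hf.continuous))
    (((hΦcont.comp hf.continuous).mul
      (contDiff_fderiv_apply hf v).continuous).integrable_of_hasCompactSupport
        (hc.fderiv_apply ℝ v).mul_left)
    (fun u _ => (hchain u).differentiableAt)
    (fun u _ => (contDiff_fderiv_apply hf v).differentiable one_ne_zero u)
  simp only [hmul] at hint
  rw [hint, neg_neg]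

theorem integral_rpow_neg_mul_sq_fderiv_le (hf : ContDiff ℝ 2 f) (hc : HasCompactSupport f) (v : E)
    {γ : ℝ} (hγ : 0 ≤ γ) (hγ' : γ ≤ 1) {ε : ℝ} (hε : 0 < ε) :
    (1 - γ) * ∫ u, (ε + f u ^ 2) ^ (-(γ / 2)) * fderiv ℝ f u v ^ 2 ∂μ ≤
      ∫ u, (1 + |f u|) * |fderiv ℝ (fun u => fderiv ℝ f u v) u v| ∂μ := by
  have hweight := continuous_add_sq_rpow hε
  have hΦ' : Continuous fun x : ℝ =>
      (ε + x ^ 2) ^ (-(γ / 2)) - γ * x ^ 2 * (ε + x ^ 2) ^ (-(γ / 2) - 1) :=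
    (hweight _).sub (Continuous.mul (by fun_prop) (hweight _))
  have hΦ : Continuous fun x : ℝ => x * (ε + x ^ 2) ^ (-(γ / 2)) := continuous_id.mul (hweight _)
  rw [← integral_const_mul]
  calc ∫ u, (1 - γ) * ((ε + f u ^ 2) ^ (-(γ / 2)) * fderiv ℝ f u v ^ 2) ∂μ
      ≤ ∫ u, ((ε + f u ^ 2) ^ (-(γ / 2)) - γ * f u ^ 2 * (ε + f u ^ 2) ^ (-(γ / 2) - 1)) *
          fderiv ℝ f u v ^ 2 ∂μ := by
        refine integral_mono
          ((integrable_mul_sq_fderiv hf hc v ((hweight _).comp hf.continuous)).const_mul _)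
          (integrable_mul_sq_fderiv hf hc v (hΦ'.comp hf.continuous)) fun u => ?_
        dsimp only
        rw [← mul_assoc]
        exact mul_le_mul_of_nonneg_right (one_sub_mul_rpow_neg_le hγ hε _) (sq_nonneg _)
    _ = ∫ u, -(f u * (ε + f u ^ 2) ^ (-(γ / 2)) *
          fderiv ℝ (fun u => fderiv ℝ f u v) u v) ∂μ := by
        rw [integral_deriv_comp_mul_sq_fderiv (hasDerivAt_mul_rpow_neg hε) hΦ' hf hc, integral_neg]
    _ ≤ ∫ u, (1 + |f u|) * |fderiv ℝ (fun u => fderiv ℝ f u v) u v| ∂μ := by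
        refine integral_mono
          (integrable_mul_fderiv_fderiv hf hc v (hΦ.comp hf.continuous)).neg ?_ fun u => ?_
        · exact (integrable_mul_fderiv_fderiv hf hc v (w := fun u => 1 + |f u|)
            (continuous_const.add hf.continuous.abs)).norm.congr
              (Eventually.of_forall fun u => by
                simp only [norm_mul, Real.norm_eq_abs]
                rw [abs_of_nonneg (by positivity)])
        · refine (neg_le_abs _).trans ?_
          rw [abs_mul]
          exact mul_le_mul_of_nonneg_right (abs_mul_rpow_neg_le hγ hγ' hε _) (abs_nonneg _)

theorem exists_lintegral_rpow_neg_mul_sq_fderiv_le (hf : ContDiff ℝ 2 f) (hc : HasCompactSupport f)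
    (v : E) {γ : ℝ} (hγ : 0 ≤ γ) (hγ' : γ < 1) :
    ∃ C ≥ 0, ∀ ε > 0,
      ∫⁻ u, ENNReal.ofReal ((ε + f u ^ 2) ^ (-(γ / 2)) * fderiv ℝ f u v ^ 2) ∂μ ≤
        ENNReal.ofReal C := by
  have hγ0 : 0 < 1 - γ := sub_pos.2 hγ'
  refine ⟨(1 - γ)⁻¹ * ∫ u, (1 + |f u|) * |fderiv ℝ (fun u => fderiv ℝ f u v) u v| ∂μ,
    by positivity, fun ε hε => ?_⟩
  have hint := integrable_mul_sq_fderiv (μ := μ) hf hc v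
    ((continuous_add_sq_rpow hε (-(γ / 2))).comp hf.continuous)
  simp only [Function.comp_def] at hint
  rw [← ofReal_integral_eq_lintegral_ofReal hint (Eventually.of_forall fun u => by positivity)]
  refine ENNReal.ofReal_le_ofReal ?_
  rw [le_inv_mul_iff₀ hγ0]
  exact integral_rpow_neg_mul_sq_fderiv_le hf hc v hγ hγ'.le hε

end IntegrationByParts

section LIntegral

variable {α ι : Type*} [MeasurableSpace α] {μ : Measure α} {U : Set α} {F : α → ℝ}

theorem setLIntegral_le_of_le_mul_sum [Fintype ι] {W : ι → α → ℝ} {A : ℝ} {C : ι → ℝ} (hA : 0 ≤ A)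
    (hC : ∀ i, 0 ≤ C i) (hW : ∀ i u, 0 ≤ W i u) (hmeas : ∀ i, Measurable (W i))
    (hle : ∀ u ∈ U, F u ≤ A * ∑ i, W i u)
    (hint : ∀ i, ∫⁻ u, ENNReal.ofReal (W i u) ∂μ ≤ ENNReal.ofReal (C i)) :
    ∫⁻ u in U, ENNReal.ofReal (F u) ∂μ ≤ ENNReal.ofReal (A * ∑ i, C i) :=
  calc ∫⁻ u in U, ENNReal.ofReal (F u) ∂μ
      ≤ ∫⁻ u in U, ENNReal.ofReal A * ∑ i, ENNReal.ofReal (W i u) ∂μ := by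
        refine setLIntegral_mono (measurable_const.mul
          (Finset.measurable_fun_sum _ fun i _ => (hmeas i).ennreal_ofReal)) fun u hu => ?_
        rw [← ENNReal.ofReal_sum_of_nonneg fun i _ => hW i u, ← ENNReal.ofReal_mul hA]
        exact ENNReal.ofReal_le_ofReal (hle u hu)
    _ ≤ ∫⁻ u, ENNReal.ofReal A * ∑ i, ENNReal.ofReal (W i u) ∂μ := setLIntegral_le_lintegral _ _
    _ = ENNReal.ofReal A * ∑ i, ∫⁻ u, ENNReal.ofReal (W i u) ∂μ := by
        rw [lintegral_const_mul' _ _ ENNReal.ofReal_ne_top,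
          lintegral_finsetSum _ fun i _ => (hmeas i).ennreal_ofReal]
    _ ≤ ENNReal.ofReal A * ∑ i, ENNReal.ofReal (C i) := by
        gcongr with i
        exact hint i
    _ = ENNReal.ofReal (A * ∑ i, C i) := by
        rw [← ENNReal.ofReal_sum_of_nonneg fun i _ => hC i, ← ENNReal.ofReal_mul hA]

theorem setLIntegral_le_of_le_mul_one_add {W : α → ℝ} {a V C : ℝ} (ha : 0 ≤ a) (hV : 0 ≤ V)
    (hC : 0 ≤ C) (hU : MeasurableSet U) (hμ : μ U ≤ ENNReal.ofReal V) (hW : ∀ u ∈ U, 0 ≤ W u)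
    (hle : ∀ u ∈ U, F u ≤ a * (1 + W u))
    (hint : ∫⁻ u in U, ENNReal.ofReal (W u) ∂μ ≤ ENNReal.ofReal C) :
    ∫⁻ u in U, ENNReal.ofReal (F u) ∂μ ≤ ENNReal.ofReal (a * (V + C)) :=
  calc ∫⁻ u in U, ENNReal.ofReal (F u) ∂μ
      ≤ ∫⁻ u in U, ENNReal.ofReal a * (1 + ENNReal.ofReal (W u)) ∂μ := by
        refine setLIntegral_mono' hU fun u hu => ?_
        rw [← ENNReal.ofReal_one, ← ENNReal.ofReal_add zero_le_one (hW u hu),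
          ← ENNReal.ofReal_mul ha]
        exact ENNReal.ofReal_le_ofReal (hle u hu)
    _ = ENNReal.ofReal a * (μ U + ∫⁻ u in U, ENNReal.ofReal (W u) ∂μ) := by
        rw [lintegral_const_mul' _ _ ENNReal.ofReal_ne_top, lintegral_add_left measurable_const,
          setLIntegral_one]
    _ ≤ ENNReal.ofReal a * (ENNReal.ofReal V + ENNReal.ofReal C) := by gcongr
    _ = ENNReal.ofReal (a * (V + C)) := by
        rw [← ENNReal.ofReal_add hV hC, ← ENNReal.ofReal_mul ha]

end LIntegral

section LocalDecay

open Filter Topology Asymptotics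

variable {m n : ℕ}

theorem opNorm_le_sum_stdVec {F : Type*} [NormedAddCommGroup F] [NormedSpace ℝ F]
    (L : Coord m →L[ℝ] F) : ‖L‖ ≤ ∑ i, ‖L (stdVec i)‖ := by
  refine L.opNorm_le_bound (Finset.sum_nonneg fun i _ => norm_nonneg _) fun v => ?_
  conv_lhs => rw [← sum_coord_smul_stdVec v]
  rw [map_sum, Finset.sum_mul]
  refine (norm_sum_le _ _).trans (Finset.sum_le_sum fun i _ => ?_)
  rw [map_smul, norm_smul, mul_comm]
  exact mul_le_mul_of_nonneg_left (PiLp.norm_apply_le v i) (norm_nonneg _)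

theorem norm_le_sum_abs_apply (v : Coord m) : ‖v‖ ≤ ∑ i, |v i| := by
  conv_lhs => rw [← sum_coord_smul_stdVec v]
  refine (norm_sum_le _ _).trans_eq (Finset.sum_congr rfl fun i _ => ?_)
  simp [norm_smul, stdVec]

theorem sq_opNorm_le_card_mul_sum_sq (B : Coord m →L[ℝ] Coord m →L[ℝ] Coord n) :
    ‖B‖ ^ 2 ≤ Fintype.card (Fin m × Fin m × Fin n) *
      ∑ x : Fin m × Fin m × Fin n, B (stdVec x.1) (stdVec x.2.1) x.2.2 ^ 2 := by
  have hsum : ‖B‖ ≤ ∑ x : Fin m × Fin m × Fin n, |B (stdVec x.1) (stdVec x.2.1) x.2.2| := by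
    simp only [Fintype.sum_prod_type]
    refine (opNorm_le_sum_stdVec B).trans (Finset.sum_le_sum fun i _ => ?_)
    exact (opNorm_le_sum_stdVec _).trans (Finset.sum_le_sum fun j _ => norm_le_sum_abs_apply _)
  refine (pow_le_pow_left₀ B.opNorm_nonneg hsum 2).trans (sq_sum_le_card_mul_sum_sq.trans_eq ?_)
  simp only [Finset.card_univ, sq_abs]

theorem rpow_neg_le_mul_rpow_neg {r A y z : ℝ} (hr : 0 ≤ r) (hA : 0 < A) (hy : 0 < y) (hz : 0 < z)
    (h : z ≤ A * y) : y ^ (-r) ≤ A ^ r * z ^ (-r) := by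
  have hle := Real.rpow_le_rpow_of_nonpos hz h (neg_nonpos.2 hr)
  rwa [Real.mul_rpow hA.le hy.le, Real.rpow_neg hA.le, inv_mul_le_iff₀ (by positivity)] at hle

variable {G : Coord m → Bilin m} {H : Coord n → Bilin n} {f : ℝ × Coord m → Coord n}

theorem contDiffAt_spaceDeriv_coord {z : ℝ × Coord m} (hf : ContDiffAt ℝ ∞ f z) (v : Coord m)
    (i : Fin n) : ContDiffAt ℝ ∞ (fun u => spaceDeriv f (z.1, u) v i) z.2 :=
  (EuclideanSpace.proj (𝕜 := ℝ) i).contDiff.contDiffAt.comp z.2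
    (contDiffAt_slice (contDiffAt_spaceDeriv_apply hf v))

theorem fderiv_spaceDeriv_coord {z : ℝ × Coord m} (hf : ContDiffAt ℝ ∞ f z) (v w : Coord m)
    (i : Fin n) : fderiv ℝ (fun u => spaceDeriv f (z.1, u) w i) z.2 v =
      spaceDeriv (spaceDeriv f) z v w i := by
  have hd := (contDiffAt_spaceDeriv_apply hf w).differentiableAt (by simp)
  have hcomp : HasFDerivAt (fun u => spaceDeriv f (z.1, u) w i)
      ((EuclideanSpace.proj (𝕜 := ℝ) i).comp (fderiv ℝ (fun u => spaceDeriv f (z.1, u) w) z.2))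
      z.2 :=
    (EuclideanSpace.proj (𝕜 := ℝ) i).hasFDerivAt.comp z.2
      ((contDiffAt_slice (contDiffAt_spaceDeriv_apply hf w)).differentiableAt
        (by simp)).hasFDerivAt
  rw [hcomp.fderiv, fderiv_slice (f := fun z => spaceDeriv f z w) hd,
    ContinuousLinearMap.comp_apply, spaceDeriv_spaceDeriv_apply hf]
  rfl

theorem abs_apply_stdVec_le_opNorm (L : Coord m →L[ℝ] Coord n) (j : Fin m) (i : Fin n) :
    |L (stdVec j) i| ≤ ‖L‖ :=
  (PiLp.norm_apply_le (L (stdVec j)) i).trans <| by simpa [stdVec] using L.le_opNorm (stdVec j)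

/-- Integration by parts applies to the weights on the right-hand side, each of which involves a
single first derivative. -/
theorem rpow_neg_mul_sq_opNorm_le {L : Coord m →L[ℝ] Coord n}
    (B : Coord m →L[ℝ] Coord m →L[ℝ] Coord n) {c e ε γ : ℝ} (hc : 0 < c) (hε : 0 < ε) (hγ : 0 ≤ γ)
    (hL : c * ‖L‖ ^ 2 ≤ e) :
    (ε + e) ^ (-(γ / 2)) * ‖B‖ ^ 2 ≤
      max 1 c⁻¹ ^ (γ / 2) * Fintype.card (Fin m × Fin m × Fin n) *
        ∑ x : Fin m × Fin m × Fin n, (ε + L (stdVec x.2.1) x.2.2 ^ 2) ^ (-(γ / 2)) *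
          B (stdVec x.1) (stdVec x.2.1) x.2.2 ^ 2 := by
  set A := max 1 c⁻¹
  have he : 0 ≤ e := le_trans (by positivity) hL
  have hweight (x : Fin m × Fin m × Fin n) : (ε + e) ^ (-(γ / 2)) ≤
      A ^ (γ / 2) * (ε + L (stdVec x.2.1) x.2.2 ^ 2) ^ (-(γ / 2)) := by
    refine rpow_neg_le_mul_rpow_neg (by positivity) (by positivity) (by positivity)
      (by positivity) ?_
    calc ε + L (stdVec x.2.1) x.2.2 ^ 2 ≤ ε + ‖L‖ ^ 2 := by
          rw [← sq_abs]
          gcongr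
          exact abs_apply_stdVec_le_opNorm L _ _
      _ ≤ 1 * ε + c⁻¹ * e := by rwa [one_mul, add_le_add_iff_left, le_inv_mul_iff₀ hc]
      _ ≤ A * (ε + e) := by
          rw [mul_add]
          gcongr
          exacts [le_max_left _ _, le_max_right _ _]
  calc (ε + e) ^ (-(γ / 2)) * ‖B‖ ^ 2
      ≤ (ε + e) ^ (-(γ / 2)) * (Fintype.card (Fin m × Fin m × Fin n) *
          ∑ x : Fin m × Fin m × Fin n, B (stdVec x.1) (stdVec x.2.1) x.2.2 ^ 2) := by
        gcongr
        exact sq_opNorm_le_card_mul_sum_sq B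
    _ = Fintype.card (Fin m × Fin m × Fin n) * ∑ x : Fin m × Fin m × Fin n,
          (ε + e) ^ (-(γ / 2)) * B (stdVec x.1) (stdVec x.2.1) x.2.2 ^ 2 := by
        rw [← Finset.mul_sum, mul_left_comm]
    _ ≤ Fintype.card (Fin m × Fin m × Fin n) * ∑ x : Fin m × Fin m × Fin n,
          A ^ (γ / 2) * (ε + L (stdVec x.2.1) x.2.2 ^ 2) ^ (-(γ / 2)) *
            B (stdVec x.1) (stdVec x.2.1) x.2.2 ^ 2 := by
        gcongr with x
        exact hweight x
    _ = _ := by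
        simp only [mul_assoc, ← Finset.mul_sum]
        rw [mul_left_comm]

namespace IsSmoothFamily

theorem exists_cutoff {u₀ : Coord m} (h : IsSmoothFamily G H f (0, u₀)) (v w : Coord m)
    (i : Fin n) :
    ∃ a : Coord m → ℝ, ContDiff ℝ 2 a ∧ HasCompactSupport a ∧ ∀ᶠ u in 𝓝 u₀,
      a u = spaceDeriv f (0, u) w i ∧ fderiv ℝ a u v = spaceDeriv (spaceDeriv f) (0, u) v w i := by
  have hsmooth : ∀ᶠ u in 𝓝 u₀, ContDiffAt ℝ ∞ f (0, u) :=
    (tendsto_slice (0, u₀)).eventually (h.eventually.mono fun _ hz => hz.contDiffAt_map)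
  obtain ⟨a, ha, hac, heq⟩ := exists_contDiff_hasCompactSupport_eventuallyEq (k := ⊤)
    (f := fun u => spaceDeriv f (0, u) w i)
    (hsmooth.mono fun u hu => contDiffAt_spaceDeriv_coord (z := (0, u)) hu w i)
  refine ⟨a, ha.of_le ENat.LEInfty.out, hac, ?_⟩
  filter_upwards [heq.eventuallyEq_nhds, hsmooth] with u hu hfu
  exact ⟨hu.eq_of_nhds, by rw [hu.fderiv_eq]; exact fderiv_spaceDeriv_coord hfu v w i⟩

theorem exists_lintegral_weight_le {u₀ : Coord m} (h : IsSmoothFamily G H f (0, u₀)) {γ : ℝ}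
    (hγ : 0 ≤ γ) (hγ' : γ < 1) :
    ∃ C ≥ 0, ∀ᶠ U in (𝓝 u₀).smallSets, ∀ ε > 0,
      ∫⁻ u in U, ENNReal.ofReal ((ε + familyDensity G H f (0, u)) ^ (-(γ / 2)) *
          ‖spaceDeriv (spaceDeriv f) (0, u)‖ ^ 2) ≤ ENNReal.ofReal C := by
  choose a ha hac hcut using fun x : Fin m × Fin m × Fin n =>
    h.exists_cutoff (stdVec x.1) (stdVec x.2.1) x.2.2
  choose C hC hint using fun x => exists_lintegral_rpow_neg_mul_sq_fderiv_le
    (μ := volume) (ha x) (hac x) (stdVec x.1) hγ hγ'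
  obtain ⟨c, hc, hlow⟩ := h.exists_sq_le_familyDensity
  set A : ℝ := max 1 c⁻¹ ^ (γ / 2) * Fintype.card (Fin m × Fin m × Fin n)
  have hA : 0 ≤ A := by positivity
  refine ⟨A * ∑ x, C x, mul_nonneg hA (Finset.sum_nonneg fun x _ => hC x), ?_⟩
  filter_upwards [eventually_smallSets_subset.2
    (((tendsto_slice (0, u₀)).eventually hlow).and (eventually_all.2 hcut))] with U hU ε hε
  refine setLIntegral_le_of_le_mul_sum hA hC
    (W := fun x u => (ε + a x u ^ 2) ^ (-(γ / 2)) * fderiv ℝ (a x) u (stdVec x.1) ^ 2)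
    (fun x u => by positivity)
    (fun x => (continuous_rpow_neg_mul_sq_fderiv (ha x) (stdVec x.1) γ hε).measurable)
    (fun u hu => ?_) fun x => hint x ε hε
  obtain ⟨hle, heq⟩ := hU hu
  simp only [(heq _).1, (heq _).2]
  exact rpow_neg_mul_sq_opNorm_le _ hc hε hγ hle

end IsSmoothFamily

end LocalDecay

section FamilyPTension

open Filter Topology Asymptotics

variable {m n : ℕ}

/-- The `p`-tension field of a family of maps. -/
def familyPTension (G : Coord m → Bilin m) (H : Coord n → Bilin n) (p : ℝ)
    (f : ℝ × Coord m → Coord n) (z : ℝ × Coord m) : Coord n :=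
  coordTension G H p (fun u => f (z.1, u)) z.2

/-- The squared norm of the `p`-tension field of a family of maps. -/
def familyPTensionSq (G : Coord m → Bilin m) (H : Coord n → Bilin n) (p : ℝ)
    (f : ℝ × Coord m → Coord n) (z : ℝ × Coord m) : ℝ :=
  H (f z) (familyPTension G H p f z) (familyPTension G H p f z)

theorem tendsto_initial_slice {T X : Type*} [TopologicalSpace T] [TopologicalSpace X] (t₀ : T)
    (x₀ : X) : Tendsto (fun z : T × X => (t₀, z.2)) (𝓝 (t₀, x₀)) (𝓝 (t₀, x₀)) :=
  Continuous.tendsto' (by fun_prop) _ _ rfl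

theorem sub_initial_slice_isBigO {V W : Type*} [NormedAddCommGroup V] [NormedSpace ℝ V]
    [NormedAddCommGroup W] [NormedSpace ℝ W] {X : ℝ × V → W} {t₀ : ℝ} {u₀ : V}
    (hX : ContDiffAt ℝ 1 X (t₀, u₀)) :
    (fun z => X z - X (t₀, z.2)) =O[𝓝 (t₀, u₀)] fun z => z.1 - t₀ := by
  obtain ⟨K, S, hS, hK⟩ := hX.exists_lipschitzOnWith
  refine IsBigO.of_bound K ?_
  filter_upwards [hS, (tendsto_initial_slice t₀ u₀).eventually hS] with z hz hz₀
  have hdist := hK.dist_le_mul _ hz _ hz₀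
  rw [dist_eq_norm] at hdist
  simpa [Prod.dist_eq, Real.dist_eq] using hdist

theorem eventually_smallSets_eventually_forall {T X : Type*} [TopologicalSpace T]
    [TopologicalSpace X] {t₀ : T} {x₀ : X} {P : T × X → Prop} (h : ∀ᶠ z in 𝓝 (t₀, x₀), P z) :
    ∀ᶠ U in (𝓝 x₀).smallSets, ∀ᶠ t in 𝓝 t₀, ∀ x ∈ U, P (t, x) := by
  rw [nhds_prod_eq, eventually_prod_iff] at h
  obtain ⟨_, ht, _, hx, hP⟩ := h
  exact (eventually_smallSets_subset.2 hx).mono fun U hU => ht.mono fun t ht x hx => hP ht (hU hx)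

theorem tendsto_rpow_sub_one_smul {Z W : Type*} [TopologicalSpace Z] [NormedAddCommGroup W]
    [NormedSpace ℝ W] {E : Z → ℝ} {Y : Z → W} {z : Z} {s : ℝ} (hs : 0 < s)
    (hE : ContinuousAt E z) (hEz : E z = 0) (hE0 : ∀ᶠ y in 𝓝 z, 0 ≤ E y) (hY : Y =O[𝓝 z] E) :
    Tendsto (fun y => E y ^ (s - 1) • Y y) (𝓝 z) (𝓝 0) := by
  have hpow : Tendsto (fun y => E y ^ s) (𝓝 z) (𝓝 0) := by
    have := hE.rpow_const (p := s) (Or.inr hs.le)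
    rwa [ContinuousAt, hEz, Real.zero_rpow hs.ne'] at this
  refine IsBigO.trans_tendsto ?_ hpow
  refine ((isBigO_refl (fun y => E y ^ (s - 1)) (𝓝 z)).smul hY).trans
    (IsBigO.of_norm_eventuallyLE ?_)
  filter_upwards [hE0] with y hy
  rcases hy.eq_or_lt' with hy0 | hy0
  · simp [hy0, Real.zero_rpow hs.ne']
  · rw [smul_eq_mul, ← Real.rpow_add_one hy0.ne', sub_add_cancel, Real.norm_of_nonneg]
    positivity

variable {G : Coord m → Bilin m} {H : Coord n → Bilin n} {f : ℝ × Coord m → Coord n} {p γ : ℝ}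

namespace IsSmoothFamily

section

variable {z : ℝ × Coord m}

theorem familyPTension_eventuallyEq (h : IsSmoothFamily G H f z) (hp : 2 ≤ p) :
    familyPTension G H p f =ᶠ[𝓝 z] fun z =>
      familyDensity G H f z ^ ((p - 2) / 2) • familyTension G H f z +
        ((p - 2) / 2 * familyDensity G H f z ^ ((p - 2) / 2 - 1)) • familyGradient G H f z :=
  h.eventually.mono fun _ hy => hy.coordTension_slice hp

theorem familyPTension_eq_zero (h : IsSmoothFamily G H f z) (hp : 2 < p)
    (h0 : familyDensity G H f z = 0) : familyPTension G H p f z = 0 := by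
  have hgradient : familyGradient G H f z = 0 := by
    simp [familyGradient, metricTrace, h.spaceDeriv_eq_zero h0]
  rw [(h.familyPTension_eventuallyEq hp.le).eq_of_nhds, hgradient, h0,
    Real.zero_rpow (by linarith), zero_smul, smul_zero, add_zero]

theorem contDiffAt_familyPTension (h : IsSmoothFamily G H f z) (hp : 2 ≤ p)
    (h0 : p = 2 ∨ 0 < familyDensity G H f z) : ContDiffAt ℝ ∞ (familyPTension G H p f) z := by
  refine ContDiffAt.congr_of_eventuallyEq ?_ (h.familyPTension_eventuallyEq hp)
  rcases h0 with rfl | h0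
  · simpa using h.contDiffAt_familyTension
  · have hE := h.contDiffAt_familyDensity
    exact ((hE.rpow_const_of_ne h0.ne').smul h.contDiffAt_familyTension).add
      ((contDiffAt_const.mul (hE.rpow_const_of_ne h0.ne')).smul h.contDiffAt_familyGradient)

theorem familyGradient_isBigO_familyDensity (h : IsSmoothFamily G H f z) :
    familyGradient G H f =O[𝓝 z] familyDensity G H f := by
  refine (h.hasOrder_familyGradient.val.trans ((isBigO_refl
    (fun z => familyNorm G H f z * familyNorm G H f z) (𝓝 z)).mul h.jetSize_isBigO_one)).congr'
    EventuallyEq.rfl ?_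
  filter_upwards [h.eventually] with y hy
  rw [mul_one, familyNorm, Real.mul_self_sqrt hy.familyDensity_nonneg]

theorem continuousAt_familyPTension (h : IsSmoothFamily G H f z) (hp : 2 ≤ p) :
    ContinuousAt (familyPTension G H p f) z := by
  rcases eq_or_lt_of_le hp with rfl | hp'
  · exact (h.contDiffAt_familyPTension le_rfl (Or.inl rfl)).continuousAt
  rcases h.familyDensity_nonneg.eq_or_lt' with h0 | h0
  swap
  · exact (h.contDiffAt_familyPTension hp (Or.inr h0)).continuousAt
  have hs : 0 < (p - 2) / 2 := by linarith
  have hE := h.contDiffAt_familyDensity.continuousAt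
  have hleading : Tendsto (fun z => familyDensity G H f z ^ ((p - 2) / 2) • familyTension G H f z)
      (𝓝 z) (𝓝 0) := by
    have := (hE.rpow_const (p := (p - 2) / 2) (Or.inr hs.le)).tendsto.smul
      h.contDiffAt_familyTension.continuousAt.tendsto
    rwa [h0, Real.zero_rpow hs.ne', zero_smul] at this
  have hgradient := (tendsto_rpow_sub_one_smul hs hE h0
    (h.eventually.mono fun _ hy => hy.familyDensity_nonneg)
    h.familyGradient_isBigO_familyDensity).const_smul ((p - 2) / 2)
  rw [ContinuousAt, h.familyPTension_eq_zero hp' h0]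
  simpa only [smul_smul, smul_zero, add_zero] using
    (hleading.add hgradient).congr' (by
      simpa only [smul_smul] using (h.familyPTension_eventuallyEq hp).symm)

theorem continuousAt_familyPTensionSq (h : IsSmoothFamily G H f z) (hp : 2 ≤ p) :
    ContinuousAt (familyPTensionSq G H p f) z :=
  (h.contDiffAt_target.continuousAt.clm_apply (h.continuousAt_familyPTension hp)).clm_apply
    (h.continuousAt_familyPTension hp)

theorem contDiffAt_familyPTensionSq (h : IsSmoothFamily G H f z) (hp : 2 ≤ p)
    (h0 : familyPTensionSq G H p f z ≠ 0) : ContDiffAt ℝ ∞ (familyPTensionSq G H p f) z := by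
  have hregular : p = 2 ∨ 0 < familyDensity G H f z := by
    rcases eq_or_lt_of_le hp with rfl | hp'
    · exact Or.inl rfl
    refine Or.inr (h.familyDensity_nonneg.lt_of_ne' fun hE => h0 ?_)
    simp [familyPTensionSq, h.familyPTension_eq_zero hp' hE]
  have hτ := h.contDiffAt_familyPTension hp hregular
  exact (h.contDiffAt_target.clm_apply hτ).clm_apply hτ

end

variable {u₀ : Coord m}

theorem exists_familyPTension_two_decay (h : IsSmoothFamily G H f (0, u₀)) (hγ : 0 ≤ γ)
    (hγ' : γ ≤ 2) (h0 : ∀ᶠ u in 𝓝 u₀, familyPTension G H 2 f (0, u) = 0) :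
    ∃ C ≥ 0, ∀ᶠ z in 𝓝 (0, u₀), ‖familyPTension G H 2 f z‖ ^ 2 ≤ C * |z.1| ^ (2 - γ) := by
  obtain ⟨K, hlip⟩ := (sub_initial_slice_isBigO
    ((h.contDiffAt_familyPTension le_rfl (Or.inl rfl)).of_le ENat.LEInfty.out)).bound
  have hsmall : ∀ᶠ z in 𝓝 ((0 : ℝ), u₀), |z.1| < 1 :=
    continuous_fst.abs.continuousAt.eventually_lt continuousAt_const (by simp)
  refine ⟨K ^ 2, sq_nonneg K, ?_⟩
  filter_upwards [hlip, continuous_snd.continuousAt.eventually h0, hsmall] with z hz hzero hz1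
  rw [hzero, sub_zero, sub_zero, Real.norm_eq_abs] at hz
  calc _ ≤ (K * |z.1|) ^ 2 := by gcongr
    _ = K ^ 2 * |z.1| ^ (2 : ℝ) := by rw [mul_pow, Real.rpow_two]
    _ ≤ K ^ 2 * |z.1| ^ (2 - γ) := mul_le_mul_of_nonneg_left
        (Real.rpow_le_rpow_of_exponent_ge' (abs_nonneg _) hz1.le (by linarith) (by linarith))
        (sq_nonneg K)

theorem exists_familyPTension_decay_of_le (h : IsSmoothFamily G H f (0, u₀)) (hγ : 0 < γ)
    (hγ' : γ < 1) (hp : 3 - γ ≤ p) (h0 : ∀ᶠ u in 𝓝 u₀, familyPTension G H p f (0, u) = 0) :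
    ∃ C ≥ 0, ∀ᶠ z in 𝓝 (0, u₀), ‖familyPTension G H p f z‖ ^ 2 ≤ C * (|z.1| ^ (2 - γ) *
      (1 + (z.1 ^ 2 + familyDensity G H f (0, z.2)) ^ (-(γ / 2)) *
        ‖spaceDeriv (spaceDeriv f) (0, z.2)‖ ^ 2)) := by
  obtain ⟨K, hK, δ, hδ, hδ1, hb⟩ := h.exists_pathBounds
  obtain ⟨C, hC, hdecay⟩ := PathBounds.exists_decay (F := Coord n) (s := (p - 2) / 2) hγ hγ'
    (by linarith) hK hδ1
  refine ⟨C, hC, ?_⟩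
  rw [nhds_prod_eq]
  filter_upwards [prod_mem_prod (Ioo_mem_nhds (neg_lt_zero.2 hδ) hδ) (hb.and h0)]
    with z ⟨ht, ⟨hsmooth, hbounds⟩, hzero⟩
  have hslice : ∀ t ∈ Ioo (-δ) δ, familyPTension G H p f (t, z.2) = _ := fun t ht =>
    (hsmooth t ht).coordTension_slice (p := p) (by linarith)
  change ‖familyPTension G H p f (z.1, z.2)‖ ^ 2 ≤ _
  rw [hslice z.1 ht]
  rw [hslice 0 ⟨by linarith, hδ⟩] at hzero
  exact hdecay _ _ _ _ hbounds hzero z.1 ht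

theorem exists_familyPTension_decay (h : IsSmoothFamily G H f (0, u₀)) (hγ : 0 < γ) (hγ' : γ < 1)
    (hp : p = 2 ∨ 3 - γ ≤ p) (h0 : ∀ᶠ u in 𝓝 u₀, familyPTension G H p f (0, u) = 0) :
    ∃ C ≥ 0, ∀ᶠ z in 𝓝 (0, u₀), ‖familyPTension G H p f z‖ ^ 2 ≤ C * (|z.1| ^ (2 - γ) *
      (1 + (z.1 ^ 2 + familyDensity G H f (0, z.2)) ^ (-(γ / 2)) *
        ‖spaceDeriv (spaceDeriv f) (0, z.2)‖ ^ 2)) := by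
  rcases hp with rfl | hp
  · obtain ⟨C, hC, hdecay⟩ := h.exists_familyPTension_two_decay hγ.le (by linarith) h0
    refine ⟨C, hC, ?_⟩
    filter_upwards [hdecay, (tendsto_initial_slice 0 u₀).eventually h.eventually] with z hz hsmooth
    have hE := hsmooth.familyDensity_nonneg
    refine hz.trans (mul_le_mul_of_nonneg_left (le_mul_of_one_le_right ?_ ?_) hC)
    · positivity
    · exact le_add_of_nonneg_right (by positivity)
  · exact h.exists_familyPTension_decay_of_le hγ hγ' hp h0

theorem exists_familyPTensionSq_decay (h : IsSmoothFamily G H f (0, u₀)) (hγ : 0 < γ)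
    (hγ' : γ < 1) (hp : p = 2 ∨ 3 - γ ≤ p)
    (h0 : ∀ᶠ u in 𝓝 u₀, familyPTension G H p f (0, u) = 0) :
    ∃ C ≥ 0, ∀ᶠ z in 𝓝 (0, u₀), familyPTensionSq G H p f z ≤ C * |z.1| ^ (2 - γ) *
      (1 + (z.1 ^ 2 + familyDensity G H f (0, z.2)) ^ (-(γ / 2)) *
        ‖spaceDeriv (spaceDeriv f) (0, z.2)‖ ^ 2) := by
  obtain ⟨C, hC, hdecay⟩ := h.exists_familyPTension_decay hγ hγ' hp h0
  have hH : ∀ᶠ z in 𝓝 ((0 : ℝ), u₀), ‖H (f z)‖ < ‖H (f (0, u₀))‖ + 1 :=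
    h.contDiffAt_target.continuousAt.norm.eventually_lt continuousAt_const (lt_add_one _)
  refine ⟨(‖H (f (0, u₀))‖ + 1) * C, by positivity, ?_⟩
  filter_upwards [hdecay, hH] with z hτ hHz
  calc familyPTensionSq G H p f z
      ≤ ‖H (f z)‖ * ‖familyPTension G H p f z‖ * ‖familyPTension G H p f z‖ :=
        (le_abs_self _).trans ((H (f z)).le_opNorm₂ _ _)
    _ = ‖H (f z)‖ * ‖familyPTension G H p f z‖ ^ 2 := by rw [mul_assoc, ← sq]
    _ ≤ (‖H (f (0, u₀))‖ + 1) * (C * (|z.1| ^ (2 - γ) *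
        (1 + (z.1 ^ 2 + familyDensity G H f (0, z.2)) ^ (-(γ / 2)) *
          ‖spaceDeriv (spaceDeriv f) (0, z.2)‖ ^ 2))) := by gcongr
    _ = _ := by ring

theorem exists_lintegral_familyPTensionSq_le (h : IsSmoothFamily G H f (0, u₀)) (hγ : 0 < γ)
    (hγ' : γ < 1) (hp : p = 2 ∨ 3 - γ ≤ p)
    (h0 : ∀ᶠ u in 𝓝 u₀, familyPTension G H p f (0, u) = 0) :
    ∃ C ≥ 0, ∀ᶠ U in (𝓝 u₀).smallSets, MeasurableSet U → ∀ᶠ t in 𝓝 0,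
      ∫⁻ u in U, ENNReal.ofReal (familyPTensionSq G H p f (t, u)) ≤
        ENNReal.ofReal (C * |t| ^ (2 - γ)) := by
  obtain ⟨C₁, hC₁, hdecay⟩ := h.exists_familyPTensionSq_decay hγ hγ' hp h0
  obtain ⟨C₂, hC₂, hint⟩ := h.exists_lintegral_weight_le hγ.le hγ'
  set V := (volume (Metric.ball u₀ 1)).toReal
  have hsmooth := (tendsto_slice (0, u₀)).eventually h.eventually
  refine ⟨C₁ * (V + C₂), by positivity, ?_⟩
  filter_upwards [hint, eventually_smallSets_eventually_forall hdecay,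
    eventually_smallSets_subset.2 (h0.and hsmooth),
    eventually_smallSets_subset.2 (Metric.ball_mem_nhds u₀ one_pos)]
    with U hUint hUdecay hU hUball hUm
  filter_upwards [hUdecay] with t ht
  rcases eq_or_ne t 0 with rfl | ht0
  · refine (setLIntegral_congr_fun hUm fun u hu => ?_).trans_le
      ((setLIntegral_const U 0).trans_le (by simp))
    simp [familyPTensionSq, (hU hu).1]
  rw [mul_right_comm]
  refine setLIntegral_le_of_le_mul_one_add (by positivity) ENNReal.toReal_nonneg hC₂ hUm ?_
    (fun u hu => ?_) ht (hUint (t ^ 2) (by positivity))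
  · rw [ENNReal.ofReal_toReal measure_ball_lt_top.ne]
    exact measure_mono hUball
  · have hE := (hU hu).2.familyDensity_nonneg
    positivity

end IsSmoothFamily

end FamilyPTension

section Variations

open Filter Topology Asymptotics

theorem isBigO_of_isCompact {T X : Type*} [TopologicalSpace T] [TopologicalSpace X] {K : Set X}
    {t₀ : T} {F : T × X → ℝ} {w : T → ℝ} (hK : IsCompact K)
    (hF : ∀ x ∈ K, F =O[𝓝 (t₀, x)] fun z => w z.1) :
    F =O[𝓝 t₀ ×ˢ 𝓟 K] fun z => w z.1 := by
  refine hK.induction_on (by simp)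
    (fun s t hst ht => ht.mono (prod_mono le_rfl (principal_mono.2 hst)))
    (fun s t hs ht => by rw [← sup_principal, prod_sup]; exact hs.sup ht) fun x hx => ?_
  obtain ⟨C, hC⟩ := (hF x hx).bound
  rw [nhds_prod_eq, eventually_prod_iff] at hC
  obtain ⟨_, ht, _, hx, hle⟩ := hC
  refine ⟨_, mem_nhdsWithin_of_mem_nhds hx, IsBigO.of_bound C ?_⟩
  filter_upwards [prod_mem_prod ht (mem_principal_self _)] with z hz
  exact hle hz.1 hz.2

variable {m n : ℕ}
  {M : Type*} [TopologicalSpace M] [ChartedSpace (EuclideanSpace ℝ (Fin m)) M]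
  {N : Type*} [TopologicalSpace N] [ChartedSpace (EuclideanSpace ℝ (Fin n)) N]
  {φ : M → N} {D : Set M} {ε : ℝ} {Φ : ℝ → M → N} {t₀ p : ℝ} {a : M} {b : N} {u₀ : Coord m}

theorem mem_chartMapDomain_apply {u : Coord m} (hu : u ∈ (extChartAt (𝓡 m) a).target) :
    u ∈ chartMapDomain (n := n) a (φ ((extChartAt (𝓡 m) a).symm u)) φ :=
  ⟨hu, mem_extChartAt_source _⟩

theorem extChartAt_mem_chartMapDomain (φ : M → N) (x : M) :
    extChartAt (𝓡 m) x x ∈ chartMapDomain (n := n) x (φ x) φ :=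
  ⟨mem_extChartAt_target x, by rw [extChartAt_to_inv]; exact mem_extChartAt_source _⟩

theorem tendsto_prodMap_extChartAt (t₀ : ℝ) (x₀ : M) :
    Tendsto (Prod.map id (extChartAt (𝓡 m) x₀)) (𝓝 (t₀, x₀)) (𝓝 (t₀, extChartAt (𝓡 m) x₀ x₀)) :=
  continuousAt_id.prodMap (continuousAt_extChartAt x₀)

/-- A time-dependent map from `M` to `N` in the charts centred at `a` and `b`. -/
def chartFamily (a : M) (b : N) (Φ : ℝ → M → N) (z : ℝ × Coord m) : Coord n :=
  chartMap a b (Φ z.1) z.2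

namespace IsVariation

theorem initial_eq (hΦ : IsVariation (m := m) (n := n) φ D ε Φ) : Φ 0 = φ := funext hΦ.initial

theorem contMDiffAt (hΦ : IsVariation (m := m) (n := n) φ D ε Φ) (ht : t₀ ∈ Ioo (-ε) ε) (x : M) :
    ContMDiffAt (𝓘(ℝ, ℝ).prod (𝓡 m)) (𝓡 n) ∞ (fun z : ℝ × M => Φ z.1 z.2) (t₀, x) :=
  hΦ.smooth.contMDiffAt ((isOpen_Ioo.prod isOpen_univ).mem_nhds ⟨ht, mem_univ x⟩)

theorem contMDiff (hΦ : IsVariation (m := m) (n := n) φ D ε Φ) (ht : t₀ ∈ Ioo (-ε) ε) :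
    ContMDiff (𝓡 m) (𝓡 n) ∞ (Φ t₀) := fun x =>
  ContMDiffAt.comp x (f := fun x : M => (t₀, x)) (hΦ.contMDiffAt ht x)
    (contMDiffAt_const.prodMk contMDiffAt_id)

theorem eventually_mem_chartMapDomain (hΦ : IsVariation (m := m) (n := n) φ D ε Φ)
    (ht : t₀ ∈ Ioo (-ε) ε) (hu : u₀ ∈ chartMapDomain (n := n) a b (Φ t₀)) :
    ∀ᶠ z in 𝓝 (t₀, u₀), z.1 ∈ Ioo (-ε) ε ∧ z.2 ∈ chartMapDomain (n := n) a b (Φ z.1) := by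
  have hmap : ContinuousAt (fun z : ℝ × Coord m => Φ z.1 ((extChartAt (𝓡 m) a).symm z.2))
      (t₀, u₀) :=
    ContinuousAt.comp (g := fun z : ℝ × M => Φ z.1 z.2) (x := (t₀, u₀))
      (f := Prod.map id (extChartAt (𝓡 m) a).symm) (hΦ.contMDiffAt ht _).continuousAt
      (continuousAt_id.prodMap (continuousAt_extChartAt_symm'' hu.1))
  exact (continuousAt_fst.eventually (isOpen_Ioo.mem_nhds ht)).and
    ((continuousAt_snd.eventually (extChartAt_target_mem_nhds' hu.1)).and
      (hmap.eventually ((isOpen_extChartAt_source b).mem_nhds hu.2)))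

end IsVariation

variable [IsManifold (𝓡 m) ∞ M] [IsManifold (𝓡 n) ∞ N]

/-- The squared norm `|τ_p(φ_t)|²` at `x`, as a function of `(t, x)`. -/
def variationPTensionSq (g : SmoothMetric m M) (h : SmoothMetric n N) (p : ℝ) (Φ : ℝ → M → N)
    (z : ℝ × M) : ℝ :=
  pTensionNorm g h p (Φ z.1) z.2 ^ 2

namespace IsVariation

theorem contDiffAt_chartFamily (hΦ : IsVariation (m := m) (n := n) φ D ε Φ)
    (ht : t₀ ∈ Ioo (-ε) ε) (hu : u₀ ∈ chartMapDomain (n := n) a b (Φ t₀)) :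
    ContDiffAt ℝ ∞ (chartFamily (n := n) a b Φ) (t₀, u₀) := by
  have hchart : ContMDiffAt 𝓘(ℝ, ℝ × Coord m) (𝓘(ℝ, ℝ).prod (𝓡 m)) ∞
      (fun z : ℝ × Coord m => (z.1, (extChartAt (𝓡 m) a).symm z.2)) (t₀, u₀) :=
    contDiffAt_fst.contMDiffAt.prodMk
      (ContMDiffAt.comp (t₀, u₀) (f := fun z : ℝ × Coord m => z.2)
        (contMDiffAt_extChartAt_symm hu.1) contDiffAt_snd.contMDiffAt)
  have hmap := ContMDiffAt.comp (t₀, u₀) (g := fun z : ℝ × M => Φ z.1 z.2)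
    (hΦ.contMDiffAt ht ((extChartAt (𝓡 m) a).symm u₀)) hchart
  exact ((contMDiffAt_extChartAt_of_mem hu.2).comp (t₀, u₀) hmap).contDiffAt

variable (g : SmoothMetric m M) (h : SmoothMetric n N)

theorem isSmoothFamily (hΦ : IsVariation (m := m) (n := n) φ D ε Φ) (ht : t₀ ∈ Ioo (-ε) ε)
    (hu : u₀ ∈ chartMapDomain (n := n) a b (Φ t₀)) :
    IsSmoothFamily (chartMetric g a) (chartMetric h b) (chartFamily a b Φ) (t₀, u₀) where
  map := (hΦ.eventually_mem_chartMapDomain ht hu).mono fun _ hz =>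
    hΦ.contDiffAt_chartFamily hz.1 hz.2
  source := by
    filter_upwards [extChartAt_target_mem_nhds' hu.1] with y hy
    exact ⟨contDiffAt_chartMetric g hy, isInnerForm_chartMetric g hy⟩
  target := by
    filter_upwards [extChartAt_target_mem_nhds' (chartMap_mem_target hu)] with y hy
    exact ⟨contDiffAt_chartMetric h hy, isInnerForm_chartMetric h hy⟩

theorem eventually_variationPTensionSq_eq (hΦ : IsVariation (m := m) (n := n) φ D ε Φ)
    (hp : 2 ≤ p) (ht : t₀ ∈ Ioo (-ε) ε) (hu : u₀ ∈ chartMapDomain (n := n) a b (Φ t₀)) :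
    ∀ᶠ z in 𝓝 (t₀, u₀),
      variationPTensionSq g h p Φ (z.1, (extChartAt (𝓡 m) a).symm z.2) =
        familyPTensionSq (chartMetric g a) (chartMetric h b) p (chartFamily a b Φ) z :=
  (hΦ.eventually_mem_chartMapDomain ht hu).mono fun _ hz =>
    pTensionNorm_sq_eq g h hp (hΦ.contMDiff hz.1) hz.2

theorem variationPTensionSq_eventuallyEq (hΦ : IsVariation (m := m) (n := n) φ D ε Φ)
    (hp : 2 ≤ p) (ht : t₀ ∈ Ioo (-ε) ε) (x₀ : M) :
    variationPTensionSq g h p Φ =ᶠ[𝓝 (t₀, x₀)]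
      familyPTensionSq (chartMetric g x₀) (chartMetric h (Φ t₀ x₀)) p
        (chartFamily x₀ (Φ t₀ x₀) Φ) ∘ Prod.map id (extChartAt (𝓡 m) x₀) := by
  filter_upwards [(tendsto_prodMap_extChartAt t₀ x₀).eventually
      (hΦ.eventually_variationPTensionSq_eq g h hp ht (extChartAt_mem_chartMapDomain (Φ t₀) x₀)),
    continuousAt_snd.eventually (extChartAt_source_mem_nhds (I := 𝓡 m) x₀)] with z hz hsource
  rw [Prod.map_fst, Prod.map_snd, (extChartAt (𝓡 m) x₀).left_inv hsource] at hz
  exact hz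

theorem continuousAt_variationPTensionSq (hΦ : IsVariation (m := m) (n := n) φ D ε Φ)
    (hp : 2 ≤ p) (ht : t₀ ∈ Ioo (-ε) ε) (x₀ : M) :
    ContinuousAt (variationPTensionSq g h p Φ) (t₀, x₀) := by
  have hsmooth := hΦ.isSmoothFamily g h ht (extChartAt_mem_chartMapDomain (Φ t₀) x₀)
  exact (ContinuousAt.comp (f := Prod.map id (extChartAt (𝓡 m) x₀))
    (hsmooth.continuousAt_familyPTensionSq hp) (tendsto_prodMap_extChartAt t₀ x₀)).congr
    (hΦ.variationPTensionSq_eventuallyEq g h hp ht x₀).symm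

theorem continuous_pTensionNorm_sq (hΦ : IsVariation (m := m) (n := n) φ D ε Φ) (hp : 2 ≤ p)
    (ht : t₀ ∈ Ioo (-ε) ε) : Continuous fun x => pTensionNorm g h p (Φ t₀) x ^ 2 :=
  continuous_iff_continuousAt.2 fun x =>
    ContinuousAt.comp (f := fun x : M => (t₀, x)) (g := variationPTensionSq g h p Φ)
      (hΦ.continuousAt_variationPTensionSq g h hp ht x) (by fun_prop)

theorem eventually_forall_variationPTensionSq_lt (hΦ : IsVariation (m := m) (n := n) φ D ε Φ)
    (hp : 2 ≤ p) (ht : t₀ ∈ Ioo (-ε) ε) {K : Set M} (hK : IsCompact K) {B : ℝ}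
    (hB : ∀ x ∈ K, variationPTensionSq g h p Φ (t₀, x) < B) :
    ∀ᶠ t in 𝓝 t₀, ∀ x ∈ K, variationPTensionSq g h p Φ (t, x) < B :=
  hK.eventually_forall_of_forall_eventually fun x hx =>
    (hΦ.continuousAt_variationPTensionSq g h hp ht x).eventually_lt continuousAt_const (hB x hx)

theorem variationPTensionSq_sub_isBigO (hΦ : IsVariation (m := m) (n := n) φ D ε Φ) (hp : 2 ≤ p)
    (ht : t₀ ∈ Ioo (-ε) ε) {x₀ : M} (h0 : variationPTensionSq g h p Φ (t₀, x₀) ≠ 0) :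
    (fun z => variationPTensionSq g h p Φ z - variationPTensionSq g h p Φ (t₀, z.2))
      =O[𝓝 (t₀, x₀)] fun z => z.1 - t₀ := by
  have hsmooth := hΦ.isSmoothFamily g h ht (extChartAt_mem_chartMapDomain (Φ t₀) x₀)
  have heq := hΦ.variationPTensionSq_eventuallyEq g h hp ht x₀
  rw [heq.eq_of_nhds] at h0
  have hdiff := (hsmooth.contDiffAt_familyPTensionSq hp h0).of_le (m := 1) ENat.LEInfty.out
  refine ((sub_initial_slice_isBigO hdiff).comp_tendsto
    (tendsto_prodMap_extChartAt t₀ x₀)).congr' ?_ EventuallyEq.rfl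
  filter_upwards [heq, (tendsto_initial_slice t₀ x₀).eventually heq] with z hz hz₀
  rw [hz, hz₀]
  rfl

theorem eventually_familyPTension_eq_zero (hΦ : IsVariation (m := m) (n := n) φ D ε Φ)
    (hp : 2 ≤ p) (ht : t₀ ∈ Ioo (-ε) ε) (hu : u₀ ∈ chartMapDomain (n := n) a b (Φ t₀))
    (h0 : ∀ x, pTensionNorm g h p (Φ t₀) x = 0) :
    ∀ᶠ u in 𝓝 u₀, familyPTension (chartMetric g a) (chartMetric h b) p
      (chartFamily a b Φ) (t₀, u) = 0 := by
  filter_upwards [(tendsto_slice (t₀, u₀)).eventually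
    ((hΦ.eventually_variationPTensionSq_eq g h hp ht hu).and
      (hΦ.isSmoothFamily g h ht hu).eventually)] with u ⟨heq, hsmooth⟩
  by_contra hne
  have hpos := hsmooth.target.self_of_nhds.2.pos _ hne
  rw [variationPTensionSq, h0, zero_pow two_ne_zero] at heq
  exact hpos.ne heq

theorem exists_lintegral_smallSets_le (hΦ : IsVariation (m := m) (n := n) φ D ε Φ) (hε : 0 < ε)
    {γ : ℝ} (hγ : 0 < γ) (hγ' : γ < 1) (hp : 2 ≤ p) (hpγ : p = 2 ∨ 3 - γ ≤ p)
    (hu : u₀ ∈ (extChartAt (𝓡 m) a).target) (h0 : ∀ x, pTensionNorm g h p φ x = 0) :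
    ∃ C ≥ 0, ∀ᶠ U in (𝓝 u₀).smallSets, MeasurableSet U → ∀ᶠ t in 𝓝 0,
      ∫⁻ u in U, ENNReal.ofReal (pTensionNorm g h p (Φ t) ((extChartAt (𝓡 m) a).symm u) ^ 2) ≤
        ENNReal.ofReal (C * |t| ^ (2 - γ)) := by
  have hzero : (0 : ℝ) ∈ Ioo (-ε) ε := ⟨neg_lt_zero.2 hε, hε⟩
  have hmem := mem_chartMapDomain_apply (n := n) (φ := Φ 0) hu
  obtain ⟨C, hC, hint⟩ := (hΦ.isSmoothFamily g h hzero hmem).exists_lintegral_familyPTensionSq_le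
    hγ hγ' hpγ (hΦ.eventually_familyPTension_eq_zero g h hp hzero hmem (by rwa [hΦ.initial_eq]))
  refine ⟨C, hC, ?_⟩
  filter_upwards [hint, eventually_smallSets_eventually_forall
    (hΦ.eventually_variationPTensionSq_eq g h hp hzero hmem)] with U hU heq hUm
  filter_upwards [hU hUm, heq] with t ht heqt
  exact (setLIntegral_congr_fun hUm fun u hu =>
    congrArg ENNReal.ofReal (heqt u hu)).trans_le ht

theorem exists_lintegral_chart_le (hΦ : IsVariation (m := m) (n := n) φ D ε Φ) (hε : 0 < ε)
    {γ : ℝ} (hγ : 0 < γ) (hγ' : γ < 1) (hp : 2 ≤ p) (hpγ : p = 2 ∨ 3 - γ ≤ p)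
    {K : Set (Coord m)} (hK : IsCompact K) (hKa : K ⊆ (extChartAt (𝓡 m) a).target)
    (h0 : ∀ x, pTensionNorm g h p φ x = 0) :
    ∃ C ≥ 0, ∀ᶠ t in 𝓝 0,
      ∫⁻ u in K, ENNReal.ofReal (pTensionNorm g h p (Φ t) ((extChartAt (𝓡 m) a).symm u) ^ 2) ≤
        ENNReal.ofReal (C * |t| ^ (2 - γ)) := by
  refine hK.induction_on ⟨0, le_rfl, by simp⟩ ?_ ?_ fun u₀ hu₀ => ?_
  · rintro s t hst ⟨C, hC, hle⟩
    exact ⟨C, hC, hle.mono fun _ hr => (lintegral_mono_set hst).trans hr⟩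
  · rintro s t ⟨C, hC, hs⟩ ⟨C', hC', ht⟩
    refine ⟨C + C', add_nonneg hC hC', ?_⟩
    filter_upwards [hs, ht] with r hsr htr
    refine (lintegral_union_le _ _ _).trans ?_
    rw [add_mul, ENNReal.ofReal_add (by positivity) (by positivity)]
    exact add_le_add hsr htr
  · obtain ⟨C, hC, hint⟩ := hΦ.exists_lintegral_smallSets_le g h hε hγ hγ' hp hpγ (hKa hu₀) h0
    obtain ⟨S, hS, hSint⟩ := eventually_smallSets.1 hint
    exact ⟨interior S, mem_nhdsWithin_of_mem_nhds (interior_mem_nhds.2 hS), C, hC,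
      hSint _ interior_subset isOpen_interior.measurableSet⟩

end IsVariation

end Variations

section Volume

open Filter Topology
open scoped ENNReal

variable {m : ℕ} {M : Type*} [TopologicalSpace M] [ChartedSpace (EuclideanSpace ℝ (Fin m)) M]
  [IsManifold (𝓡 m) ∞ M]

theorem continuousOn_volumeDensity (g : SmoothMetric m M) (a : M) :
    ContinuousOn (fun u => √(gramMatrix (chartMetric g a u)).det)
      (extChartAt (𝓡 m) a).target := by
  intro u hu
  have hmetric := (contDiffAt_chartMetric g hu).continuousAt
  have hgram : ContinuousAt (fun u => gramMatrix (chartMetric g a u)) u :=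
    continuousAt_pi.2 fun i => continuousAt_pi.2 fun j =>
      (hmetric.clm_apply continuousAt_const).clm_apply continuousAt_const
  exact ((Continuous.matrix_det continuous_id).continuousAt.comp hgram).sqrt.continuousWithinAt

theorem tsupport_chartPartition_subset [T2Space M] [SigmaCompactSpace M] (a : M) :
    tsupport (chartPartition m M a) ⊆ (extChartAt (𝓡 m) a).source := by
  rw [extChartAt_source]
  exact (SmoothPartitionOfUnity.exists_isSubordinate_chartAt_source (𝓡 m) M).choose_spec a

variable [MeasurableSpace M]

theorem exists_lintegral_chartVolume_le (g : SmoothMetric m M) (a : M) {K : Set (Coord m)}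
    (hK : IsCompact K) (hKa : K ⊆ (extChartAt (𝓡 m) a).target) :
    ∃ C : ℝ, ∀ w : M → ℝ≥0∞,
      (∀ u ∈ (extChartAt (𝓡 m) a).target, u ∉ K → w ((extChartAt (𝓡 m) a).symm u) = 0) →
      ∫⁻ x, w x ∂chartVolume g a ≤
        ENNReal.ofReal C * ∫⁻ u in K, w ((extChartAt (𝓡 m) a).symm u) := by
  have hdensity := continuousOn_volumeDensity g a
  obtain ⟨C, hC⟩ := (hK.image_of_continuousOn (hdensity.mono hKa)).bddAbove
  have htarget : MeasurableSet (extChartAt (𝓡 m) a).target :=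
    (isOpen_extChartAt_target (I := 𝓡 m) a).measurableSet
  refine ⟨C, fun w hw => (lintegral_map_le _ _).trans ?_⟩
  rw [lintegral_withDensity_eq_lintegral_mul_non_measurable₀ _
    (hdensity.aemeasurable htarget).ennreal_ofReal
    (Eventually.of_forall fun u => ENNReal.ofReal_lt_top),
    ← lintegral_const_mul' _ _ ENNReal.ofReal_ne_top, ← lintegral_indicator htarget,
    ← lintegral_indicator hK.measurableSet]
  refine lintegral_mono fun u => ?_
  by_cases hu : u ∈ K
  · rw [indicator_of_mem (hKa hu), indicator_of_mem hu]
    exact mul_le_mul_left (ENNReal.ofReal_le_ofReal (hC ⟨u, hu, rfl⟩)) _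
  by_cases hu' : u ∈ (extChartAt (𝓡 m) a).target
  · rw [indicator_of_mem hu']
    exact (mul_eq_zero_of_right _ (hw u hu' hu)).trans_le zero_le
  · rw [indicator_of_notMem hu']
    exact zero_le

variable [T2Space M] [SigmaCompactSpace M] [BorelSpace M]

theorem lintegral_withDensity_chartPartition (ν : Measure M) (a : M) (w : M → ℝ≥0∞) :
    ∫⁻ x, w x ∂ν.withDensity (fun x => ENNReal.ofReal (chartPartition m M a x)) =
      ∫⁻ x, ENNReal.ofReal (chartPartition m M a x) * w x ∂ν :=
  lintegral_withDensity_eq_lintegral_mul_non_measurable₀ _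
    (chartPartition m M a).contMDiff.continuous.measurable.ennreal_ofReal.aemeasurable
    (Eventually.of_forall fun _ => ENNReal.ofReal_lt_top) w

theorem exists_setLIntegral_riemannianVolume_eq_sum (g : SmoothMetric m M) {D : Set M}
    (hD : IsCompact D) :
    ∃ S : Finset M, ∀ w : M → ℝ≥0∞, ∫⁻ x in D, w x ∂riemannianVolume g =
      ∑ a ∈ S,
        ∫⁻ x, ENNReal.ofReal (chartPartition m M a x) * D.indicator w x ∂chartVolume g a := by
  have hfinite := (chartPartition m M).locallyFinite.finite_nonempty_inter_compact hD
  refine ⟨hfinite.toFinset, fun w => ?_⟩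
  rw [← lintegral_indicator hD.measurableSet, riemannianVolume, lintegral_sum_measure, tsum_eq_sum]
  · exact Finset.sum_congr rfl fun a _ => lintegral_withDensity_chartPartition _ a _
  · intro a ha
    rw [lintegral_withDensity_chartPartition, lintegral_eq_zero_of_ae_eq_zero]
    refine Eventually.of_forall fun x => ?_
    rw [Pi.zero_apply, mul_eq_zero, or_iff_not_imp_right, ← Ne, Set.indicator_apply_ne_zero]
    intro hx
    by_contra hne
    refine ha (hfinite.mem_toFinset.2 ⟨x, fun h0 => hne ?_, hx.1⟩)
    rw [h0, ENNReal.ofReal_zero]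

theorem exists_setLIntegral_riemannianVolume_le (g : SmoothMetric m M) {D : Set M}
    (hD : IsCompact D) :
    ∃ (S : Finset M) (K : M → Set (Coord m)) (C : M → ℝ),
      (∀ a, IsCompact (K a) ∧ K a ⊆ (extChartAt (𝓡 m) a).target) ∧
      ∀ w : M → ℝ≥0∞, ∫⁻ x in D, w x ∂riemannianVolume g ≤
        ∑ a ∈ S, ENNReal.ofReal (C a) * ∫⁻ u in K a, w ((extChartAt (𝓡 m) a).symm u) := by
  let K : M → Set (Coord m) := fun a => extChartAt (𝓡 m) a '' (D ∩ tsupport (chartPartition m M a))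
  have hsource : ∀ a, D ∩ tsupport (chartPartition m M a) ⊆ (extChartAt (𝓡 m) a).source :=
    fun a => inter_subset_right.trans (tsupport_chartPartition_subset a)
  have hK : ∀ a, IsCompact (K a) ∧ K a ⊆ (extChartAt (𝓡 m) a).target := fun a =>
    ⟨(hD.inter_right (isClosed_tsupport _)).image_of_continuousOn
      ((continuousOn_extChartAt a).mono (hsource a)),
      (image_mono (hsource a)).trans_eq (extChartAt (𝓡 m) a).image_source_eq_target⟩
  choose C hC using fun a => exists_lintegral_chartVolume_le g a (hK a).1 (hK a).2
  obtain ⟨S, hS⟩ := exists_setLIntegral_riemannianVolume_eq_sum g hD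
  refine ⟨S, K, C, hK, fun w => (hS w).trans_le ?_⟩
  refine Finset.sum_le_sum fun a _ => (hC a _ fun u hu huK => ?_).trans ?_
  · by_contra hne
    obtain ⟨hpartition, hw⟩ := mul_ne_zero_iff.1 hne
    refine huK ⟨_, ⟨mem_of_indicator_ne_zero hw, subset_tsupport _ fun h0 => hpartition ?_⟩,
      (extChartAt (𝓡 m) a).right_inv hu⟩
    rw [h0, ENNReal.ofReal_zero]
  · gcongr with u
    exact (mul_le_of_le_one_left zero_le
      (ENNReal.ofReal_le_one.2 ((chartPartition m M).le_one a _))).trans (indicator_le_self _ _ _)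

instance isFiniteMeasureOnCompacts_riemannianVolume (g : SmoothMetric m M) :
    IsFiniteMeasureOnCompacts (riemannianVolume g) where
  lt_top_of_isCompact D hD := by
    obtain ⟨S, K, C, hK, hint⟩ := exists_setLIntegral_riemannianVolume_le g hD
    rw [← setLIntegral_one]
    refine (hint fun _ => 1).trans_lt (ENNReal.sum_lt_top.2 fun a _ => ?_)
    rw [setLIntegral_one]
    exact ENNReal.mul_lt_top ENNReal.ofReal_lt_top (hK a).1.measure_lt_top

end Volume

section RealAnalysis

open Filter Topology Asymptotics

theorem hasDerivAt_zero_of_isBigO_rpow {F : ℝ → ℝ} {η : ℝ} (hη : 1 < η)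
    (hF : (fun t => F t - F 0) =O[𝓝 0] fun t => |t| ^ η) : HasDerivAt F 0 0 := by
  have hlittle : (fun t : ℝ => |t| ^ (η - 1)) =o[𝓝 0] fun _ => (1 : ℝ) := by
    rw [isLittleO_one_iff]
    have htendsto := (continuous_abs.tendsto (0 : ℝ)).rpow_const (p := η - 1)
      (Or.inr (by linarith))
    rwa [abs_zero, Real.zero_rpow (by linarith)] at htendsto
  have hmul := (hlittle.mul_isBigO (isBigO_refl (fun t : ℝ => |t|) (𝓝 0))).congr_right
    fun t => one_mul |t|
  rw [hasDerivAt_iff_isLittleO]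
  simp only [smul_zero, sub_zero]
  refine hF.trans_isLittleO ((hmul.congr_left fun t => ?_).of_abs_right)
  rcases eq_or_ne t 0 with rfl | ht
  · rw [abs_zero, mul_zero, Real.zero_rpow (by linarith)]
  · rw [← Real.rpow_add_one (abs_pos.2 ht).ne', sub_add_cancel]

theorem hasDerivAt_setIntegral_comp_of_isBigO {X : Type*} [MeasurableSpace X] {ν : Measure X}
    {D : Set X} (hν : ν D < ⊤) {R : ℝ → ℝ} {y₀ : ℝ} (hR : HasDerivAt R 0 y₀)
    {f : ℝ × X → ℝ} (hf₀ : ∀ x ∈ D, f (0, x) = y₀)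
    (hf : (fun z => f z - f (0, z.2)) =O[𝓝 0 ×ˢ 𝓟 D] Prod.fst)
    (hint : ∀ᶠ t in 𝓝 0, IntegrableOn (fun x => R (f (t, x))) D ν) :
    HasDerivAt (fun t => ∫ x in D, R (f (t, x)) ∂ν) 0 0 := by
  have hbase : ∀ᶠ z in 𝓝 (0 : ℝ) ×ˢ 𝓟 D, f (0, z.2) = y₀ :=
    tendsto_snd.eventually (eventually_principal.2 hf₀)
  have hsub : (fun z => f z - y₀) =O[𝓝 0 ×ˢ 𝓟 D] Prod.fst :=
    hf.congr' (hbase.mono fun z hz => congrArg (f z - ·) hz) EventuallyEq.rfl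
  have htendsto : Tendsto f (𝓝 0 ×ˢ 𝓟 D) (𝓝 y₀) :=
    tendsto_sub_nhds_zero_iff.1 (hsub.trans_tendsto tendsto_fst)
  have hlittle : (fun z => R (f z) - R y₀) =o[𝓝 0 ×ˢ 𝓟 D] Prod.fst := by
    have hcomp := hR.isLittleO.comp_tendsto htendsto
    simp only [Function.comp_def, smul_zero, sub_zero] at hcomp
    exact hcomp.trans_isBigO hsub
  rw [hasDerivAt_iff_isLittleO]
  simp only [smul_zero, sub_zero]
  refine IsLittleO.trans_isBigO (g := fun t => ν.real D * t) ?_ (isBigO_const_mul_self _ _ _)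
  refine isLittleO_iff.2 fun c hc => ?_
  filter_upwards [hint, eventually_prod_principal_iff.1 (hlittle.def hc)] with t hintt hle
  have hconst : IntegrableOn (fun x => R (f (0, x))) D ν := hint.self_of_nhds
  rw [← integral_sub hintt hconst]
  refine (norm_setIntegral_le_of_norm_le_const (C := c * ‖t‖) hν fun x hx => ?_).trans_eq ?_
  · rw [hf₀ x hx]
    exact hle x hx
  · rw [norm_mul, Real.norm_of_nonneg measureReal_nonneg]
    ring

theorem hasDerivAt_rpow_half_sub {q r s : ℝ} (hq : q ≠ 0) (hr : r ≠ 0) (hs : 0 < s) :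
    HasDerivAt (fun y => 1 / q * y ^ (q / 2) - s ^ (q - r) * (1 / r * y ^ (r / 2))) 0 (s ^ 2) := by
  have hrpow : ∀ k : ℝ, (s ^ 2) ^ (k / 2 - 1) = s ^ (k - 2) := fun k => by
    rw [← Real.rpow_natCast, ← Real.rpow_mul hs.le]
    ring_nf
  have hderiv : ∀ k : ℝ, k ≠ 0 →
      HasDerivAt (fun y => 1 / k * y ^ (k / 2)) (1 / 2 * s ^ (k - 2)) (s ^ 2) := fun k hk => by
    refine ((Real.hasDerivAt_rpow_const (p := k / 2)
      (Or.inl (pow_pos hs 2).ne')).const_mul (1 / k)).congr_deriv ?_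
    rw [hrpow]
    field_simp
  refine ((hderiv q hq).sub ((hderiv r hr).const_mul (s ^ (q - r)))).congr_deriv ?_
  rw [mul_left_comm, ← Real.rpow_add hs, sub_add_sub_cancel, sub_self]

end RealAnalysis

section Harmonic

open Filter Topology Asymptotics
open scoped ENNReal

variable {m n : ℕ}
  {M : Type*} [TopologicalSpace M] [ChartedSpace (EuclideanSpace ℝ (Fin m)) M]
  [IsManifold (𝓡 m) ∞ M]
  {N : Type*} [TopologicalSpace N] [ChartedSpace (EuclideanSpace ℝ (Fin n)) N]
  [IsManifold (𝓡 n) ∞ N]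
  {φ : M → N} {D : Set M} {ε : ℝ} {Φ : ℝ → M → N} {p q r s : ℝ}
  (g : SmoothMetric m M) (h : SmoothMetric n N)

theorem pTensionNorm_nonneg (p : ℝ) (φ : M → N) (x : M) : 0 ≤ pTensionNorm g h p φ x :=
  Real.sqrt_nonneg _

theorem pTensionNorm_rpow_eq (p q : ℝ) (φ : M → N) (x : M) :
    pTensionNorm g h p φ x ^ q = (pTensionNorm g h p φ x ^ 2) ^ (q / 2) := by
  rw [← Real.rpow_natCast, ← Real.rpow_mul (pTensionNorm_nonneg g h p φ x)]
  ring_nf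

theorem exists_pTensionNorm_eq (hqr : q ≠ r)
    (hconst : ∃ c : ℝ, ∀ x : M, pTensionNorm g h p φ x ^ (q - r) = c) :
    ∃ s ≥ 0, ∀ x, pTensionNorm g h p φ x = s := by
  obtain ⟨c, hc⟩ := hconst
  rcases isEmpty_or_nonempty M with hM | ⟨⟨x₀⟩⟩
  · exact ⟨0, le_rfl, fun x => hM.elim x⟩
  refine ⟨_, pTensionNorm_nonneg g h p φ x₀, fun x => ?_⟩
  exact (Real.rpow_left_inj (pTensionNorm_nonneg g h p φ x) (pTensionNorm_nonneg g h p φ x₀)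
    (sub_ne_zero.2 hqr)).1 ((hc x).trans (hc x₀).symm)

theorem IsVariation.eventually_pTensionNorm_le_one (hp : 2 ≤ p)
    (hΦ : IsVariation (m := m) (n := n) φ D ε Φ) (hε : 0 < ε) (hD : IsCompact D)
    (h0 : ∀ x ∈ D, pTensionNorm g h p φ x < 1) :
    ∀ᶠ t in 𝓝 (0 : ℝ), ∀ x ∈ D, pTensionNorm g h p (Φ t) x ≤ 1 := by
  filter_upwards [hΦ.eventually_forall_variationPTensionSq_lt g h hp ⟨neg_lt_zero.2 hε, hε⟩ hD
    (B := 1) fun x hx => by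
      rw [variationPTensionSq, hΦ.initial_eq]
      exact pow_lt_one₀ (pTensionNorm_nonneg g h p φ x) (h0 x hx) two_ne_zero] with t ht x hx
  exact ((sq_lt_one_iff₀ (pTensionNorm_nonneg g h p (Φ t) x)).1 (ht x hx)).le

variable [T2Space M] [SigmaCompactSpace M] [MeasurableSpace M]

theorem biPEnergy_eq_pqEnergy (p : ℝ) : biPEnergy g h p = pqEnergy g h p 2 := by
  funext φ D
  simp only [biPEnergy, pqEnergy, Real.rpow_two]

theorem pqEnergy_nonneg (p : ℝ) (hq : 0 ≤ q) (φ : M → N) (D : Set M) :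
    0 ≤ pqEnergy g h p q φ D :=
  mul_nonneg (one_div_nonneg.2 hq)
    (integral_nonneg fun x => Real.rpow_nonneg (pTensionNorm_nonneg g h p φ x) q)

theorem pqEnergy_le_of_pTensionNorm_le_one (hq : 2 ≤ q) (hD : MeasurableSet D)
    (hφ : ∀ x ∈ D, pTensionNorm g h p φ x ≤ 1) {c : ℝ} (hc : 0 ≤ c)
    (hint : ∫⁻ x in D, ENNReal.ofReal (pTensionNorm g h p φ x ^ 2) ∂riemannianVolume g ≤
      ENNReal.ofReal c) :
    pqEnergy g h p q φ D ≤ 1 / q * c := by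
  refine mul_le_mul_of_nonneg_left ?_ (by positivity)
  refine (Real.le_norm_self _).trans ((norm_integral_le_lintegral_norm _).trans
    (ENNReal.toReal_le_of_le_ofReal hc (le_trans ?_ hint)))
  refine setLIntegral_mono' hD fun x hx => ENNReal.ofReal_le_ofReal ?_
  have hnonneg := pTensionNorm_nonneg g h p φ x
  rw [Real.norm_of_nonneg (Real.rpow_nonneg hnonneg q), ← Real.rpow_two]
  exact Real.rpow_le_rpow_of_exponent_ge' hnonneg (hφ x hx) zero_le_two hq

variable [BorelSpace M]

namespace IsVariation

theorem exists_setLIntegral_pTensionNorm_sq_le (hp : 2 ≤ p)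
    (hΦ : IsVariation (m := m) (n := n) φ D ε Φ) (hε : 0 < ε) (hD : IsCompact D)
    (h0 : ∀ x, pTensionNorm g h p φ x = 0) :
    ∃ η > (1 : ℝ), ∃ C ≥ 0, ∀ᶠ t in 𝓝 (0 : ℝ),
      ∫⁻ x in D, ENNReal.ofReal (pTensionNorm g h p (Φ t) x ^ 2) ∂riemannianVolume g ≤
        ENNReal.ofReal (C * |t| ^ η) := by
  obtain ⟨γ, hγ, hγ', hpγ⟩ : ∃ γ : ℝ, 0 < γ ∧ γ < 1 ∧ (p = 2 ∨ 3 - γ ≤ p) := by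
    rcases eq_or_lt_of_le hp with rfl | hp
    · exact ⟨1 / 2, by norm_num, by norm_num, Or.inl rfl⟩
    · exact ⟨max (1 / 2) (3 - p), lt_max_of_lt_left (by norm_num),
        max_lt (by norm_num) (by linarith), Or.inr (by linarith [le_max_right (1 / 2) (3 - p)])⟩
  obtain ⟨S, K, A, hK, hsum⟩ := exists_setLIntegral_riemannianVolume_le g hD
  choose C hC hchart using fun a =>
    hΦ.exists_lintegral_chart_le g h hε hγ hγ' hp hpγ (hK a).1 (hK a).2 h0
  have hnonneg : ∀ a, 0 ≤ max (A a) 0 * C a := fun a => mul_nonneg (le_max_right _ _) (hC a)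
  refine ⟨2 - γ, by linarith, ∑ a ∈ S, max (A a) 0 * C a,
    Finset.sum_nonneg fun a _ => hnonneg a, ?_⟩
  filter_upwards [(Finset.eventually_all S).2 fun a _ => hchart a] with t ht
  refine (hsum _).trans ?_
  rw [Finset.sum_mul, ENNReal.ofReal_sum_of_nonneg fun a _ =>
    mul_nonneg (hnonneg a) (Real.rpow_nonneg (abs_nonneg t) _)]
  refine Finset.sum_le_sum fun a ha => ?_
  rw [mul_assoc, ENNReal.ofReal_mul (le_max_right _ _)]
  exact mul_le_mul' (ENNReal.ofReal_le_ofReal (le_max_left _ _)) (ht a ha)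

theorem integrableOn_pTensionNorm_sq_rpow (hp : 2 ≤ p) (hq : 0 ≤ q)
    (hΦ : IsVariation (m := m) (n := n) φ D ε Φ) (hD : IsCompact D) {t : ℝ}
    (ht : t ∈ Ioo (-ε) ε) :
    IntegrableOn (fun x => (pTensionNorm g h p (Φ t) x ^ 2) ^ q) D (riemannianVolume g) :=
  ((hΦ.continuous_pTensionNorm_sq g h hp ht).rpow_const fun _ =>
    Or.inr hq).continuousOn.integrableOn_compact hD

theorem hasDerivAt_pqEnergy_sub (hp : 2 ≤ p) (hq : 0 < q) (hr : 0 < r)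
    (hΦ : IsVariation (m := m) (n := n) φ D ε Φ) (hε : 0 < ε) (hD : IsCompact D) (hs : 0 < s)
    (hτ : ∀ x, pTensionNorm g h p φ x = s) :
    HasDerivAt (fun t => pqEnergy g h p q (Φ t) D - s ^ (q - r) * pqEnergy g h p r (Φ t) D)
      0 0 := by
  have hzero : (0 : ℝ) ∈ Ioo (-ε) ε := ⟨neg_lt_zero.2 hε, hε⟩
  have hint : ∀ t ∈ Ioo (-ε) ε, ∀ k > 0, IntegrableOn
      (fun x => 1 / k * (pTensionNorm g h p (Φ t) x ^ 2) ^ (k / 2)) D (riemannianVolume g) :=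
    fun t ht k hk =>
      (hΦ.integrableOn_pTensionNorm_sq_rpow g h hp (half_pos hk).le hD ht).const_mul _
  have hinitial : ∀ x, variationPTensionSq g h p Φ (0, x) = s ^ 2 := fun x => by
    rw [variationPTensionSq, hΦ.initial_eq, hτ]
  have hbigO := isBigO_of_isCompact (w := fun t : ℝ => t - 0) hD fun x _ =>
    hΦ.variationPTensionSq_sub_isBigO g h hp hzero (x₀ := x) (by rw [hinitial]; positivity)
  simp only [sub_zero] at hbigO
  refine (hasDerivAt_setIntegral_comp_of_isBigO (ν := riemannianVolume g) hD.measure_lt_top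
    (hasDerivAt_rpow_half_sub hq.ne' hr.ne' hs) (fun x _ => hinitial x)
    hbigO ?_).congr_of_eventuallyEq ?_
  all_goals filter_upwards [Ioo_mem_nhds (neg_lt_zero.2 hε) hε] with t ht
  · exact (hint t ht q hq).sub ((hint t ht r hr).const_mul _)
  · simp only [pqEnergy, pTensionNorm_rpow_eq g h p q, pTensionNorm_rpow_eq g h p r,
      variationPTensionSq]
    rw [integral_sub (hint t ht q hq) ((hint t ht r hr).const_mul _), integral_const_mul,
      integral_const_mul, integral_const_mul]

end IsVariation

theorem isPQHarmonic_of_pTensionNorm_eq_zero (hp : 2 ≤ p) (hq : 2 ≤ q)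
    (h0 : ∀ x, pTensionNorm g h p φ x = 0) : IsPQHarmonic g h p q φ := by
  intro D hD ε hε Φ hΦ
  obtain ⟨η, hη, C, hC, hdecay⟩ := hΦ.exists_setLIntegral_pTensionNorm_sq_le g h hp hε hD h0
  have hinitial : pqEnergy g h p q (Φ 0) D = 0 := by
    simp [pqEnergy, hΦ.initial_eq, h0, Real.zero_rpow (by linarith : q ≠ 0)]
  refine hasDerivAt_zero_of_isBigO_rpow hη (IsBigO.of_bound (1 / q * C) ?_)
  filter_upwards [hdecay, hΦ.eventually_pTensionNorm_le_one g h hp hε hD fun x _ =>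
    (h0 x).trans_lt one_pos] with t ht hle
  rw [hinitial, sub_zero, Real.norm_of_nonneg (pqEnergy_nonneg g h p (by linarith) _ _),
    Real.norm_of_nonneg (by positivity), mul_assoc]
  exact pqEnergy_le_of_pTensionNorm_le_one g h hq hD.measurableSet hle (by positivity) ht

theorem IsPQHarmonic.of_pTensionNorm_eq_const (hp : 2 ≤ p) (hq : 0 < q) (hr : 0 < r) (hs : 0 < s)
    (hτ : ∀ x, pTensionNorm g h p φ x = s) (hφ : IsPQHarmonic g h p r φ) :
    IsPQHarmonic g h p q φ := by
  intro D hD ε hε Φ hΦ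
  have hsub := hΦ.hasDerivAt_pqEnergy_sub g h hp hq hr hε hD hs hτ
  simpa [Pi.add_def] using hsub.add ((hφ D hD ε hε Φ hΦ).const_mul (s ^ (q - r)))

theorem mainTheorem2_general (hp : 2 ≤ p) (hq : 2 ≤ q) (hr : 2 ≤ r)
    (hconst : ∃ c : ℝ, ∀ x : M, pTensionNorm g h p φ x ^ (q - r) = c) :
    IsPQHarmonic g h p q φ ↔ IsPQHarmonic g h p r φ := by
  rcases eq_or_ne q r with rfl | hqr
  · rfl
  obtain ⟨s, hs, hτ⟩ := exists_pTensionNorm_eq g h hqr hconst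
  rcases hs.eq_or_lt' with rfl | hs
  · exact iff_of_true (isPQHarmonic_of_pTensionNorm_eq_zero g h hp hq hτ)
      (isPQHarmonic_of_pTensionNorm_eq_zero g h hp hr hτ)
  · have hq0 : 0 < q := by linarith
    have hr0 : 0 < r := by linarith
    exact ⟨.of_pTensionNorm_eq_const g h hp hr0 hq0 hs hτ,
      .of_pTensionNorm_eq_const g h hp hq0 hr0 hs hτ⟩

end Harmonic

end

theorem mainTheorem2 {m n : ℕ}
    {M : Type*} [TopologicalSpace M] [ChartedSpace (EuclideanSpace ℝ (Fin m)) M]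
    [IsManifold (𝓡 m) ∞ M] [T2Space M] [SigmaCompactSpace M] [MeasurableSpace M] [BorelSpace M]
    {N : Type*} [TopologicalSpace N] [ChartedSpace (EuclideanSpace ℝ (Fin n)) N]
    [IsManifold (𝓡 n) ∞ N] [T2Space N] [SigmaCompactSpace N]
    (g : SmoothMetric m M) (h : SmoothMetric n N)
    (p q : ℝ) (hp : 2 ≤ p) (hq : 2 ≤ q)
    (φ : M → N) (hφ : ContMDiff (𝓡 m) (𝓡 n) ∞ φ)
    (hconst : ∃ c : ℝ, ∀ x : M, pTensionNorm g h p φ x ^ (q - 2) = c) :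
    IsPQHarmonic g h p q φ ↔ IsBiPHarmonic g h p φ := by
  rw [IsBiPHarmonic, biPEnergy_eq_pqEnergy]
  exact mainTheorem2_general g h hp hq le_rfl hconst
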